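/- Let $(M,g)$ be a closed (compact, without boundary) smooth Riemannian manifold of dimension $n$ with a fixed spin structure, and let $\Sigma_gM\to M$ be its complex spinor bundle, of complex rank $2^{\lfloor n/2\rfloor}$, regarded as a real vector bundle with its fibrewise Euclidean inner product and its spin connection. Let $\nabla^g$ be the induced connection on the bundle $\mathrm{End}(\Sigma_gM)$ of real endomorphisms. For $n<p<\infty$ (and $p\ge 1$) let $W^{1,p}(M,\mathrm{End}(\Sigma_gM))$ be the space of sections $F\in L^p$ whose weak covariant derivative $\nabla^gF$ lies in $L^p$, with the norm $\|F\|_{L^p}+\|\nabla^gF\|_{L^p}$. For $0<\Lambda_1\le\Lambda_2$ let $\mathcal P_{\Lambda_1,\Lambda_2}$ be the set of all $A\in W^{1,p}(M,\mathrm{End}(\Sigma_gM))$ such that, for almost every $x\in M$, $A(x)=A(x)^*$ and $\Lambda_1\mathrm{Id}\le A(x)\le\Lambda_2\mathrm{Id}$. Let $I\subset\mathbb R$ be an interval and let $I\ni t\mapsto A_t\in\mathcal P_{\Lambda_1,\Lambda_2}$ be of class $C^1$ as a map into $W^{1,p}(M,\mathrm{End}(\Sigma_gM))$, with derivative $\dot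 A_t$. Let $S_t=A_t^{1/2}$ be the fibrewise positive square root and $Q_t=A_t^{-1/2}=S_t^{-1}$. Then $S_t$ and $Q_t$ belong to $W^{1,p}(M,\mathrm{End}(\Sigma_gM))$, and the maps $t\mapsto S_t$ and $t\mapsto Q_t$ are of class $C^1$ as maps $I\to W^{1,p}(M,\mathrm{End}(\Sigma_gM))$. For every $t\in I$ and almost every $x\in M$, $\dot S_t(x)$ is the unique endomorphism $X$ of the fibre of $\Sigma_gM$ at $x$ that solves the Sylvester equation $$S_t(x)\,X+X\,S_t(x)=\dot A_t(x),$$ and $\dot Q_t(x)=-Q_t(x)\,\dot S_t(x)\,Q_t(x)$. -/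

import Mathlib

set_option maxSynthPendingDepth 3

open Set Filter MeasureTheory Bundle Topology
open scoped Manifold ContDiff ENNReal

-- Without this, instance search endows `EuclideanSpace ℝ (Fin n)` with a charted space structure
-- obtained by unfolding it as an object of `TopCat`.
attribute [instance 2000] chartedSpaceSelf

namespace SpinGeom

/-! ### Clifford algebra and spinor representation -/

/-- Euclidean `n`-space. -/
abbrev E (n : ℕ) : Type := EuclideanSpace ℝ (Fin n)

/-- Endomorphisms of the space `V` of spinors regarded as a real Euclidean space, with the operator
norm. -/
abbrev EndSpinor (V : Type*) [NormedAddCommGroup V] [InnerProductSpace ℝ V] : Type _ := V →L[ℝ] V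

/-- The form `v ↦ -|v|²`, so that `v² = -|v|²` in its Clifford algebra. -/
noncomputable def cliffordForm (n : ℕ) : QuadraticForm ℝ (E n) :=
  -LinearMap.BilinMap.toQuadraticMap (innerₗ (E n))

/-- A complex spinor representation of the Clifford algebra of `ℝⁿ`: a Hermitian space of complex
dimension `2^⌊n/2⌋` on which vectors act by skew-adjoint complex linear maps (the representation is
irreducible by its dimension). The Hermitian space is given as the underlying real Euclidean space
`V` with its orthogonal complex structure `J`. -/
structure SpinorRep (n : ℕ) (V : Type*) [NormedAddCommGroup V] [InnerProductSpace ℝ V] where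
  finrank_eq : Module.finrank ℝ V = 2 * 2 ^ (n / 2)
  J : EndSpinor V
  J_sq : J * J = -1
  J_skew : ∀ ψ φ : V, inner ℝ (J ψ) φ = -inner ℝ ψ (J φ)
  γ : E n →ₗ[ℝ] EndSpinor V
  sq : ∀ v, γ v * γ v = algebraMap ℝ (EndSpinor V) (cliffordForm n v)
  comm_J : ∀ v, γ v * J = J * γ v
  skew : ∀ v (ψ φ : V), inner ℝ (γ v ψ) φ = -inner ℝ ψ (γ v φ)

/-- The action of the whole Clifford algebra on spinors. -/
noncomputable def SpinorRep.ρ {n : ℕ} {V : Type*} [NormedAddCommGroup V] [InnerProductSpace ℝ V]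
    (κ : SpinorRep n V) : CliffordAlgebra (cliffordForm n) →ₐ[ℝ] EndSpinor V :=
  CliffordAlgebra.lift (cliffordForm n) ⟨κ.γ, κ.sq⟩

/-- Smooth Riemannian metrics on `M`. -/
abbrev RMetric (n : ℕ) (M : Type*) [TopologicalSpace M] [ChartedSpace (E n) M]
    [IsManifold (𝓡 n) ∞ M] : Type _ :=
  ContMDiffRiemannianMetric (𝓡 n) ∞ (E n) (fun x : M => TangentSpace (𝓡 n) x)

/-- A spin structure on `(M, g)`, given by a countable open cover with smooth orthonormal frames
whose transition functions come with a cocycle of smooth lifts to `Spin(n)`. If `ẽᵢ` is the lift of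
the frame `eᵢ`, then `ẽⱼ = ẽᵢ · lift i j`. (An orientation is part of the data, as `Spin(n)` acts
through `SO(n)`.) -/
structure SpinStructure {n : ℕ} {M : Type*} [TopologicalSpace M] [ChartedSpace (E n) M]
    [IsManifold (𝓡 n) ∞ M] (g : RMetric n M) where
  U : ℕ → Set M
  isOpen_U : ∀ i, IsOpen (U i)
  cover : ∀ x, ∃ i, x ∈ U i
  frame : ℕ → Fin n → (x : M) → TangentSpace (𝓡 n) x
  smooth_frame : ∀ i a, ContMDiffOn (𝓡 n) (𝓡 n).tangent ∞
    (fun x => (⟨x, frame i a x⟩ : TangentBundle (𝓡 n) M)) (U i)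
  orthonormal : ∀ i, ∀ x ∈ U i, ∀ a b,
    g.inner x (frame i a x) (frame i b x) = if a = b then 1 else 0
  lift : ℕ → ℕ → M → spinGroup (cliffordForm n)
  smooth_lift : ∀ i j (l : CliffordAlgebra (cliffordForm n) →ₗ[ℝ] ℝ),
    ContMDiffOn (𝓡 n) 𝓘(ℝ, ℝ) ∞
      (fun x => l (lift i j x : CliffordAlgebra (cliffordForm n))) (U i ∩ U j)
  cocycle : ∀ i j k, ∀ x ∈ U i ∩ U j ∩ U k, lift i j x * lift j k x = lift i k x
  /-- `lift i j` acts on `ℝⁿ` by conjugation as the matrix of the frame `eⱼ` in the frame `eᵢ`. -/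
  lift_frame : ∀ i j, ∀ x ∈ U i ∩ U j, ∀ b : Fin n,
    (lift i j x : CliffordAlgebra (cliffordForm n)) *
        CliffordAlgebra.ι (cliffordForm n) (EuclideanSpace.single b 1) =
      CliffordAlgebra.ι (cliffordForm n)
          (WithLp.toLp 2 fun a => g.inner x (frame i a x) (frame j b x)) *
        (lift i j x : CliffordAlgebra (cliffordForm n))

section

variable {n : ℕ} {M : Type*} [TopologicalSpace M] [ChartedSpace (E n) M]
  [IsManifold (𝓡 n) ∞ M]

/-! ### Riemannian volume -/

/-- The derivative at `y` of the inverse of the chart `φ`; it maps the `k`-th basis vector to the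
coordinate field `∂ₖ`. -/
noncomputable def coordVec (φ : OpenPartialHomeomorph M (E n)) (y v : E n) :
    TangentSpace (𝓡 n) (φ.symm y) :=
  mfderiv (𝓡 n) (𝓡 n) φ.symm y v

/-- The density `√det(g(∂ₐ, ∂_b))` in the chart `φ`. -/
noncomputable def volDensity (g : RMetric n M) (φ : OpenPartialHomeomorph M (E n)) (y : E n) : ℝ :=
  √(Matrix.det (Matrix.of fun a b : Fin n =>
    g.inner (φ.symm y) (coordVec φ y (EuclideanSpace.single a 1))
      (coordVec φ y (EuclideanSpace.single b 1))))

/-- The Riemannian volume measure: the least measure dominating, for every chart `φ`, the measure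
which is `√det g dy` in `φ`. All of the latter are restrictions of one measure to chart domains, so
that this is the measure given by `√det g dy` in every chart. -/
noncomputable def vol [MeasurableSpace M] (g : RMetric n M) : Measure M :=
  ⨆ φ ∈ atlas (E n) M, Measure.map φ.symm
    ((volume.restrict φ.target).withDensity fun y => ENNReal.ofReal (volDensity g φ y))

theorem continuousOn_gram (g : RMetric n M) {φ : OpenPartialHomeomorph M (E n)}
    (hφ : φ ∈ atlas (E n) M) (v w : E n) :
    ContinuousOn (fun y => g.inner (φ.symm y) (coordVec φ y v) (coordVec φ y w)) φ.target := by
  let : RiemannianBundle (fun x : M => TangentSpace (𝓡 n) x) := ⟨g.toRiemannianMetric⟩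
  have hs : ContMDiffOn (𝓡 n) (𝓡 n) ∞ φ.symm φ.target :=
    contMDiffOn_symm_of_mem_maximalAtlas (IsManifold.subset_maximalAtlas hφ)
  have ht : ∀ u : E n, ContMDiffOn (𝓡 n) (𝓡 n).tangent 0
      (fun y => (⟨φ.symm y, coordVec φ y u⟩ : TangentBundle (𝓡 n) M)) φ.target := by
    intro u
    have h1 := hs.contMDiffOn_tangentMapWithin (m := 0) (by simp)
      φ.open_target.uniqueMDiffOn
    have h2 : ContMDiff (𝓡 n) (𝓡 n).tangent 0
        (fun y : E n => (⟨y, u⟩ : TangentBundle (𝓡 n) (E n))) :=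
      (contMDiff_vectorSpace_iff_contDiff (V := fun _ : E n => u)).2 contDiff_const
    refine (h1.comp h2.contMDiffOn (fun y hy => hy)).congr ?_
    intro y hy
    simp only [Function.comp_apply, tangentMapWithin, coordVec]
    rw [mfderivWithin_of_isOpen φ.open_target hy]
  exact ((ht v).inner_bundle (ht w)).continuousOn

theorem volDensity_pos (g : RMetric n M) {φ : OpenPartialHomeomorph M (E n)}
    (hφ : φ ∈ atlas (E n) M) {y : E n} (hy : y ∈ φ.target) : 0 < volDensity g φ y := by
  have hinj : Function.Injective (mfderiv (𝓡 n) (𝓡 n) φ.symm y) :=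
    (mdifferentiable_of_mem_atlas (I := 𝓡 n) hφ).symm.mfderiv_injective hy
  refine Real.sqrt_pos.2 (Matrix.PosDef.det_pos (Matrix.PosDef.of_dotProduct_mulVec_pos ?_ ?_))
  · ext a b
    simp [Matrix.conjTranspose_apply, g.symm]
  · intro c hc
    have hne : coordVec φ y (WithLp.toLp 2 c) ≠ 0 := by
      intro h0
      apply hc
      have h1 : (WithLp.toLp 2 c : E n) = 0 := hinj (h0.trans (map_zero _).symm)
      simpa using congrArg (WithLp.ofLp) h1
    have hexp : coordVec φ y (WithLp.toLp 2 c) =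
        ∑ a, c a • coordVec φ y (EuclideanSpace.single a 1) := by
      have h2 : (WithLp.toLp 2 c : E n) = ∑ a, c a • EuclideanSpace.single a (1 : ℝ) := by
        ext b
        simp [Finset.sum_apply, Pi.single_apply]
      rw [h2]
      exact (map_sum (mfderiv (𝓡 n) (𝓡 n) φ.symm y) _ _).trans
        (Finset.sum_congr rfl fun a _ => map_smul (mfderiv (𝓡 n) (𝓡 n) φ.symm y) _ _)
    have hp := g.pos _ _ hne
    rw [hexp] at hp
    simp only [map_sum, map_smul, sum_apply, smul_apply,
      smul_eq_mul] at hp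
    simp only [dotProduct, Matrix.mulVec, Matrix.of_apply, star_trivial]
    refine lt_of_lt_of_eq hp (Finset.sum_congr rfl fun a _ => ?_)
    congr 1
    refine Finset.sum_congr rfl fun b _ => ?_
    rw [mul_comm, g.symm]

theorem ae_chart_of_ae_vol [MeasurableSpace M] [BorelSpace M] (g : RMetric n M)
    {φ : OpenPartialHomeomorph M (E n)} (hφ : φ ∈ atlas (E n) M) {P : M → Prop}
    (hP : ∀ᵐ x ∂vol g, P x) : ∀ᵐ y ∂(volume.restrict φ.target), P (φ.symm y) := by
  have hms : MeasurableSet φ.target := φ.open_target.measurableSet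
  have hd : ContinuousOn (volDensity g φ) φ.target := by
    refine Real.continuous_sqrt.comp_continuousOn ?_
    have hc : ContinuousOn (fun y => (Matrix.of fun a b : Fin n =>
        g.inner (φ.symm y) (coordVec φ y (EuclideanSpace.single a 1))
          (coordVec φ y (EuclideanSpace.single b 1)))) φ.target :=
      continuousOn_pi.2 fun a => continuousOn_pi.2 fun b => continuousOn_gram g hφ _ _
    exact (Continuous.matrix_det continuous_id).comp_continuousOn hc
  have h1 : ∀ᵐ y ∂((volume.restrict φ.target).withDensity
      fun y => ENNReal.ofReal (volDensity g φ y)), P (φ.symm y) := by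
    refine ae_of_ae_map ?_ (ae_mono ?_ hP)
    · exact (φ.symm.continuousOn.aemeasurable hms).mono_ac
        (withDensity_absolutelyContinuous _ _)
    · exact le_iSup₂ (f := fun (φ : OpenPartialHomeomorph M (E n)) (_ : φ ∈ atlas (E n) M) =>
        Measure.map φ.symm ((volume.restrict φ.target).withDensity
          fun y => ENNReal.ofReal (volDensity g φ y))) φ hφ
  refine (withDensity_absolutelyContinuous' ?_ ?_).ae_le h1
  · exact (hd.aemeasurable hms).ennreal_ofReal
  · refine (ae_restrict_iff' hms).2 (Eventually.of_forall fun y hy => ?_)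
    simpa using volDensity_pos g hφ hy

/-! ### The spinor bundle and its connection -/

namespace SpinStructure

variable {g : RMetric n M} (σ : SpinStructure g) {V : Type*} [NormedAddCommGroup V]
  [InnerProductSpace ℝ V] (κ : SpinorRep n V)

/-- The first index `i` with `x ∈ U i`. -/
noncomputable def indexAt (x : M) : ℕ := by
  classical exact Nat.find (σ.cover x)

theorem mem_U_indexAt (x : M) : x ∈ σ.U (σ.indexAt x) := by
  classical
  unfold indexAt
  exact Nat.find_spec (σ.cover x)

theorem lift_self (i : ℕ) (x : M) (hx : x ∈ σ.U i) : σ.lift i i x = 1 := by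
  have h := σ.cocycle i i i x ⟨⟨hx, hx⟩, hx⟩
  exact mul_left_cancel (h.trans (mul_one _).symm)

theorem continuousOn_rho_lift (i j : ℕ) :
    ContinuousOn (fun x => κ.ρ (σ.lift i j x : CliffordAlgebra (cliffordForm n)))
      (σ.U i ∩ σ.U j) := by
  have : FiniteDimensional ℝ V :=
    Module.finite_of_finrank_pos (by rw [κ.finrank_eq]; positivity)
  let b := Module.finBasis ℝ (EndSpinor V)
  have h : ∀ x, κ.ρ (σ.lift i j x : CliffordAlgebra (cliffordForm n)) =
      ∑ k, (b.coord k ∘ₗ κ.ρ.toLinearMap)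
        (σ.lift i j x : CliffordAlgebra (cliffordForm n)) • b k := by
    intro x
    conv_lhs => rw [← b.sum_repr (κ.ρ (σ.lift i j x : CliffordAlgebra (cliffordForm n)))]
    rfl
  simp_rw [h]
  exact continuousOn_finsetSum _ fun k _ =>
    ((σ.smooth_lift i j (b.coord k ∘ₗ κ.ρ.toLinearMap)).continuousOn).smul continuousOn_const

/-- The spinor bundle `Σ_g M`: the bundle with fibre `V` associated to the spin structure. A spinor
has components `ψᵢ` in the frame `i`, related by `ψⱼ = ρ(lift j i) ψᵢ`. The fibre at `x` is a copy
of `V`, by means of the components in the frame of index `indexAt x`. -/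
noncomputable def spinorBundle : VectorBundleCore ℝ M V ℕ where
  baseSet := σ.U
  isOpen_baseSet := σ.isOpen_U
  indexAt := σ.indexAt
  mem_baseSet_at := σ.mem_U_indexAt
  coordChange i j x := κ.ρ (σ.lift j i x : CliffordAlgebra (cliffordForm n))
  coordChange_self i x hx v := by simp [σ.lift_self i x hx]
  continuousOn_coordChange i j := by
    rw [inter_comm]
    exact σ.continuousOn_rho_lift κ j i
  coordChange_comp i j k x hx v := by
    have h := σ.cocycle k j i x ⟨⟨hx.2, hx.1.2⟩, hx.1.1⟩
    rw [← h, Submonoid.coe_mul, map_mul]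
    rfl

/-- The matrix in the frame `i` of an endomorphism of the fibre `(Σ_g M)ₓ`. -/
noncomputable def endRep (i : ℕ) (x : M) (B : EndSpinor V) : EndSpinor V :=
  (σ.spinorBundle κ).coordChange (σ.indexAt x) i x * B *
    (σ.spinorBundle κ).coordChange i (σ.indexAt x) x

/-- The coordinates of a tangent vector in the orthonormal frame `i`. -/
noncomputable def coord (i : ℕ) (x : M) (X : TangentSpace (𝓡 n) x) : E n :=
  WithLp.toLp 2 fun a => g.inner x (σ.frame i a x) X

/-- The Levi-Civita coefficients `g(∇_{e_c} e_a, e_b)` of the orthonormal frame `i`, by the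
Koszul formula. -/
noncomputable def leviCivita (i : ℕ) (x : M) (c a b : Fin n) : ℝ :=
  (1 / 2) *
    (g.inner x (VectorField.mlieBracket (𝓡 n) (σ.frame i c) (σ.frame i a) x) (σ.frame i b x)
      - g.inner x (VectorField.mlieBracket (𝓡 n) (σ.frame i a) (σ.frame i b) x) (σ.frame i c x)
      + g.inner x (VectorField.mlieBracket (𝓡 n) (σ.frame i b) (σ.frame i c) x) (σ.frame i a x))

/-- The spin connection form in the frame `i`: the spin connection is
`(∇_X ψ)ᵢ = X(ψᵢ) + (1/4) ∑_{a,b} g(∇_X e_a, e_b) γ(e_a) γ(e_b) ψᵢ`. -/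
noncomputable def connForm (i : ℕ) (x : M) (X : TangentSpace (𝓡 n) x) : EndSpinor V :=
  (1 / 4 : ℝ) • ∑ a, ∑ b, (∑ c, σ.coord i x X c * σ.leviCivita i x c a b) •
    (κ.γ (EuclideanSpace.single a 1) * κ.γ (EuclideanSpace.single b 1))

/-! ### Sobolev sections of the endomorphism bundle

A (measurable) section of `End(Σ_g M)` is represented by `F : M → EndSpinor V`, where `F x` is an
endomorphism of the fibre at `x`. A section of `T*M ⊗ End(Σ_g M)` is represented by
`G : M → (E n →L[ℝ] EndSpinor V)`, where `G x v` is its value at the tangent vector with coordinates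
`v` in the orthonormal frame of index `indexAt x`. As the frames are orthonormal and their
lifts act isometrically, the norms `‖F x‖` and `‖G x‖` are the pointwise operator norms defined by
the metrics of `TM` and `Σ_g M`. -/

/-- The matrix in the frame `i`, read in the chart `φ`, of the section `F`. -/
noncomputable def localSec (i : ℕ) (φ : OpenPartialHomeomorph M (E n)) (F : M → EndSpinor V)
    (y : E n) : EndSpinor V :=
  σ.endRep κ i (φ.symm y) (F (φ.symm y))

/-- What `∂_v` of `localSec i φ F` has to be if `∇F = G`: as `(∇_X F)ᵢ = X(Fᵢ) + [ωᵢ(X), Fᵢ]`, it is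
`Gᵢ(∂_v) - [ωᵢ(∂_v), Fᵢ]`. -/
noncomputable def localDeriv (i : ℕ) (φ : OpenPartialHomeomorph M (E n)) (v : E n)
    (F : M → EndSpinor V) (G : M → (E n →L[ℝ] EndSpinor V)) (y : E n) : EndSpinor V :=
  σ.endRep κ i (φ.symm y)
      (G (φ.symm y) (σ.coord (σ.indexAt (φ.symm y)) (φ.symm y) (coordVec φ y v)))
    - (σ.connForm κ i (φ.symm y) (coordVec φ y v) * σ.localSec κ i φ F y
        - σ.localSec κ i φ F y * σ.connForm κ i (φ.symm y) (coordVec φ y v))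

/-- The domain in `ℝⁿ` on which the frame `i` is read in the chart `φ`. -/
def localDom (i : ℕ) (φ : OpenPartialHomeomorph M (E n)) : Set (E n) :=
  φ.target ∩ φ.symm ⁻¹' σ.U i

/-- `G` is the weak covariant derivative of `F`: in each chart and frame, the local expressions
are locally integrable and satisfy the integration by parts formula against all test functions. -/
def HasWeakCovDeriv (F : M → EndSpinor V) (G : M → (E n →L[ℝ] EndSpinor V)) : Prop :=
  ∀ (i : ℕ), ∀ φ ∈ atlas (E n) M, ∀ v : E n,
    LocallyIntegrableOn (σ.localSec κ i φ F) (σ.localDom i φ) ∧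
    LocallyIntegrableOn (σ.localDeriv κ i φ v F G) (σ.localDom i φ) ∧
    ∀ η : E n → ℝ, ContDiff ℝ ∞ η → HasCompactSupport η → tsupport η ⊆ σ.localDom i φ →
      ∫ y in σ.localDom i φ, fderiv ℝ η y v • σ.localSec κ i φ F y =
        -∫ y in σ.localDom i φ, η y • σ.localDeriv κ i φ v F G y

theorem endRep_add (i : ℕ) (x : M) (B C : EndSpinor V) :
    σ.endRep κ i x (B + C) = σ.endRep κ i x B + σ.endRep κ i x C := by
  simp only [endRep, mul_add, add_mul]

theorem endRep_smul (i : ℕ) (x : M) (c : ℝ) (B : EndSpinor V) :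
    σ.endRep κ i x (c • B) = c • σ.endRep κ i x B := by
  simp only [endRep, mul_smul_comm, smul_mul_assoc]

theorem isOpen_localDom (i : ℕ) (φ : OpenPartialHomeomorph M (E n)) :
    IsOpen (σ.localDom i φ) :=
  φ.symm.isOpen_inter_preimage (σ.isOpen_U i)

theorem hasWeakCovDeriv_zero : σ.HasWeakCovDeriv κ (fun _ => 0) (fun _ => 0) := by
  intro i φ _ v
  have h0 : ∀ x, σ.endRep κ i x 0 = 0 := fun x => by simp [endRep]
  have h1 : σ.localSec κ i φ (fun _ => 0) = fun _ => 0 := by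
    funext y
    simp [localSec, h0]
  have h2 : σ.localDeriv κ i φ v (fun _ => 0) (fun _ => 0) = fun _ => 0 := by
    funext y
    simp [localDeriv, h1, h0]
  rw [h1, h2]
  exact ⟨locallyIntegrableOn_zero, locallyIntegrableOn_zero, fun η _ _ _ => by simp⟩

theorem integrable_test_smul {Ω : Set (E n)} {f : E n → EndSpinor V}
    (hf : LocallyIntegrableOn f Ω) {η : E n → ℝ} (hη : Continuous η) (hc : HasCompactSupport η)
    (hs : tsupport η ⊆ Ω) : IntegrableOn (fun y => η y • f y) Ω := by
  have hK : IntegrableOn f (tsupport η) := hf.integrableOn_compact_subset hs hc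
  have h1 : IntegrableOn (fun y => η y • f y) (tsupport η) :=
    hK.continuousOn_smul hη.continuousOn hc
  refine Integrable.integrableOn ((integrableOn_iff_integrable_of_support_subset ?_).1 h1)
  intro y hy
  refine subset_tsupport η fun h => hy ?_
  simp [h]

variable {σ κ}

theorem HasWeakCovDeriv.add {F F' : M → EndSpinor V} {G G' : M → (E n →L[ℝ] EndSpinor V)}
    (h : σ.HasWeakCovDeriv κ F G) (h' : σ.HasWeakCovDeriv κ F' G') :
    σ.HasWeakCovDeriv κ (F + F') (G + G') := by
  intro i φ hφ v
  obtain ⟨a, b, c⟩ := h i φ hφ v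
  obtain ⟨a', b', c'⟩ := h' i φ hφ v
  have h1 : σ.localSec κ i φ (F + F') = σ.localSec κ i φ F + σ.localSec κ i φ F' := by
    funext y
    simp [localSec, endRep_add]
  have h2 : σ.localDeriv κ i φ v (F + F') (G + G') =
      σ.localDeriv κ i φ v F G + σ.localDeriv κ i φ v F' G' := by
    funext y
    simp only [localDeriv, h1, Pi.add_apply, add_apply, endRep_add, mul_add, add_mul]
    abel
  rw [h1, h2]
  refine ⟨a.add a', b.add b', fun η hη hc hs => ?_⟩
  have hd : Continuous fun y => fderiv ℝ η y v :=
    (hη.continuous_fderiv (by simp)).clm_apply continuous_const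
  have hdc : HasCompactSupport fun y => fderiv ℝ η y v := hc.fderiv_apply (𝕜 := ℝ) v
  have hds : tsupport (fun y => fderiv ℝ η y v) ⊆ σ.localDom i φ :=
    (tsupport_fderiv_apply_subset ℝ v).trans hs
  simp only [Pi.add_apply, smul_add]
  rw [integral_add (integrable_test_smul a hd hdc hds) (integrable_test_smul a' hd hdc hds),
    integral_add (integrable_test_smul b hη.continuous hc hs)
      (integrable_test_smul b' hη.continuous hc hs), c η hη hc hs, c' η hη hc hs]
  abel

theorem HasWeakCovDeriv.smul {F : M → EndSpinor V} {G : M → (E n →L[ℝ] EndSpinor V)}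
    (h : σ.HasWeakCovDeriv κ F G) (r : ℝ) : σ.HasWeakCovDeriv κ (r • F) (r • G) := by
  intro i φ hφ v
  obtain ⟨a, b, c⟩ := h i φ hφ v
  have h1 : σ.localSec κ i φ (r • F) = r • σ.localSec κ i φ F := by
    funext y
    simp [localSec, endRep_smul]
  have h2 : σ.localDeriv κ i φ v (r • F) (r • G) = r • σ.localDeriv κ i φ v F G := by
    funext y
    simp only [localDeriv, h1, Pi.smul_apply, smul_apply, endRep_smul, mul_smul_comm,
      smul_mul_assoc, smul_sub]
  rw [h1, h2]
  refine ⟨a.smul r, b.smul r, fun η hη hc hs => ?_⟩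
  simp only [Pi.smul_apply, smul_comm _ r]
  rw [integral_smul, integral_smul, c η hη hc hs, smul_neg]

theorem HasWeakCovDeriv.congr [MeasurableSpace M] [BorelSpace M] {F F' : M → EndSpinor V}
    {G G' : M → (E n →L[ℝ] EndSpinor V)} (h : σ.HasWeakCovDeriv κ F G)
    (hF : F =ᵐ[vol g] F') (hG : G =ᵐ[vol g] G') : σ.HasWeakCovDeriv κ F' G' := by
  intro i φ hφ v
  obtain ⟨a, b, c⟩ := h i φ hφ v
  have hae : ∀ᵐ y ∂(volume.restrict (σ.localDom i φ)),
      F (φ.symm y) = F' (φ.symm y) ∧ G (φ.symm y) = G' (φ.symm y) :=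
    ae_restrict_of_ae_restrict_of_subset inter_subset_left
      (ae_chart_of_ae_vol g hφ (hF.and hG))
  have h1 : σ.localSec κ i φ F =ᵐ[volume.restrict (σ.localDom i φ)] σ.localSec κ i φ F' := by
    filter_upwards [hae] with y hy
    simp only [localSec, hy.1]
  have h2 : σ.localDeriv κ i φ v F G =ᵐ[volume.restrict (σ.localDom i φ)]
      σ.localDeriv κ i φ v F' G' := by
    filter_upwards [hae] with y hy
    simp only [localDeriv, localSec, hy.1, hy.2]
  refine ⟨a.congr h1, b.congr h2, fun η hη hc hs => ?_⟩
  have e := c η hη hc hs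
  have e1 : (fun y => fderiv ℝ η y v • σ.localSec κ i φ F y)
      =ᵐ[volume.restrict (σ.localDom i φ)] fun y => fderiv ℝ η y v • σ.localSec κ i φ F' y := by
    filter_upwards [h1] with y hy
    rw [hy]
  have e2 : (fun y => η y • σ.localDeriv κ i φ v F G y)
      =ᵐ[volume.restrict (σ.localDom i φ)] fun y => η y • σ.localDeriv κ i φ v F' G' y := by
    filter_upwards [h2] with y hy
    rw [hy]
  rwa [integral_congr_ae e1, integral_congr_ae e2] at e

variable (σ κ)
variable [MeasurableSpace M] [BorelSpace M] (p : ℝ≥0∞) [Fact (1 ≤ p)]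

/-- The Sobolev space `W^{1,p}(M, End(Σ_g M))`: the pairs `(F, ∇F)` with `F ∈ L^p` and weak covariant
derivative `∇F ∈ L^p`, with the norm `‖F‖_{L^p} + ‖∇F‖_{L^p}` (the pair is determined by `F`). -/
noncomputable def W1p : Submodule ℝ (WithLp 1
    (Lp (EndSpinor V) p (vol g) × Lp (E n →L[ℝ] EndSpinor V) p (vol g))) where
  carrier := {u | σ.HasWeakCovDeriv κ (u.fst : M → EndSpinor V)
    (u.snd : M → (E n →L[ℝ] EndSpinor V))}
  zero_mem' := (σ.hasWeakCovDeriv_zero κ).congr (Lp.coeFn_zero _ _ _).symm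
    (Lp.coeFn_zero _ _ _).symm
  add_mem' hu hv := (hu.add hv).congr (Lp.coeFn_add _ _).symm (Lp.coeFn_add _ _).symm
  smul_mem' r _ hu := (hu.smul r).congr (Lp.coeFn_smul _ _).symm (Lp.coeFn_smul _ _).symm

variable {σ κ p}

/-- The section underlying an element of `W^{1,p}` (defined almost everywhere). -/
noncomputable def sec (u : σ.W1p κ p) : M → EndSpinor V := u.1.fst

variable (σ κ p)

/-- The admissible weights `𝒫_{Λ₁,Λ₂}`. -/
def admissible (Λ₁ Λ₂ : ℝ) : Set (σ.W1p κ p) :=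
  {A | ∀ᵐ x ∂vol g, (sec A x).IsSymmetric ∧
    Λ₁ • (1 : EndSpinor V) ≤ sec A x ∧ sec A x ≤ Λ₂ • (1 : EndSpinor V)}

variable {σ κ p}

/-- `S = A^{1/2}`: almost everywhere, `S x` is the positive square root of `A x`. -/
def IsSqrt (S A : σ.W1p κ p) : Prop :=
  ∀ᵐ x ∂vol g, (sec S x).IsPositive ∧ sec S x * sec S x = sec A x

/-- `Q = S⁻¹`: almost everywhere, `Q x` is the inverse of `S x`. -/
def IsInv (Q S : σ.W1p κ p) : Prop :=
  ∀ᵐ x ∂vol g, sec Q x * sec S x = 1 ∧ sec S x * sec Q x = 1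

end SpinStructure

end

end SpinGeom

/-!
Since `n < p`, Morrey's inequality embeds `W^{1,p}` in `L^∞`, and by the Leibniz rule `W^{1,p}` is
closed under pointwise multiplication. The values of `A` are symmetric and within `Λ₂ - Λ₁ < Λ₂` of
the scalar `Λ₂`, so that pointwise `A ^ a` is the sum of the binomial series in
`T = Λ₂⁻¹ • A - 1`. On `W^{1,p}` multiplication by `T` satisfies
`‖T u‖ ≤ q ‖u‖ + K ‖u‖_∞` and `‖T u‖_∞ ≤ q ‖u‖_∞` with `q = 1 - Λ₁ / Λ₂ < 1`. It is therefore a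
strict contraction for the equivalent norm `max ‖u‖ (m * ‖u‖_∞)` with `m` large, the binomial series
converges in the algebra of bounded operators on `W^{1,p}`, and `A ^ (±1/2)` depends smoothly on
`A`. Differentiating `S * S = A` and `Q * S = 1` gives the equations for the derivatives; the
Sylvester equation has no other solution because `S` is a power series in `S ^ 2`.
-/

namespace SpinGeom

/-! ### Weak derivatives -/

theorem setIntegral_smul_eq_integral {α X : Type*} [TopologicalSpace α] [MeasurableSpace α]
    [NormedAddCommGroup X] [NormedSpace ℝ X] {μ : Measure α} {Ω : Set α} {ζ : α → ℝ}
    (hζ : tsupport ζ ⊆ Ω) (u : α → X) : ∫ y in Ω, ζ y • u y ∂μ = ∫ y, ζ y • u y ∂μ :=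
  setIntegral_eq_integral_of_forall_compl_eq_zero fun y hy => by
    rw [image_eq_zero_of_notMem_tsupport fun h => hy (hζ h), zero_smul]

theorem continuous_fderiv_apply_const {G : Type*} [NormedAddCommGroup G] [NormedSpace ℝ G]
    {η : G → ℝ} (hη : ContDiff ℝ ∞ η) (v : G) : Continuous fun x => fderiv ℝ η x v :=
  (hη.continuous_fderiv (by simp)).clm_apply continuous_const

section WeakDerivative

open Convolution ContinuousLinearMap

variable {G X 𝔸 : Type*} [NormedAddCommGroup G] [NormedSpace ℝ G] [MeasurableSpace G]
  [NormedAddCommGroup X] [NormedSpace ℝ X] [NormedRing 𝔸] [NormedAlgebra ℝ 𝔸]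
  {μ : Measure G} {Ω Ω' : Set G} {v : G}

/-- The function `u'` is the weak derivative of `u` in the direction `v` on the open set `Ω`. -/
structure HasWeakDeriv (μ : Measure G) (Ω : Set G) (v : G) (u u' : G → X) : Prop where
  locallyIntegrableOn : LocallyIntegrableOn u Ω μ
  locallyIntegrableOn_deriv : LocallyIntegrableOn u' Ω μ
  integral_eq : ∀ η : G → ℝ, ContDiff ℝ ∞ η → HasCompactSupport η → tsupport η ⊆ Ω →
    ∫ y in Ω, fderiv ℝ η y v • u y ∂μ = -∫ y in Ω, η y • u' y ∂μ

namespace HasWeakDeriv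

section

variable {u u' : G → X}

theorem integral_fderiv_smul (h : HasWeakDeriv μ Ω v u u') {η : G → ℝ} (hη : ContDiff ℝ ∞ η)
    (hc : HasCompactSupport η) (hs : tsupport η ⊆ Ω) :
    ∫ y, fderiv ℝ η y v • u y ∂μ = -∫ y, η y • u' y ∂μ := by
  rw [← setIntegral_smul_eq_integral ((tsupport_fderiv_apply_subset ℝ v).trans hs),
    ← setIntegral_smul_eq_integral hs]
  exact h.integral_eq η hη hc hs

theorem mono (h : HasWeakDeriv μ Ω v u u') (hΩ : Ω' ⊆ Ω) : HasWeakDeriv μ Ω' v u u' where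
  locallyIntegrableOn := h.locallyIntegrableOn.mono_set hΩ
  locallyIntegrableOn_deriv := h.locallyIntegrableOn_deriv.mono_set hΩ
  integral_eq η hη hc hs := by
    rw [setIntegral_smul_eq_integral ((tsupport_fderiv_apply_subset ℝ v).trans hs),
      setIntegral_smul_eq_integral hs]
    exact h.integral_fderiv_smul hη hc (hs.trans hΩ)

theorem congr (h : HasWeakDeriv μ Ω v u u') {w w' : G → X} (hw : u =ᵐ[μ.restrict Ω] w)
    (hw' : u' =ᵐ[μ.restrict Ω] w') : HasWeakDeriv μ Ω v w w' where
  locallyIntegrableOn := h.locallyIntegrableOn.congr hw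
  locallyIntegrableOn_deriv := h.locallyIntegrableOn_deriv.congr hw'
  integral_eq η hη hc hs := by
    rw [← integral_congr_ae (hw.mono fun y hy => congrArg (fderiv ℝ η y v • ·) hy),
      ← integral_congr_ae (hw'.mono fun y hy => congrArg (η y • ·) hy)]
    exact h.integral_eq η hη hc hs

theorem indicator (h : HasWeakDeriv μ Ω v u u') (hΩ : MeasurableSet Ω) :
    HasWeakDeriv μ Ω v (Ω.indicator u) (Ω.indicator u') :=
  h.congr (indicator_ae_eq_restrict hΩ).symm (indicator_ae_eq_restrict hΩ).symm

end

variable {u u' w w' : G → 𝔸}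

theorem integral_mul_fderiv [OpensMeasurableSpace G] [FiniteDimensional ℝ 𝔸]
    (h : HasWeakDeriv μ Ω v u u') (hu : Integrable u μ) (hu' : Integrable u' μ)
    {ζ : G → 𝔸} (hζ : ContDiff ℝ ∞ ζ) (hc : HasCompactSupport ζ) (hs : tsupport ζ ⊆ Ω) :
    ∫ y, u y * fderiv ℝ ζ y v ∂μ = -∫ y, u' y * ζ y ∂μ := by
  let b := Module.finBasis ℝ 𝔸
  let coord i : 𝔸 →L[ℝ] ℝ := LinearMap.toContinuousLinearMap (b.coord i)
  have expand (x a : 𝔸) : x * a = ∑ i, (coord i a • x) * b i := by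
    conv_lhs => rw [← b.sum_repr a, Finset.mul_sum]
    exact Finset.sum_congr rfl fun i _ => by rw [mul_smul_comm, smul_mul_assoc]; rfl
  have smooth i : ContDiff ℝ ∞ fun y => coord i (ζ y) := (coord i).contDiff.comp hζ
  have support i : tsupport (fun y => coord i (ζ y)) ⊆ tsupport ζ :=
    tsupport_comp_subset (map_zero (coord i)) ζ
  have compact i : HasCompactSupport fun y => coord i (ζ y) := hc.comp_left (map_zero (coord i))
  have deriv_coord i y : coord i (fderiv ℝ ζ y v) = fderiv ℝ (fun y => coord i (ζ y)) y v :=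
    (congrArg (· v) ((coord i).hasFDerivAt.comp y
      (hζ.differentiable (by simp) y).hasFDerivAt).fderiv).symm
  have integrable_coord i : Integrable (fun y => coord i (ζ y) • u' y) μ :=
    hu'.locallyIntegrable.integrable_smul_left_of_hasCompactSupport (smooth i).continuous
      (compact i)
  have integrable_coord' i : Integrable (fun y => coord i (fderiv ℝ ζ y v) • u y) μ := by
    simp only [deriv_coord]
    exact hu.locallyIntegrable.integrable_smul_left_of_hasCompactSupport
      (continuous_fderiv_apply_const (smooth i) v) ((compact i).fderiv_apply (𝕜 := ℝ) v)
  have integral_coord i : ∫ y, (coord i (fderiv ℝ ζ y v) • u y) * b i ∂μ =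
      -∫ y, (coord i (ζ y) • u' y) * b i ∂μ := by
    have key := h.integral_fderiv_smul (smooth i) (compact i) ((support i).trans hs)
    rw [integral_mul_const_of_integrable (integrable_coord' i),
      integral_mul_const_of_integrable (integrable_coord i), ← neg_mul, ← key]
    simp only [deriv_coord]
  simp_rw [fun y => expand (u y), fun y => expand (u' y)]
  rw [integral_finsetSum _ fun i _ => (integrable_coord' i).mul_const _,
    integral_finsetSum _ fun i _ => (integrable_coord i).mul_const _, ← Finset.sum_neg_distrib]
  exact Finset.sum_congr rfl fun i _ => integral_coord i

end HasWeakDeriv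

section Mollification

variable [FiniteDimensional ℝ G] [BorelSpace G] [μ.IsAddHaarMeasure]

theorem HasWeakDeriv.fderiv_convolution {w w' : G → X}
    (h : HasWeakDeriv μ Ω v w w') (hw : Integrable w μ) {k : G → ℝ} (hk : ContDiff ℝ ∞ k)
    {r : ℝ} (hr : tsupport k ⊆ Metric.closedBall 0 r) {x : G} (hx : Metric.closedBall x r ⊆ Ω) :
    fderiv ℝ (k ⋆[lsmul ℝ ℝ, μ] w) x v = (k ⋆[lsmul ℝ ℝ, μ] w') x := by
  have hkc : HasCompactSupport k := (isCompact_closedBall _ _).of_isClosed_subset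
    (isClosed_tsupport k) hr
  have support : tsupport (fun y => k (x - y)) ⊆ Metric.closedBall x r := by
    refine closure_minimal (fun y hy => ?_) Metric.isClosed_closedBall
    rw [Metric.mem_closedBall, dist_comm, dist_eq_norm, ← mem_closedBall_zero_iff]
    exact hr (subset_tsupport k hy)
  have deriv_reflected y : fderiv ℝ (fun y => k (x - y)) y v = -fderiv ℝ k (x - y) v := by
    have := (hk.differentiable (by simp) (x - y)).hasFDerivAt.comp y
      ((hasFDerivAt_id y).const_sub x)
    have deriv_eq : fderiv ℝ (fun y => k (x - y)) y = _ := this.fderiv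
    simp [deriv_eq]
  have key := h.integral_fderiv_smul (η := fun y => k (x - y))
    (hk.comp (contDiff_const.sub contDiff_id))
    ((isCompact_closedBall x r).of_isClosed_subset (isClosed_tsupport _) support)
    (support.trans hx)
  simp only [deriv_reflected, neg_smul, integral_neg, neg_inj] at key
  have exists_conv := ((hkc.fderiv ℝ).convolutionExists_left ((lsmul ℝ ℝ).precompL G)
    (hk.continuous_fderiv (by simp)) hw.locallyIntegrable x).integrable_swap
  rw [(hkc.hasFDerivAt_convolution_left (lsmul ℝ ℝ) (hk.of_le (by simp))
      hw.locallyIntegrable x).fderiv, convolution_eq_swap, convolution_eq_swap,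
    ContinuousLinearMap.integral_apply exists_conv]
  exact key

theorem integral_neg_convolution_mul [CompleteSpace 𝔸] {k : G → ℝ} (hk : Continuous k)
    (hkc : HasCompactSupport k) {f h : G → 𝔸} (hf : Integrable f μ) (hh : Integrable h μ) :
    ∫ y, ((fun z => k (-z)) ⋆[lsmul ℝ ℝ, μ] f) y * h y ∂μ =
      ∫ x, f x * (k ⋆[lsmul ℝ ℝ, μ] h) x ∂μ := by
  obtain ⟨C, hC⟩ := hkc.exists_bound_of_continuous hk
  have integrable_smul {f : G → 𝔸} (hf : Integrable f μ) {c : G → ℝ} (hc : Continuous c)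
      (hC : ∀ z, ‖c z‖ ≤ C) : Integrable (fun x => c x • f x) μ :=
    hf.bdd_smul C hc.aestronglyMeasurable (Eventually.of_forall hC)
  have h_integrable : Integrable (fun z : G × G => k (z.1 - z.2) • (f z.1 * h z.2)) (μ.prod μ) :=
    (hf.mul_prod hh).bdd_smul C (by fun_prop) (Eventually.of_forall fun z => hC _)
  simp only [convolution_eq_swap, lsmul_apply, neg_sub]
  calc ∫ y, (∫ x, k (x - y) • f x ∂μ) * h y ∂μ
      = ∫ y, ∫ x, k (x - y) • (f x * h y) ∂μ ∂μ := by
        congr with y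
        rw [← integral_mul_const_of_integrable
          (integrable_smul hf (c := fun x => k (x - y)) (by fun_prop) fun _ => hC _)]
        simp only [smul_mul_assoc]
    _ = ∫ x, ∫ y, k (x - y) • (f x * h y) ∂μ ∂μ := (integral_integral_swap h_integrable).symm
    _ = ∫ x, f x * ∫ y, k (x - y) • h y ∂μ ∂μ := by
        congr with x
        rw [← integral_const_mul_of_integrable
          (integrable_smul hh (c := fun y => k (x - y)) (by fun_prop) fun _ => hC _)]
        simp only [mul_smul_comm]

theorem norm_normed_convolution_le (φ : ContDiffBump (0 : G)) {g : G → X} {C : ℝ}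
    (hC : ∀ᵐ y ∂μ, ‖g y‖ ≤ C) (x : G) : ‖(φ.normed μ ⋆[lsmul ℝ ℝ, μ] g) x‖ ≤ C := by
  rw [convolution_eq_swap]
  calc ‖∫ y, φ.normed μ (x - y) • g y ∂μ‖
      ≤ ∫ y, φ.normed μ (x - y) * C ∂μ := by
        refine norm_integral_le_of_norm_le ((φ.integrable_normed.comp_sub_left x).mul_const C) ?_
        filter_upwards [hC] with y hy
        rw [norm_smul, Real.norm_of_nonneg (φ.nonneg_normed _)]
        exact mul_le_mul_of_nonneg_left hy (φ.nonneg_normed _)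
    _ = C := by
        rw [integral_mul_const, integral_sub_left_eq_self (φ.normed μ) μ x, φ.integral_normed,
          one_mul]

theorem continuous_normed_convolution (φ : ContDiffBump (0 : G)) {g : G → X}
    (hg : Integrable g μ) : Continuous (φ.normed μ ⋆[lsmul ℝ ℝ, μ] g) :=
  φ.hasCompactSupport_normed.continuous_convolution_left _ φ.continuous_normed
    hg.locallyIntegrable

/-- Bump functions at the origin whose radii, at most `d`, tend to zero. -/
noncomputable def shrinkingBump (G : Type*) [NormedAddCommGroup G] {d : ℝ} (hd : 0 < d) (j : ℕ) :
    ContDiffBump (0 : G) where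
  rIn := d / (2 * (j + 1))
  rOut := d / (j + 1)
  rIn_pos := by positivity
  rIn_lt_rOut := by
    have : (0 : ℝ) < j + 1 := by positivity
    exact div_lt_div_of_pos_left hd this (by linarith)

omit [NormedSpace ℝ G] [MeasurableSpace G] [FiniteDimensional ℝ G] [BorelSpace G] in
theorem shrinkingBump_rOut_le {d : ℝ} (hd : 0 < d) (j : ℕ) : (shrinkingBump G hd j).rOut ≤ d :=
  div_le_self hd.le (by simp)

omit [NormedSpace ℝ G] [MeasurableSpace G] [FiniteDimensional ℝ G] [BorelSpace G] in
theorem tendsto_rOut_shrinkingBump {d : ℝ} (hd : 0 < d) :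
    Tendsto (fun j => (shrinkingBump G hd j).rOut) atTop (𝓝 0) := by
  simpa only [shrinkingBump, mul_one_div, mul_zero] using
    (tendsto_one_div_add_atTop_nhds_zero_nat (𝕜 := ℝ)).const_mul d

theorem ae_tendsto_shrinkingBump_convolution [CompleteSpace X] {d : ℝ} (hd : 0 < d) {g : G → X}
    (hg : Integrable g μ) : ∀ᵐ x ∂μ, Tendsto
      (fun j => ((shrinkingBump G hd j).normed μ ⋆[lsmul ℝ ℝ, μ] g) x) atTop (𝓝 (g x)) := by
  refine ContDiffBump.ae_convolution_tendsto_right_of_locallyIntegrable (K := 2)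
    (tendsto_rOut_shrinkingBump hd) (Eventually.of_forall fun j => le_of_eq ?_)
    hg.locallyIntegrable
  simp only [shrinkingBump]
  field_simp

theorem tendsto_integral_mul_convolution [CompleteSpace 𝔸] {d : ℝ} (hd : 0 < d) {f g : G → 𝔸}
    (hf : Integrable f μ) (hg : Integrable g μ) {C : ℝ} (hC : ∀ᵐ y ∂μ, ‖g y‖ ≤ C) :
    Tendsto
      (fun j => ∫ x, f x * ((shrinkingBump G hd j).normed μ ⋆[lsmul ℝ ℝ, μ] g) x ∂μ)
      atTop (𝓝 (∫ x, f x * g x ∂μ)) := by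
  refine tendsto_integral_of_dominated_convergence (fun x => ‖f x‖ * C)
    (fun j => hf.aestronglyMeasurable.mul
      (continuous_normed_convolution _ hg).aestronglyMeasurable)
    (hf.norm.mul_const C) (fun j => Eventually.of_forall fun x => ?_) ?_
  · exact (norm_mul_le _ _).trans
      (mul_le_mul_of_nonneg_left (norm_normed_convolution_le _ hC x) (norm_nonneg _))
  · filter_upwards [ae_tendsto_shrinkingBump_convolution hd hg] with x hx
    exact hx.const_mul _

theorem tendsto_integral_convolution_mul [CompleteSpace 𝔸] {d : ℝ} (hd : 0 < d) {f g : G → 𝔸}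
    (hf : Integrable f μ) (hg : Integrable g μ) {C : ℝ} (hC : ∀ᵐ y ∂μ, ‖g y‖ ≤ C) :
    Tendsto
      (fun j => ∫ x, ((shrinkingBump G hd j).normed μ ⋆[lsmul ℝ ℝ, μ] g) x * f x ∂μ)
      atTop (𝓝 (∫ x, g x * f x ∂μ)) := by
  refine tendsto_integral_of_dominated_convergence (fun x => C * ‖f x‖)
    (fun j => (continuous_normed_convolution _ hg).aestronglyMeasurable.mul
      hf.aestronglyMeasurable)
    (hf.norm.const_mul C) (fun j => Eventually.of_forall fun x => ?_) ?_
  · exact (norm_mul_le _ _).trans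
      (mul_le_mul_of_nonneg_right (norm_normed_convolution_le _ hC x) (norm_nonneg _))
  · filter_upwards [ae_tendsto_shrinkingBump_convolution hd hg] with x hx
    exact hx.mul_const _

theorem HasWeakDeriv.integral_fderiv_smul_mul_convolution [FiniteDimensional ℝ 𝔸]
    {u u' w w' : G → 𝔸} (hu : HasWeakDeriv μ Ω v u u') (hw : HasWeakDeriv μ Ω v w w')
    (iu : Integrable u μ) (iu' : Integrable u' μ) (iw : Integrable w μ) (iw' : Integrable w' μ)
    {η : G → ℝ} (hη : ContDiff ℝ ∞ η) (hc : HasCompactSupport η) {r : ℝ}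
    (hs : Metric.cthickening r (tsupport η) ⊆ Ω) {φ : ContDiffBump (0 : G)} (hφ : φ.rOut ≤ r) :
    ∫ x, (fderiv ℝ η x v • u x) * (φ.normed μ ⋆[lsmul ℝ ℝ, μ] w) x ∂μ =
      -(∫ x, (η x • u' x) * (φ.normed μ ⋆[lsmul ℝ ℝ, μ] w) x ∂μ +
        ∫ x, (φ.normed μ ⋆[lsmul ℝ ℝ, μ] fun y => η y • u y) x * w' x ∂μ) := by
  have : CompleteSpace 𝔸 := FiniteDimensional.complete ℝ 𝔸
  set k := φ.normed μ
  set W := k ⋆[lsmul ℝ ℝ, μ] w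
  have hk : ContDiff ℝ ∞ k := φ.contDiff_normed
  have hkc : HasCompactSupport k := φ.hasCompactSupport_normed
  have hksymm : (fun z => k (-z)) = k := funext φ.normed_neg
  have hW : ContDiff ℝ ∞ W := hkc.contDiff_convolution_left _ hk iw.locallyIntegrable
  have hdη : Continuous fun x => fderiv ℝ η x v := continuous_fderiv_apply_const hη v
  have hW' : Continuous (k ⋆[lsmul ℝ ℝ, μ] w') := continuous_normed_convolution φ iw'
  have leibniz x : fderiv ℝ (fun x => η x • W x) x v =
      fderiv ℝ η x v • W x + η x • (k ⋆[lsmul ℝ ℝ, μ] w') x := by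
    rw [fderiv_fun_smul (hη.differentiable (by simp) x) (hW.differentiable (by simp) x)]
    by_cases hx : x ∈ tsupport η
    · have hball : Metric.closedBall x φ.rOut ⊆ Ω :=
        ((Metric.closedBall_subset_closedBall hφ).trans
          (Metric.closedBall_subset_cthickening hx r)).trans hs
      have := hw.fderiv_convolution iw hk φ.tsupport_normed_eq.subset hball
      simp [this, W, add_comm]
    · simp [image_eq_zero_of_notMem_tsupport hx, add_comm]
  have integrable₁ : Integrable (fun x => u x * (fderiv ℝ η x v • W x)) μ :=
    iu.locallyIntegrable.integrable_smul_right_of_hasCompactSupport (hdη.smul hW.continuous)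
      (hc.fderiv_apply (𝕜 := ℝ) v).smul_right
  have integrable₂ : Integrable (fun x => u x * (η x • (k ⋆[lsmul ℝ ℝ, μ] w') x)) μ :=
    iu.locallyIntegrable.integrable_smul_right_of_hasCompactSupport (hη.continuous.smul hW')
      hc.smul_right
  have parts := hu.integral_mul_fderiv iu iu' (ζ := fun x => η x • W x) (hη.smul hW) hc.smul_right
    ((tsupport_smul_subset_left _ _).trans ((Metric.self_subset_cthickening _).trans hs))
  simp only [leibniz, mul_add] at parts
  rw [integral_add integrable₁ integrable₂] at parts
  have transpose := integral_neg_convolution_mul hk.continuous hkc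
    (iu.locallyIntegrable.integrable_smul_left_of_hasCompactSupport hη.continuous hc) iw'
  rw [hksymm] at transpose
  simp only [mul_smul_comm, smul_mul_assoc] at parts transpose ⊢
  rw [transpose, neg_add, ← parts]
  abel

theorem HasWeakDeriv.integral_fderiv_smul_mul [FiniteDimensional ℝ 𝔸] {u u' w w' : G → 𝔸}
    (hu : HasWeakDeriv μ Ω v u u') (hw : HasWeakDeriv μ Ω v w w') (iu : Integrable u μ)
    (iu' : Integrable u' μ) (iw : Integrable w μ) (iw' : Integrable w' μ) {C D : ℝ}
    (hC : ∀ᵐ y ∂μ, ‖u y‖ ≤ C) (hD : ∀ᵐ y ∂μ, ‖w y‖ ≤ D) {η : G → ℝ} (hη : ContDiff ℝ ∞ η)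
    (hc : HasCompactSupport η) {d : ℝ} (hd : 0 < d)
    (hs : Metric.cthickening d (tsupport η) ⊆ Ω) :
    ∫ y, fderiv ℝ η y v • (u y * w y) ∂μ = -∫ y, η y • (u' y * w y + u y * w' y) ∂μ := by
  have : CompleteSpace 𝔸 := FiniteDimensional.complete ℝ 𝔸
  have hdη : Continuous fun x => fderiv ℝ η x v := continuous_fderiv_apply_const hη v
  have integrable_smul {f : G → 𝔸} (hf : Integrable f μ) {ζ : G → ℝ} (hζ : Continuous ζ)
      (hζc : HasCompactSupport ζ) : Integrable (fun y => ζ y • f y) μ :=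
    hf.locallyIntegrable.integrable_smul_left_of_hasCompactSupport hζ hζc
  obtain ⟨D₀, hD₀⟩ := hc.exists_bound_of_continuous hη.continuous
  have bound : ∀ᵐ y ∂μ, ‖η y • u y‖ ≤ D₀ * C := by
    filter_upwards [hC] with y hy
    rw [norm_smul]
    exact mul_le_mul (hD₀ y) hy (norm_nonneg _) ((norm_nonneg _).trans (hD₀ y))
  have lim := tendsto_integral_mul_convolution hd
    (integrable_smul iu hdη (hc.fderiv_apply (𝕜 := ℝ) v)) iw hD
  have lim_left := tendsto_integral_mul_convolution hd
    (integrable_smul iu' hη.continuous hc) iw hD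
  have lim_right := tendsto_integral_convolution_mul hd iw'
    (integrable_smul iu hη.continuous hc) bound
  have limit_eq := tendsto_nhds_unique lim ((lim_left.add lim_right).neg.congr fun j =>
    (hu.integral_fderiv_smul_mul_convolution hw iu iu' iw iw' hη hc hs
      (shrinkingBump_rOut_le hd j)).symm)
  rw [← integral_add
    ((integrable_smul iu' hη.continuous hc).mul_bdd (c := D) iw.aestronglyMeasurable hD)
    (iw'.bdd_mul (c := D₀ * C) (integrable_smul iu hη.continuous hc).aestronglyMeasurable bound)]
    at limit_eq
  simpa only [smul_mul_assoc, ← smul_add] using limit_eq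

end Mollification

omit [NormedAlgebra ℝ 𝔸] in
theorem locallyIntegrableOn_mul_of_bounded {α : Type*} [TopologicalSpace α] [LocallyCompactSpace α]
    [T2Space α] [SecondCountableTopology α] [MeasurableSpace α]
    {μ : Measure α} {s : Set α} (hs : IsOpen s) {f g : α → 𝔸} (hf : LocallyIntegrableOn f s μ)
    (hg : LocallyIntegrableOn g s μ) {C : ℝ} (hC : ∀ᵐ y ∂μ.restrict s, ‖g y‖ ≤ C) :
    LocallyIntegrableOn (fun y => f y * g y) s μ ∧
      LocallyIntegrableOn (fun y => g y * f y) s μ := by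
  simp only [locallyIntegrableOn_iff hs.isLocallyClosed] at hf hg ⊢
  exact ⟨fun K hKs hK => (hf K hKs hK).mul_bdd (c := C) (hg K hKs hK).aestronglyMeasurable
      (ae_restrict_of_ae_restrict_of_subset hKs hC),
    fun K hKs hK => (hf K hKs hK).bdd_mul (c := C) (hg K hKs hK).aestronglyMeasurable
      (ae_restrict_of_ae_restrict_of_subset hKs hC)⟩

-- Both factors are cut off to a neighbourhood of the support of the test function, where they are
-- integrable.
theorem HasWeakDeriv.mul [FiniteDimensional ℝ G] [BorelSpace G] [μ.IsAddHaarMeasure]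
    [FiniteDimensional ℝ 𝔸] (hΩ : IsOpen Ω) {u u' w w' : G → 𝔸}
    (hu : HasWeakDeriv μ Ω v u u') (hw : HasWeakDeriv μ Ω v w w') {C : ℝ}
    (hC : ∀ᵐ y ∂μ.restrict Ω, ‖u y‖ ≤ C) {D : ℝ} (hD : ∀ᵐ y ∂μ.restrict Ω, ‖w y‖ ≤ D) :
    HasWeakDeriv μ Ω v (fun y => u y * w y) (fun y => u' y * w y + u y * w' y) := by
  have : ProperSpace G := FiniteDimensional.proper ℝ G
  refine ⟨(locallyIntegrableOn_mul_of_bounded hΩ hu.1 hw.1 hD).1,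
    (locallyIntegrableOn_mul_of_bounded hΩ hu.2 hw.1 hD).1.add
      (locallyIntegrableOn_mul_of_bounded hΩ hw.2 hu.1 hC).2, fun η hη hc hs => ?_⟩
  obtain ⟨d, hd, hdΩ⟩ := hc.isCompact.exists_cthickening_subset_open hΩ hs
  set K : Set G := Metric.cthickening d (tsupport η)
  have hK : IsCompact K := hc.isCompact.cthickening
  have hηK : tsupport η ⊆ K := Metric.self_subset_cthickening _
  have integrable {f : G → 𝔸} (hf : LocallyIntegrableOn f Ω μ) : Integrable (K.indicator f) μ :=
    (hf.integrableOn_compact_subset hdΩ hK).integrable_indicator hK.measurableSet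
  have bounded {f : G → 𝔸} {B : ℝ} (hB : ∀ᵐ y ∂μ.restrict Ω, ‖f y‖ ≤ B) :
      ∀ᵐ y ∂μ, ‖K.indicator f y‖ ≤ max B 0 := by
    filter_upwards [(ae_restrict_iff' hK.measurableSet).1
      (ae_restrict_of_ae_restrict_of_subset hdΩ hB)] with y hy
    by_cases h : y ∈ K
    · simpa only [indicator_of_mem h] using (hy h).trans (le_max_left _ _)
    · simp [indicator_of_notMem h]
  have key := ((hu.mono hdΩ).indicator hK.measurableSet).integral_fderiv_smul_mul
    ((hw.mono hdΩ).indicator hK.measurableSet) (integrable hu.1) (integrable hu.2)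
    (integrable hw.1) (integrable hw.2) (bounded hC) (bounded hD) hη hc hd subset_rfl
  have smul_congr {ζ : G → ℝ} (hζ : tsupport ζ ⊆ K) {f f' : G → 𝔸} (h : EqOn f f' K) :
      ∫ y, ζ y • f y ∂μ = ∫ y, ζ y • f' y ∂μ := by
    rw [← setIntegral_smul_eq_integral hζ f, ← setIntegral_smul_eq_integral hζ f']
    exact setIntegral_congr_fun hK.measurableSet fun y hy => congrArg (ζ y • ·) (h hy)
  have hdη : tsupport (fderiv ℝ η · v) ⊆ tsupport η := tsupport_fderiv_apply_subset ℝ v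
  rw [setIntegral_smul_eq_integral (hdη.trans hs), setIntegral_smul_eq_integral hs,
    smul_congr (hdη.trans hηK) fun y hy => ?_, key, smul_congr hηK fun y hy => ?_]
  · simp only [indicator_of_mem hy]
  · simp only [indicator_of_mem hy]

end WeakDerivative

/-! ### Morrey's inequality -/

section Morrey

variable {G X : Type*} [NormedAddCommGroup G] [NormedSpace ℝ G] [NormedAddCommGroup X]

theorem setIntegral_norm_le_of_eLpNorm_le {α : Type*} [MeasurableSpace α] {μ : Measure α}
    {p : ℝ≥0∞} (hp : 1 ≤ p) {s : Set α} (hs : μ s ≠ ⊤) {f : α → X}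
    (hf : AEStronglyMeasurable f (μ.restrict s)) {B : ℝ} (hB : 0 ≤ B)
    (h : eLpNorm f p (μ.restrict s) ≤ ENNReal.ofReal B) :
    ∫ y in s, ‖f y‖ ∂μ ≤ B * μ.real s ^ (1 - 1 / p.toReal) := by
  have exponent_nonneg : 0 ≤ 1 - 1 / p.toReal := by
    rcases eq_or_ne p ⊤ with rfl | hpt
    · simp
    · have : 1 ≤ p.toReal := by simpa using ENNReal.toReal_mono hpt hp
      rw [sub_nonneg]
      exact (div_le_one (by linarith)).2 this
  have hoelder := eLpNorm_le_eLpNorm_mul_rpow_measure_univ hp hf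
  rw [eLpNorm_one_eq_lintegral_enorm, Measure.restrict_apply_univ, ENNReal.toReal_one, div_one]
    at hoelder
  rw [integral_norm_eq_lintegral_enorm hf]
  refine ENNReal.toReal_le_of_le_ofReal (by positivity) (hoelder.trans ?_)
  rw [ENNReal.ofReal_mul hB, ← ENNReal.ofReal_rpow_of_nonneg measureReal_nonneg exponent_nonneg,
    ofReal_measureReal hs]
  gcongr

/-- The `L¹`-normalized dilation by `r` of a function on a finite-dimensional space. -/
noncomputable def dilate (ρ : G → ℝ) (r : ℝ) (z : G) : ℝ :=
  r⁻¹ ^ Module.finrank ℝ G * ρ (r⁻¹ • z)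

theorem hasDerivAt_dilate {ρ : G → ℝ} (hρ : Differentiable ℝ ρ) {r : ℝ} (hr : r ≠ 0) (z : G) :
    HasDerivAt (fun r => dilate ρ r z)
      (-(r⁻¹ * dilate (fun w => Module.finrank ℝ G * ρ w + fderiv ℝ ρ w w) r z)) r := by
  have deriv_inv : HasDerivAt (fun r : ℝ => r⁻¹) (-(r ^ 2)⁻¹) r := hasDerivAt_inv hr
  have deriv_comp :
      HasDerivAt (fun r : ℝ => ρ (r⁻¹ • z)) (fderiv ℝ ρ (r⁻¹ • z) (-(r ^ 2)⁻¹ • z)) r :=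
    (hρ (r⁻¹ • z)).hasFDerivAt.comp_hasDerivAt r (deriv_inv.smul_const z)
  refine ((deriv_inv.pow (Module.finrank ℝ G)).mul deriv_comp).congr_deriv ?_
  simp only [dilate, map_smul, smul_eq_mul, Pi.pow_apply]
  rcases Module.finrank ℝ G with _ | m
  · simp only [pow_zero, Nat.cast_zero, zero_mul, one_mul, zero_add]
    field_simp
  · push_cast
    simp only [inv_pow]
    field_simp
    ring

theorem fderiv_dilate_apply {ρ : G → ℝ} (hρ : Differentiable ℝ ρ) (r : ℝ) (z v : G) :
    fderiv ℝ (dilate ρ r) z v = r⁻¹ * dilate (fun w => fderiv ℝ ρ w v) r z := by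
  have deriv_comp : HasFDerivAt (fun z : G => ρ (r⁻¹ • z))
      ((fderiv ℝ ρ (r⁻¹ • z)).comp (r⁻¹ • ContinuousLinearMap.id ℝ G)) z :=
    (hρ (r⁻¹ • z)).hasFDerivAt.comp z ((hasFDerivAt_id z).const_smul r⁻¹)
  have deriv_dilate : HasFDerivAt (dilate ρ r) _ z :=
    deriv_comp.const_mul (r⁻¹ ^ Module.finrank ℝ G)
  rw [deriv_dilate.fderiv]
  simp only [dilate, _root_.smul_apply, ContinuousLinearMap.comp_apply,
    ContinuousLinearMap.id_apply, map_smul, smul_eq_mul]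
  ring

theorem contDiff_dilate {ρ : G → ℝ} (hρ : ContDiff ℝ ∞ ρ) (r : ℝ) : ContDiff ℝ ∞ (dilate ρ r) :=
  contDiff_const.mul (hρ.comp (contDiff_const_smul r⁻¹))

theorem support_dilate_subset {ρ : G → ℝ} (hρ : Function.support ρ ⊆ Metric.closedBall 0 1) {r : ℝ}
    (hr : 0 < r) (x : G) :
    Function.support (fun y => dilate ρ r (y - x)) ⊆ Metric.closedBall x r := by
  intro y hy
  have hmem : r⁻¹ • (y - x) ∈ Metric.closedBall (0 : G) 1 := hρ (right_ne_zero_of_mul hy)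
  rw [mem_closedBall_zero_iff, norm_smul, norm_inv, Real.norm_of_nonneg hr.le, ← div_eq_inv_mul,
    div_le_one hr] at hmem
  rwa [Metric.mem_closedBall, dist_eq_norm]

theorem norm_dilate_le {ρ : G → ℝ} {C : ℝ} (hC : ∀ w, ‖ρ w‖ ≤ C) {r : ℝ} (hr : 0 < r) (z : G) :
    ‖dilate ρ r z‖ ≤ r⁻¹ ^ Module.finrank ℝ G * C := by
  rw [dilate, norm_mul, Real.norm_of_nonneg (by positivity)]
  exact mul_le_mul_of_nonneg_left (hC _) (by positivity)

section Coordinates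

variable [FiniteDimensional ℝ G] {ι : Type*} (b : Module.Basis ι ℝ G)

theorem contDiff_repr_mul {ρ : G → ℝ} (hρ : ContDiff ℝ ∞ ρ) (a : ι) :
    ContDiff ℝ ∞ fun w => b.repr w a * ρ w :=
  (b.coord a).toContinuousLinearMap.contDiff.mul hρ

variable [Fintype ι]

-- The vector field `w ↦ w` has divergence `dim G`.
theorem finrank_mul_add_fderiv_self {ρ : G → ℝ} {w : G} (hρ : DifferentiableAt ℝ ρ w) :
    Module.finrank ℝ G * ρ w + fderiv ℝ ρ w w =
      ∑ a, fderiv ℝ (fun w => b.repr w a * ρ w) w (b a) := by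
  have product_rule (a : ι) : fderiv ℝ (fun w => b.repr w a * ρ w) w (b a) =
      b.repr w a * fderiv ℝ ρ w (b a) + ρ w := by
    have hprod : HasFDerivAt (fun w => b.repr w a * ρ w) _ w :=
      (b.coord a).toContinuousLinearMap.hasFDerivAt.mul hρ.hasFDerivAt
    rw [hprod.fderiv]
    simp
  have expand : fderiv ℝ ρ w w = ∑ a, b.repr w a * fderiv ℝ ρ w (b a) := by
    conv_lhs => rw [← b.sum_repr w, map_sum, b.sum_repr w]
    simp only [map_smul, smul_eq_mul]
  simp only [product_rule, Finset.sum_add_distrib, Finset.sum_const, Finset.card_univ,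
    nsmul_eq_mul, ← expand, Module.finrank_eq_card_basis b]
  ring

theorem hasDerivAt_dilate_eq_neg_divergence {ρ : G → ℝ} (hρ : ContDiff ℝ ∞ ρ) {r : ℝ} (hr : r ≠ 0)
    (z : G) :
    HasDerivAt (fun r => dilate ρ r z)
      (-∑ a, fderiv ℝ (dilate (fun w => b.repr w a * ρ w) r) z (b a)) r := by
  have hdiff := hρ.differentiable (by simp)
  refine (hasDerivAt_dilate hdiff hr z).congr_deriv ?_
  simp_rw [fderiv_dilate_apply ((contDiff_repr_mul b hρ _).differentiable (by simp)),
    ← Finset.mul_sum, dilate, ← Finset.mul_sum, finrank_mul_add_fderiv_self b (hdiff _)]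

end Coordinates

variable [MeasurableSpace G] [BorelSpace G] {μ : Measure G} [NormedSpace ℝ X]

theorem hasDerivAt_integral_dilate_smul {ρ : G → ℝ} (hρ : ContDiff ℝ ∞ ρ)
    (hs : HasCompactSupport ρ) {f : G → X} (hf : Integrable f μ) {x : G} {r : ℝ} (hr : 0 < r) :
    HasDerivAt (fun r => ∫ y, dilate ρ r (y - x) • f y ∂μ)
      (∫ y, deriv (fun r => dilate ρ r (y - x)) r • f y ∂μ) r := by
  set d := Module.finrank ℝ G
  set κ : G → ℝ := fun w => d * ρ w + fderiv ℝ ρ w w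
  have hρc : Continuous ρ := hρ.continuous
  have hκ : Continuous κ :=
    (continuous_const.mul hρc).add ((hρ.continuous_fderiv (by simp)).clm_apply continuous_id)
  have hκs : HasCompactSupport κ := by
    refine HasCompactSupport.intro hs.isCompact fun w hw => ?_
    have : fderiv ℝ ρ w = 0 :=
      image_eq_zero_of_notMem_tsupport fun h => hw (tsupport_fderiv_subset ℝ h)
    simp [κ, image_eq_zero_of_notMem_tsupport hw, this]
  obtain ⟨C, hC⟩ := hs.exists_bound_of_continuous hρc
  obtain ⟨D, hD⟩ := hκs.exists_bound_of_continuous hκ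
  have continuous_dilate {θ : G → ℝ} (hθ : Continuous θ) (r : ℝ) :
      Continuous fun y => dilate θ r (y - x) := by
    unfold dilate
    fun_prop
  have deriv_eq {t : ℝ} (ht : t ≠ 0) (y : G) := hasDerivAt_dilate (hρ.differentiable (by simp)) ht
    (y - x)
  have meas : AEStronglyMeasurable (fun y => deriv (fun r => dilate ρ r (y - x)) r • f y) μ := by
    simp_rw [(deriv_eq hr.ne' _).deriv]
    exact ((continuous_const.mul (continuous_dilate hκ r)).neg.aestronglyMeasurable).smul
      hf.aestronglyMeasurable
  refine (hasDerivAt_integral_of_dominated_loc_of_deriv_le (𝕜 := ℝ) (μ := μ)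
    (F' := fun t y => deriv (fun r => dilate ρ r (y - x)) t • f y)
    (bound := fun y => (r / 2)⁻¹ * ((r / 2)⁻¹ ^ d * D) * ‖f y‖)
    (Ioi_mem_nhds (half_lt_self hr)) (Eventually.of_forall fun t =>
      (continuous_dilate hρc t).aestronglyMeasurable.smul hf.aestronglyMeasurable)
    (hf.bdd_smul _ (continuous_dilate hρc r).aestronglyMeasurable
      (Eventually.of_forall fun y => norm_dilate_le hC hr (y - x))) meas
    (Eventually.of_forall fun y t ht => ?_) (hf.norm.const_mul _)
    (Eventually.of_forall fun y t ht => ?_)).2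
  · have ht0 : 0 < t := (half_pos hr).trans ht
    have hD0 : 0 ≤ D := (norm_nonneg _).trans (hD 0)
    have inv_le : t⁻¹ ≤ (r / 2)⁻¹ := inv_anti₀ (half_pos hr) (mem_Ioi.1 ht).le
    have dilate_le := norm_dilate_le hD ht0 (y - x)
    rw [(deriv_eq ht0.ne' y).deriv, norm_smul, norm_neg, norm_mul, norm_inv,
      Real.norm_of_nonneg ht0.le]
    gcongr
    exact dilate_le.trans (by gcongr)
  · have ht0 : 0 < t := (half_pos hr).trans ht
    exact ((deriv_eq ht0.ne' y).differentiableAt.hasDerivAt).smul_const (f y)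

variable [FiniteDimensional ℝ G]

theorem hasDerivAt_integral_dilate_smul_of_hasWeakDeriv {ι : Type*} [Fintype ι]
    (b : Module.Basis ι ℝ G) {Ω : Set G} {u : G → X} {u' : ι → G → X}
    (hu : ∀ a, HasWeakDeriv μ Ω (b a) u (u' a)) (hi : Integrable u μ) {ρ : G → ℝ}
    (hρ : ContDiff ℝ ∞ ρ) (hs : Function.support ρ ⊆ Metric.closedBall 0 1) {x : G} {r : ℝ}
    (hr : 0 < r) (hx : Metric.closedBall x r ⊆ Ω) :
    HasDerivAt (fun r => ∫ y, dilate ρ r (y - x) • u y ∂μ)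
      (∑ a, ∫ y, dilate (fun w => b.repr w a * ρ w) r (y - x) • u' a y ∂μ) r := by
  set η : ι → G → ℝ := fun a y => dilate (fun w => b.repr w a * ρ w) r (y - x)
  have hη (a : ι) : ContDiff ℝ ∞ (η a) :=
    (contDiff_dilate (contDiff_repr_mul b hρ a) r).comp (contDiff_id.sub contDiff_const)
  have support_η (a : ι) : Function.support (η a) ⊆ Metric.closedBall x r :=
    support_dilate_subset ((Function.support_mul_subset_right _ _).trans hs) hr x
  have compact_η (a : ι) : HasCompactSupport (η a) :=
    HasCompactSupport.of_support_subset_isCompact (isCompact_closedBall x r) (support_η a)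
  have tsupport_η (a : ι) : tsupport (η a) ⊆ Ω :=
    (closure_minimal (support_η a) Metric.isClosed_closedBall).trans hx
  have deriv_dilate (y : G) :
      deriv (fun r => dilate ρ r (y - x)) r = -∑ a, fderiv ℝ (η a) y (b a) := by
    rw [(hasDerivAt_dilate_eq_neg_divergence b hρ hr.ne' (y - x)).deriv]
    simp only [η, fderiv_comp_sub (f := dilate _ r)]
  have integrable (a : ι) : Integrable (fun y => fderiv ℝ (η a) y (b a) • u y) μ :=
    hi.locallyIntegrable.integrable_smul_left_of_hasCompactSupport
      (continuous_fderiv_apply_const (hη a) (b a)) ((compact_η a).fderiv_apply (𝕜 := ℝ) (b a))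
  refine (hasDerivAt_integral_dilate_smul hρ
    (HasCompactSupport.of_support_subset_isCompact (isCompact_closedBall 0 1) hs) hi
    hr).congr_deriv ?_
  simp_rw [deriv_dilate, neg_smul, Finset.sum_smul]
  rw [integral_neg, integral_finsetSum _ fun a _ => integrable a, ← Finset.sum_neg_distrib]
  refine Finset.sum_congr rfl fun a _ => ?_
  rw [(hu a).integral_fderiv_smul (hη a) (compact_η a) (tsupport_η a), neg_neg]

variable [μ.IsAddHaarMeasure]

theorem integral_dilate (ρ : G → ℝ) {r : ℝ} (hr : 0 < r) : ∫ z, dilate ρ r z ∂μ = ∫ z, ρ z ∂μ := by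
  simp only [dilate]
  rw [integral_const_mul, Measure.integral_comp_inv_smul_of_nonneg μ ρ hr.le, smul_eq_mul,
    ← mul_assoc, ← mul_pow, inv_mul_cancel₀ hr.ne', one_pow, one_mul]

theorem ae_tendsto_integral_dilate [CompleteSpace X] {ρ : G → ℝ} {C : ℝ} (hC : ∀ w, ‖ρ w‖ ≤ C)
    (hs : Function.support ρ ⊆ Metric.closedBall 0 1) (hρ_one : ∫ z, ρ z ∂μ = 1) {f : G → X}
    (hf : Integrable f μ) :
    ∀ᵐ x ∂μ, Tendsto (fun r => ∫ y, dilate ρ r (y - x) • f y ∂μ) (𝓝[>] 0) (𝓝 (f x)) := by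
  filter_upwards [(Besicovitch.vitaliFamily μ).ae_tendsto_average_norm_sub
    hf.locallyIntegrable] with x hx
  refine tendsto_integral_smul_of_tendsto_average_norm_sub (C * μ.real (Metric.ball 0 1))
    (hx.comp (Besicovitch.tendsto_filterAt μ x)) (Eventually.of_forall fun r => hf.integrableOn)
    ?_ ?_ ?_
  · refine tendsto_const_nhds.congr' ?_
    filter_upwards [self_mem_nhdsWithin] with r hr
    rw [integral_sub_right_eq_self (dilate ρ r), integral_dilate ρ hr, hρ_one]
  · filter_upwards [self_mem_nhdsWithin] with r hr using support_dilate_subset hs hr x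
  · filter_upwards [self_mem_nhdsWithin] with r hr y
    rw [mem_Ioi] at hr
    refine (norm_dilate_le hC hr _).trans (le_of_eq ?_)
    have : μ.real (Metric.ball (0 : G) 1) ≠ 0 :=
      (ENNReal.toReal_pos (Metric.measure_ball_pos μ _ one_pos).ne' measure_ball_lt_top.ne).ne'
    rw [Measure.addHaar_real_closedBall μ x hr.le, inv_pow]
    field_simp

theorem norm_integral_dilate_smul_le {p : ℝ≥0∞} (hp : 1 ≤ p) {ρ : G → ℝ} {C : ℝ}
    (hC : ∀ w, ‖ρ w‖ ≤ C) (hs : Function.support ρ ⊆ Metric.closedBall 0 1) {r : ℝ} (hr : 0 < r)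
    {x : G} {f : G → X} (hf : Integrable f μ) {B : ℝ} (hB : 0 ≤ B)
    (h : eLpNorm f p μ ≤ ENNReal.ofReal B) :
    ‖∫ y, dilate ρ r (y - x) • f y ∂μ‖ ≤
      C * μ.real (Metric.ball (0 : G) 1) ^ (1 - 1 / p.toReal) *
        r ^ (-(Module.finrank ℝ G / p.toReal)) * B := by
  have hC0 : 0 ≤ C := (norm_nonneg _).trans (hC 0)
  set d := Module.finrank ℝ G
  set s := Metric.closedBall x r with hs_def
  have vanishes (y : G) (hy : y ∉ s) : dilate ρ r (y - x) • f y = 0 := by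
    rw [Function.notMem_support.1 fun hy' => hy (support_dilate_subset hs hr x hy'), zero_smul]
  have hoelder := setIntegral_norm_le_of_eLpNorm_le hp (s := s) measure_closedBall_lt_top.ne
    hf.aestronglyMeasurable.restrict hB ((eLpNorm_mono_measure f Measure.restrict_le_self).trans h)
  have rpow_split :
      r ^ (-(d / p.toReal)) = r ^ (-(d : ℝ)) * r ^ ((d : ℝ) * (1 - 1 / p.toReal)) := by
    rw [← Real.rpow_add hr]
    congr 1
    ring
  rw [← setIntegral_eq_integral_of_forall_compl_eq_zero vanishes]
  calc ‖∫ y in s, dilate ρ r (y - x) • f y ∂μ‖ ≤ ∫ y in s, r⁻¹ ^ d * C * ‖f y‖ ∂μ := by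
        refine norm_integral_le_of_norm_le (hf.norm.integrableOn.const_mul _)
          (Eventually.of_forall fun y => ?_)
        rw [norm_smul]
        exact mul_le_mul_of_nonneg_right (norm_dilate_le hC hr _) (norm_nonneg _)
    _ = r⁻¹ ^ d * C * ∫ y in s, ‖f y‖ ∂μ := integral_const_mul _ _
    _ ≤ r⁻¹ ^ d * C * (B * μ.real s ^ (1 - 1 / p.toReal)) := by gcongr
    _ = _ := by
        rw [hs_def, Measure.addHaar_real_closedBall μ x hr.le,
          Real.mul_rpow (by positivity) measureReal_nonneg, ← Real.rpow_natCast r,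
          ← Real.rpow_mul hr.le, ← Real.rpow_natCast r⁻¹, Real.inv_rpow hr.le,
          ← Real.rpow_neg hr.le, rpow_split]
        ring

theorem norm_le_add_of_norm_deriv_le_rpow {m m' : ℝ → X} {c s R : ℝ} (hc : 0 ≤ c) (hs : 0 < s)
    (hm : ∀ r ∈ Ioc 0 R, HasDerivAt m (m' r) r)
    (hm' : ∀ r ∈ Ioc 0 R, ‖m' r‖ ≤ c * r ^ (s - 1)) {ε : ℝ} (hε : ε ∈ Ioc 0 R) :
    ‖m ε‖ ≤ ‖m R‖ + c / s * R ^ s := by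
  obtain ⟨hε0, hεR⟩ := hε
  have deriv_power (r : ℝ) (hr : 0 < r) :
      HasDerivAt (fun r => c / s * (r ^ s - ε ^ s)) (c * r ^ (s - 1)) r := by
    refine (((Real.hasDerivAt_rpow_const (.inl hr.ne')).sub_const (ε ^ s)).const_mul
      (c / s)).congr_deriv ?_
    field_simp
  have increment : ‖m R - m ε‖ ≤ c / s * (R ^ s - ε ^ s) :=
    image_norm_le_of_norm_deriv_right_le_deriv_boundary' (f := fun r => m r - m ε)
      (fun r hr => ((hm r ⟨hε0.trans_le hr.1, hr.2⟩).sub_const _).continuousAt.continuousWithinAt)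
      (fun r hr => ((hm r ⟨hε0.trans_le hr.1, hr.2.le⟩).sub_const _).hasDerivWithinAt) (by simp)
      (fun r hr => (deriv_power r (hε0.trans_le hr.1)).continuousAt.continuousWithinAt)
      (fun r hr => (deriv_power r (hε0.trans_le hr.1)).hasDerivWithinAt)
      (fun r hr => hm' r ⟨hε0.trans_le hr.1, hr.2.le⟩) (right_mem_Icc.2 hεR)
  calc ‖m ε‖ = ‖m R - (m R - m ε)‖ := by rw [sub_sub_cancel]
    _ ≤ ‖m R‖ + ‖m R - m ε‖ := norm_sub_le _ _
    _ ≤ ‖m R‖ + c / s * R ^ s := by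
      have : c / s * (R ^ s - ε ^ s) ≤ c / s * R ^ s :=
        mul_le_mul_of_nonneg_left (sub_le_self _ (Real.rpow_nonneg hε0.le s)) (by positivity)
      linarith

theorem norm_integral_dilate_smul_le_of_hasWeakDeriv {ι : Type*} [Fintype ι]
    (b : Module.Basis ι ℝ G) {p : ℝ≥0∞} (hp1 : 1 ≤ p) (hp : Module.finrank ℝ G < p.toReal)
    {ρ : G → ℝ} (hρ : ContDiff ℝ ∞ ρ) (hs : Function.support ρ ⊆ Metric.closedBall 0 1) {C : ℝ}
    (hC : ∀ w, ‖ρ w‖ ≤ C) (hC' : ∀ a w, ‖b.repr w a * ρ w‖ ≤ C) {x : G} {R : ℝ} {u : G → X}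
    {u' : ι → G → X} (hu : ∀ a, HasWeakDeriv μ (Metric.closedBall x R) (b a) u (u' a))
    (hi : Integrable u μ) (hi' : ∀ a, Integrable (u' a) μ) {B : ℝ} (hB : 0 ≤ B)
    (hBu : eLpNorm u p μ ≤ ENNReal.ofReal B) (hBu' : ∀ a, eLpNorm (u' a) p μ ≤ ENNReal.ofReal B)
    {ε : ℝ} (hε : ε ∈ Ioc 0 R) :
    ‖∫ y, dilate ρ ε (y - x) • u y ∂μ‖ ≤
      C * μ.real (Metric.ball (0 : G) 1) ^ (1 - 1 / p.toReal) *
        (R ^ (-(Module.finrank ℝ G / p.toReal)) + Fintype.card ι /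
          (1 - Module.finrank ℝ G / p.toReal) * R ^ (1 - Module.finrank ℝ G / p.toReal)) * B := by
  set A := C * μ.real (Metric.ball (0 : G) 1) ^ (1 - 1 / p.toReal)
  set q := Module.finrank ℝ G / p.toReal
  have hC0 : 0 ≤ C := (norm_nonneg _).trans (hC 0)
  have : 0 ≤ A := by positivity
  have hq : 0 < 1 - q := sub_pos.2 ((div_lt_one ((Nat.cast_nonneg _).trans_lt hp)).2 hp)
  have deriv_le (r : ℝ) (hr : r ∈ Ioc 0 R) :
      ‖∑ a, ∫ y, dilate (fun w => b.repr w a * ρ w) r (y - x) • u' a y ∂μ‖ ≤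
        Fintype.card ι * A * B * r ^ (1 - q - 1) := by
    have summand_le (a : ι) := norm_integral_dilate_smul_le hp1 (hC' a)
      ((Function.support_mul_subset_right _ _).trans hs) hr.1 (x := x) (hi' a) hB (hBu' a)
    refine (norm_sum_le_of_le _ fun a _ => summand_le a).trans (le_of_eq ?_)
    rw [Finset.sum_const, Finset.card_univ, nsmul_eq_mul, sub_sub_cancel_left]
    ring
  have fence := norm_le_add_of_norm_deriv_le_rpow (by positivity) hq
    (fun r hr => hasDerivAt_integral_dilate_smul_of_hasWeakDeriv b hu hi hρ hs hr.1
      (Metric.closedBall_subset_closedBall hr.2)) deriv_le hε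
  have outer := norm_integral_dilate_smul_le hp1 hC hs (hε.1.trans_le hε.2) (x := x) hi hB hBu
  calc _ ≤ A * R ^ (-q) * B + Fintype.card ι * A * B / (1 - q) * R ^ (1 - q) :=
        fence.trans (by gcongr)
    _ = _ := by ring

theorem exists_smooth_kernel {ι : Type*} [Finite ι] (b : Module.Basis ι ℝ G) :
    ∃ (ρ : G → ℝ) (C : ℝ), ContDiff ℝ ∞ ρ ∧ Function.support ρ ⊆ Metric.closedBall 0 1 ∧
      ∫ w, ρ w ∂μ = 1 ∧ (∀ w, ‖ρ w‖ ≤ C) ∧ ∀ a w, ‖b.repr w a * ρ w‖ ≤ C := by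
  let φ : ContDiffBump (0 : G) := ⟨1 / 2, 1, by norm_num, by norm_num⟩
  have hρ : ContDiff ℝ ∞ (φ.normed μ) := φ.contDiff_normed
  have hc : HasCompactSupport (φ.normed μ) := φ.hasCompactSupport_normed
  obtain ⟨C₀, hC₀⟩ := hc.exists_bound_of_continuous hρ.continuous
  choose C hC using fun a => HasCompactSupport.exists_bound_of_continuous
    (f := fun w => b.repr w a * φ.normed μ w) hc.mul_left (contDiff_repr_mul b hρ a).continuous
  obtain ⟨C₁, hC₁⟩ := (Set.finite_range C).bddAbove
  exact ⟨φ.normed μ, max C₀ C₁, hρ,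
    φ.support_normed_eq.trans_subset Metric.ball_subset_closedBall, φ.integral_normed,
    fun w => (hC₀ w).trans (le_max_left _ _),
    fun a w => (hC a w).trans ((hC₁ (mem_range_self a)).trans (le_max_right _ _))⟩

/-- The averages `∫ ρ_r(y - x) u(y) dy` are followed from `r = R` down to a Lebesgue point: their
`r`-derivative is `O(r ^ (-dim G / p))`, which is integrable at `0` because `dim G < p`. -/
theorem exists_morrey_bound {ι : Type*} [Finite ι] (b : Module.Basis ι ℝ G) {p : ℝ≥0∞}
    (hp1 : 1 ≤ p) (hp : Module.finrank ℝ G < p.toReal) {R : ℝ} (hR : 0 < R) :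
    ∃ C : ℝ, 0 ≤ C ∧ ∀ {X : Type*} [NormedAddCommGroup X] [NormedSpace ℝ X] [CompleteSpace X]
      {Ω K : Set G}, IsCompact K → Metric.cthickening R K ⊆ Ω → ∀ {u : G → X} {u' : ι → G → X},
      LocallyIntegrableOn u Ω μ → (∀ a, HasWeakDeriv μ Ω (b a) u (u' a)) → ∀ B : ℝ, 0 ≤ B →
      eLpNorm u p (μ.restrict (Metric.cthickening R K)) ≤ ENNReal.ofReal B →
      (∀ a, eLpNorm (u' a) p (μ.restrict (Metric.cthickening R K)) ≤ ENNReal.ofReal B) →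
      ∀ᵐ x ∂μ.restrict K, ‖u x‖ ≤ C * B := by
  obtain ⟨ρ, C, hρ, hs, hρ_one, hC, hC'⟩ := exists_smooth_kernel (μ := μ) b
  have := Fintype.ofFinite ι
  have hC0 : 0 ≤ C := (norm_nonneg _).trans (hC 0)
  have hq : 0 < 1 - Module.finrank ℝ G / p.toReal :=
    sub_pos.2 ((div_lt_one ((Nat.cast_nonneg _).trans_lt hp)).2 hp)
  refine ⟨C * μ.real (Metric.ball (0 : G) 1) ^ (1 - 1 / p.toReal) *
    (R ^ (-(Module.finrank ℝ G / p.toReal)) + Fintype.card ι /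
      (1 - Module.finrank ℝ G / p.toReal) * R ^ (1 - Module.finrank ℝ G / p.toReal)),
    by positivity, fun {X} _ _ _ Ω K hK hKΩ u u' hui hu B hB hBu hBu' => ?_⟩
  have hK' : MeasurableSet (Metric.cthickening R K) := hK.cthickening.measurableSet
  have integrable {f : G → X} (hf : LocallyIntegrableOn f Ω μ) :
      Integrable ((Metric.cthickening R K).indicator f) μ :=
    (hf.integrableOn_compact_subset hKΩ hK.cthickening).integrable_indicator hK'
  rw [ae_restrict_iff' hK.measurableSet]
  filter_upwards [ae_tendsto_integral_dilate hC hs hρ_one (integrable hui)] with x hx hxK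
  rw [indicator_of_mem (Metric.self_subset_cthickening K hxK)] at hx
  refine le_of_tendsto hx.norm ?_
  filter_upwards [Ioc_mem_nhdsGT hR] with ε hε
  refine norm_integral_dilate_smul_le_of_hasWeakDeriv b hp1 hp hρ hs hC hC'
    (fun a => (((hu a).mono hKΩ).indicator hK').mono (Metric.closedBall_subset_cthickening hxK R))
    (integrable hui) (fun a => integrable (hu a).locallyIntegrableOn_deriv) hB ?_ (fun a => ?_) hε
  · rwa [eLpNorm_indicator_eq_eLpNorm_restrict hK']
  · rw [eLpNorm_indicator_eq_eLpNorm_restrict hK']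
    exact hBu' a

end Morrey

/-! ### Unitarity of the spinor representation -/

theorem SpinorRep.rho_star {n : ℕ} {V : Type*} [NormedAddCommGroup V] [InnerProductSpace ℝ V]
    [CompleteSpace V] (κ : SpinorRep n V) (x : CliffordAlgebra (cliffordForm n)) :
    κ.ρ (star x) = star (κ.ρ x) := by
  induction x using CliffordAlgebra.induction with
  | algebraMap r =>
    rw [CliffordAlgebra.star_algebraMap, AlgHom.commutes, ← algebraMap_star_comm, star_trivial]
  | ι v =>
    rw [CliffordAlgebra.star_ι, map_neg, SpinorRep.ρ, CliffordAlgebra.lift_ι_apply]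
    refine (ContinuousLinearMap.eq_adjoint_iff _ _).2 fun ψ φ => ?_
    simp only [neg_apply, inner_neg_left, κ.skew v ψ φ, neg_neg]
  | mul a b ha hb => rw [star_mul, map_mul, ha, hb, map_mul, star_mul]
  | add a b ha hb => rw [star_add, map_add, ha, hb, map_add, star_add]

theorem SpinorRep.norm_rho_le {n : ℕ} {V : Type*} [NormedAddCommGroup V] [InnerProductSpace ℝ V]
    [CompleteSpace V] (κ : SpinorRep n V) (s : spinGroup (cliffordForm n)) :
    ‖κ.ρ (s : CliffordAlgebra (cliffordForm n))‖ ≤ 1 := by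
  set U := κ.ρ (s : CliffordAlgebra (cliffordForm n))
  have hU : star U * U = 1 := by
    rw [← κ.rho_star, ← map_mul, spinGroup.star_mul_self_of_mem s.2, map_one]
  have hsq : ‖U‖ * ‖U‖ ≤ 1 := by
    rw [← CStarRing.norm_star_mul_self, hU]
    exact ContinuousLinearMap.norm_id_le
  exact le_of_abs_le (abs_le_one_iff_mul_self_le_one.2 hsq)

theorem norm_mul_mul_le_of_norm_le_one {A : Type*} [NormedRing A] {a c : A} (ha : ‖a‖ ≤ 1)
    (hc : ‖c‖ ≤ 1) (b : A) : ‖a * b * c‖ ≤ ‖b‖ :=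
  calc ‖a * b * c‖ ≤ ‖a‖ * ‖b‖ * ‖c‖ := norm_mul₃_le
    _ ≤ 1 * ‖b‖ * 1 := by gcongr
    _ = ‖b‖ := by ring

section Geometry

variable {n : ℕ} {M : Type*} [TopologicalSpace M] [ChartedSpace (E n) M]
  [IsManifold (𝓡 n) ∞ M] {g : RMetric n M}

namespace SpinStructure

variable (σ : SpinStructure g) {V : Type*} [NormedAddCommGroup V]
  [InnerProductSpace ℝ V] (κ : SpinorRep n V)

theorem norm_coordChange_le [CompleteSpace V] (i j : ℕ) (x : M) :
    ‖(σ.spinorBundle κ).coordChange i j x‖ ≤ 1 :=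
  κ.norm_rho_le _

theorem coordChange_mul_coordChange {i j : ℕ} {x : M} (hi : x ∈ σ.U i) (hj : x ∈ σ.U j) :
    (σ.spinorBundle κ).coordChange i j x * (σ.spinorBundle κ).coordChange j i x = 1 := by
  ext v
  rw [mul_apply_eq_comp, (σ.spinorBundle κ).coordChange_comp j i j x ⟨⟨hj, hi⟩, hj⟩ v]
  exact (σ.spinorBundle κ).coordChange_self j x hj v

theorem endRep_mul {i : ℕ} {x : M} (hx : x ∈ σ.U i) (B C : EndSpinor V) :
    σ.endRep κ i x (B * C) = σ.endRep κ i x B * σ.endRep κ i x C := by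
  have hinv := σ.coordChange_mul_coordChange κ hx (σ.mem_U_indexAt x)
  simp only [endRep]
  calc _ = (σ.spinorBundle κ).coordChange (σ.indexAt x) i x * B * 1 * C *
        (σ.spinorBundle κ).coordChange i (σ.indexAt x) x := by simp only [mul_one, mul_assoc]
    _ = _ := by simp only [← hinv, mul_assoc]

theorem norm_endRep_le [CompleteSpace V] (i : ℕ) (x : M) (B : EndSpinor V) :
    ‖σ.endRep κ i x B‖ ≤ ‖B‖ :=
  norm_mul_mul_le_of_norm_le_one (σ.norm_coordChange_le κ _ _ x) (σ.norm_coordChange_le κ _ _ x) B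

theorem norm_endRep [CompleteSpace V] {i : ℕ} {x : M} (hx : x ∈ σ.U i) (B : EndSpinor V) :
    ‖σ.endRep κ i x B‖ = ‖B‖ := by
  refine le_antisymm (σ.norm_endRep_le κ i x B) ?_
  have hinv := σ.coordChange_mul_coordChange κ hx (σ.mem_U_indexAt x)
  have hB : (σ.spinorBundle κ).coordChange i (σ.indexAt x) x * σ.endRep κ i x B *
      (σ.spinorBundle κ).coordChange (σ.indexAt x) i x = B := by
    calc _ = (σ.spinorBundle κ).coordChange i (σ.indexAt x) x *
            (σ.spinorBundle κ).coordChange (σ.indexAt x) i x * B *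
          ((σ.spinorBundle κ).coordChange i (σ.indexAt x) x *
            (σ.spinorBundle κ).coordChange (σ.indexAt x) i x) := by simp only [endRep, mul_assoc]
      _ = B := by rw [hinv, one_mul, mul_one]
  conv_lhs => rw [← hB]
  exact norm_mul_mul_le_of_norm_le_one (σ.norm_coordChange_le κ _ _ x)
    (σ.norm_coordChange_le κ _ _ x) _

/-! ### Local bounds for the metric and connection coefficients -/

theorem norm_coord_sq_le {i : ℕ} {x : M} (hx : x ∈ σ.U i) (X : TangentSpace (𝓡 n) x) :
    ‖σ.coord i x X‖ ^ 2 ≤ g.inner x X X := by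
  have inner_self_nonneg : ∀ Y : TangentSpace (𝓡 n) x, 0 ≤ g.inner x Y Y := by
    intro Y
    by_cases hY : Y = 0
    · simp [hY]
    · exact (g.pos x Y hY).le
  set c : Fin n → ℝ := fun a => g.inner x (σ.frame i a x) X
  have hleft : g.inner x X (∑ a, c a • σ.frame i a x) = ∑ a, c a ^ 2 := by
    simp only [map_sum, map_smul, smul_eq_mul]
    exact Finset.sum_congr rfl fun a _ => by rw [g.symm, sq]
  have hright : g.inner x (∑ a, c a • σ.frame i a x) X = ∑ a, c a ^ 2 := (g.symm x _ _).trans hleft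
  have hboth : g.inner x (∑ a, c a • σ.frame i a x) (∑ a, c a • σ.frame i a x) =
      ∑ a, c a ^ 2 := by
    simp only [map_sum, map_smul, sum_apply, smul_apply, smul_eq_mul, σ.orthonormal i x hx,
      mul_ite, mul_one, mul_zero, Finset.sum_ite_eq', Finset.mem_univ, if_true, sq]
  have h := inner_self_nonneg (X - ∑ a, c a • σ.frame i a x)
  rw [map_sub, map_sub, sub_apply, sub_apply, hleft, hright, hboth] at h
  rw [EuclideanSpace.norm_sq_eq]
  simp only [coord, Real.norm_eq_abs, sq_abs]
  linarith

theorem continuousOn_inner_mlieBracket {U : Set M} (hU : IsOpen U)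
    {X Y Z : (x : M) → TangentSpace (𝓡 n) x}
    (hX : ContMDiffOn (𝓡 n) (𝓡 n).tangent ∞ (fun x => (⟨x, X x⟩ : TangentBundle (𝓡 n) M)) U)
    (hY : ContMDiffOn (𝓡 n) (𝓡 n).tangent ∞ (fun x => (⟨x, Y x⟩ : TangentBundle (𝓡 n) M)) U)
    (hZ : ContMDiffOn (𝓡 n) (𝓡 n).tangent ∞ (fun x => (⟨x, Z x⟩ : TangentBundle (𝓡 n) M)) U) :
    ContinuousOn (fun x => g.inner x (VectorField.mlieBracket (𝓡 n) X Y x) (Z x)) U := by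
  let : RiemannianBundle (fun x : M => TangentSpace (𝓡 n) x) := ⟨g.toRiemannianMetric⟩
  have : IsManifold (𝓡 n) (((⊤ : ℕ∞) : WithTop ℕ∞) + 1) M := by
    simpa using (inferInstance : IsManifold (𝓡 n) ∞ M)
  have : IsManifold (𝓡 n) (minSmoothness ℝ 2) M := by
    rw [minSmoothness_of_isRCLikeNormedField]
    exact IsManifold.of_le (n := ((⊤ : ℕ∞) : WithTop ℕ∞))
      (WithTop.coe_le_coe.2 (le_top : (2 : ℕ∞) ≤ ⊤))
  intro x hx
  have hxU : U ∈ 𝓝 x := hU.mem_nhds hx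
  have hbracket : ContMDiffAt (𝓡 n) (𝓡 n).tangent ((0 : ℕ∞) : WithTop ℕ∞) (fun x =>
      (⟨x, VectorField.mlieBracket (𝓡 n) X Y x⟩ : TangentBundle (𝓡 n) M)) x :=
    ContMDiffAt.mlieBracket_vectorField (n := ⊤) (hX.contMDiffAt hxU) (hY.contMDiffAt hxU)
      (by simp [minSmoothness_of_isRCLikeNormedField])
  have hZ₀ := (hZ.contMDiffAt hxU).of_le
    (show ((0 : ℕ∞) : WithTop ℕ∞) ≤ ((⊤ : ℕ∞) : WithTop ℕ∞) by simp)
  exact (hbracket.inner_bundle hZ₀).continuousAt.continuousWithinAt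

theorem continuousOn_leviCivita (i : ℕ) (c a b : Fin n) :
    ContinuousOn (fun x => σ.leviCivita i x c a b) (σ.U i) := by
  have h := fun a b c => continuousOn_inner_mlieBracket (g := g) (σ.isOpen_U i)
    (σ.smooth_frame i a) (σ.smooth_frame i b) (σ.smooth_frame i c)
  exact continuousOn_const.mul (((h c a b).sub (h a b c)).add (h b c a))

theorem exists_norm_coord_le {φ : OpenPartialHomeomorph M (E n)} (hφ : φ ∈ atlas (E n) M)
    {K : Set (E n)} (hK : IsCompact K) (hKφ : K ⊆ φ.target) (v : E n) :
    ∃ C : ℝ, 0 ≤ C ∧ ∀ y ∈ K, ∀ j, φ.symm y ∈ σ.U j →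
      ‖σ.coord j (φ.symm y) (coordVec φ y v)‖ ≤ C := by
  obtain ⟨C, hC⟩ := hK.exists_bound_of_continuousOn ((continuousOn_gram g hφ v v).mono hKφ)
  refine ⟨√C, Real.sqrt_nonneg _, fun y hy j hj => Real.le_sqrt_of_sq_le ?_⟩
  exact (σ.norm_coord_sq_le hj _).trans ((le_abs_self _).trans (hC y hy))

theorem exists_norm_connForm_le {i : ℕ} {φ : OpenPartialHomeomorph M (E n)}
    (hφ : φ ∈ atlas (E n) M) {K : Set (E n)} (hK : IsCompact K) (hKφ : K ⊆ σ.localDom i φ)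
    (v : E n) :
    ∃ C : ℝ, 0 ≤ C ∧ ∀ y ∈ K, ‖σ.connForm κ i (φ.symm y) (coordVec φ y v)‖ ≤ C := by
  obtain ⟨C, hC0, hC⟩ := σ.exists_norm_coord_le hφ hK (hKφ.trans inter_subset_left) v
  have hlc : ∀ c a b, ∃ D, ∀ y ∈ K, ‖σ.leviCivita i (φ.symm y) c a b‖ ≤ D := fun c a b =>
    hK.exists_bound_of_continuousOn ((σ.continuousOn_leviCivita i c a b).comp
      (φ.symm.continuousOn.mono (hKφ.trans inter_subset_left)) fun y hy => (hKφ hy).2)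
  choose D hD using hlc
  refine ⟨‖(1 / 4 : ℝ)‖ * ∑ a, ∑ b, (∑ c, C * |D c a b|) *
    ‖κ.γ (EuclideanSpace.single a 1) * κ.γ (EuclideanSpace.single b 1)‖, by positivity,
    fun y hy => ?_⟩
  rw [connForm, norm_smul]
  gcongr
  refine norm_sum_le_of_le _ fun a _ => norm_sum_le_of_le _ fun b _ => ?_
  rw [norm_smul]
  gcongr
  refine norm_sum_le_of_le _ fun c _ => ?_
  rw [norm_mul]
  gcongr
  · exact (PiLp.norm_apply_le _ c).trans (hC y hy i (hKφ hy).2)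
  · exact (hD c a b y hy).trans (le_abs_self _)

end SpinStructure

/-! ### The volume measure in charts -/

theorem continuousOn_volDensity (g : RMetric n M) {φ : OpenPartialHomeomorph M (E n)}
    (hφ : φ ∈ atlas (E n) M) : ContinuousOn (volDensity g φ) φ.target := by
  have hgram : ContinuousOn (fun y => (Matrix.of fun a b : Fin n =>
      g.inner (φ.symm y) (coordVec φ y (EuclideanSpace.single a 1))
        (coordVec φ y (EuclideanSpace.single b 1)))) φ.target :=
    continuousOn_pi.2 fun a => continuousOn_pi.2 fun b => continuousOn_gram g hφ _ _
  exact Real.continuous_sqrt.comp_continuousOn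
    ((Continuous.matrix_det continuous_id).comp_continuousOn hgram)

theorem restrict_le_smul_withDensity {α : Type*} [MeasurableSpace α] {μ : Measure α} {s t : Set α}
    (hs : MeasurableSet s) (hst : s ⊆ t) {d : α → ℝ≥0∞} {c : ℝ≥0∞} (hc0 : c ≠ 0) (hc : c ≠ ⊤)
    (hd : ∀ x ∈ s, c ≤ d x) : μ.restrict s ≤ c⁻¹ • (μ.restrict t).withDensity d :=
  calc μ.restrict s = c⁻¹ • (μ.restrict s).withDensity fun _ => c := by
        rw [withDensity_const, smul_smul, ENNReal.inv_mul_cancel hc0 hc, one_smul]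
    _ ≤ c⁻¹ • (μ.restrict s).withDensity d := by
        gcongr
        exact withDensity_mono (ae_restrict_of_forall_mem hs hd)
    _ ≤ c⁻¹ • (μ.restrict t).withDensity d := by
        gcongr
        rw [← inter_eq_self_of_subset_left hst, ← Measure.restrict_restrict hs,
          ← restrict_withDensity hs]
        exact Measure.restrict_le_self

theorem iSup_measure_apply_eq_zero {α : Type*} [MeasurableSpace α] {ι : Sort*} {μ : ι → Measure α}
    {s : Set α} (hs : MeasurableSet s) (h : ∀ i, μ i s = 0) : (⨆ i, μ i) s = 0 := by
  have hle : ⨆ i, μ i ≤ (⨆ i, μ i).restrict sᶜ := iSup_le fun i => by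
    have hmem : ∀ᵐ x ∂μ i, x ∈ sᶜ := measure_eq_zero_iff_ae_notMem.1 (h i)
    rw [← Measure.restrict_eq_self_of_ae_mem hmem]
    exact Measure.restrict_mono_measure (le_iSup μ i) _
  refine le_antisymm ((hle s).trans_eq ?_) zero_le
  rw [Measure.restrict_apply hs, inter_compl_self, measure_empty]

theorem measurableSet_inter_preimage {X Y : Type*} [TopologicalSpace X] [MeasurableSpace X]
    [OpensMeasurableSpace X] [TopologicalSpace Y] [MeasurableSpace Y] [BorelSpace Y] {f : X → Y}
    {s : Set X} (hf : ContinuousOn f s) (hs : MeasurableSet s) {B : Set Y} (hB : MeasurableSet B) :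
    MeasurableSet (s ∩ f ⁻¹' B) := by
  rw [← Subtype.image_preimage_coe]
  exact hs.subtype_image (continuousOn_iff_continuous_domRestrict.1 hf |>.measurable hB)

theorem aemeasurable_symm_withDensity {X Y : Type*} [TopologicalSpace X] [MeasurableSpace X]
    [BorelSpace X] [TopologicalSpace Y] [MeasurableSpace Y] [OpensMeasurableSpace Y]
    (φ : OpenPartialHomeomorph X Y) (μ : Measure Y) (d : Y → ℝ≥0∞) :
    AEMeasurable φ.symm ((μ.restrict φ.target).withDensity d) :=
  (φ.symm.continuousOn.aemeasurable φ.open_target.measurableSet).mono_ac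
    (withDensity_absolutelyContinuous _ _)

variable (g)

/-- The measure on `M` which is `√det g dy` in the chart `φ`; the Riemannian volume is the supremum
of these measures. -/
noncomputable def chartVol [MeasurableSpace M] (φ : OpenPartialHomeomorph M (E n)) : Measure M :=
  Measure.map φ.symm
    ((volume.restrict φ.target).withDensity fun y => ENNReal.ofReal (volDensity g φ y))

variable {φ ψ : OpenPartialHomeomorph M (E n)}

theorem volume_image_transition_eq_zero (hφ : φ ∈ atlas (E n) M) (hψ : ψ ∈ atlas (E n) M)
    {B : Set (E n)} (hB : volume B = 0) :
    volume ((φ.symm.trans ψ) '' (B ∩ (φ.symm.trans ψ).source)) = 0 := by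
  have hmem : φ.symm.trans ψ ∈ contDiffGroupoid ∞ (𝓡 n) := HasGroupoid.compatible hφ hψ
  rw [contDiffGroupoid, mem_groupoid_of_pregroupoid] at hmem
  have hd : ContDiffOn ℝ ∞ (φ.symm.trans ψ) (φ.symm.trans ψ).source := by
    simpa [contDiffPregroupoid] using hmem.1
  exact addHaar_image_eq_zero_of_differentiableOn_of_addHaar_eq_zero volume
    ((hd.differentiableOn (by simp)).mono inter_subset_right)
    (measure_mono_null inter_subset_left hB)

variable [MeasurableSpace M]

theorem chartVol_le_vol (hφ : φ ∈ atlas (E n) M) : chartVol g φ ≤ vol g :=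
  le_iSup₂ (f := fun (φ : OpenPartialHomeomorph M (E n)) (_ : φ ∈ atlas (E n) M) => chartVol g φ)
    φ hφ

variable [BorelSpace M]

theorem chartVol_apply_eq_zero {N : Set M} (hN : MeasurableSet N)
    (h : volume (φ.target ∩ φ.symm ⁻¹' N) = 0) : chartVol g φ N = 0 := by
  rw [chartVol, Measure.map_apply_of_aemeasurable (aemeasurable_symm_withDensity φ _ _) hN]
  refine withDensity_absolutelyContinuous _ _ ?_
  rwa [Measure.restrict_apply' φ.open_target.measurableSet, inter_comm]

theorem vol_apply_eq_zero {N : Set M} (hN : MeasurableSet N)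
    (h : ∀ φ ∈ atlas (E n) M, volume (φ.target ∩ φ.symm ⁻¹' N) = 0) : vol g N = 0 :=
  iSup_measure_apply_eq_zero hN fun φ => iSup_measure_apply_eq_zero hN fun hφ =>
    chartVol_apply_eq_zero g hN (h φ hφ)

theorem exists_map_restrict_le_vol (hφ : φ ∈ atlas (E n) M) {K : Set (E n)} (hK : IsCompact K)
    (hKφ : K ⊆ φ.target) :
    ∃ C : ℝ≥0∞, C ≠ ⊤ ∧ Measure.map φ.symm (volume.restrict K) ≤ C • vol g := by
  obtain ⟨c, hc0, hc⟩ : ∃ c > 0, ∀ y ∈ K, c ≤ volDensity g φ y :=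
    hK.exists_forall_le' ((continuousOn_volDensity g hφ).mono hKφ)
      fun y hy => volDensity_pos g hφ (hKφ hy)
  have hc0' : ENNReal.ofReal c ≠ 0 := by simpa using hc0
  refine ⟨(ENNReal.ofReal c)⁻¹, ENNReal.inv_ne_top.2 hc0', ?_⟩
  have hle := restrict_le_smul_withDensity (μ := volume) hK.measurableSet hKφ hc0'
    ENNReal.ofReal_ne_top fun y hy => ENNReal.ofReal_le_ofReal (hc y hy)
  refine (Measure.map_mono_of_aemeasurable hle
    ((aemeasurable_symm_withDensity φ _ _).smul_measure _)).trans ?_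
  rw [Measure.map_smul]
  gcongr
  exact chartVol_le_vol g hφ

theorem vol_source_inter_preimage_eq_zero (hφ : φ ∈ atlas (E n) M) {B : Set (E n)}
    (hB : volume B = 0) : vol g (φ.source ∩ φ ⁻¹' B) = 0 := by
  have hsub : φ.source ∩ φ ⁻¹' B ⊆ φ.source ∩ φ ⁻¹' toMeasurable volume B :=
    inter_subset_inter_right _ (preimage_mono (subset_toMeasurable _ _))
  refine measure_mono_null hsub (vol_apply_eq_zero g
    (measurableSet_inter_preimage φ.continuousOn φ.open_source.measurableSet
      (measurableSet_toMeasurable _ _)) fun ψ hψ => ?_)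
  refine measure_mono_null ?_ (volume_image_transition_eq_zero hφ hψ
    ((measure_toMeasurable B).trans hB))
  rintro z ⟨hz, hzφ, hzB⟩
  refine ⟨φ (ψ.symm z), ⟨hzB, ?_⟩, ?_⟩
  · rw [OpenPartialHomeomorph.trans_source]
    refine ⟨φ.map_source hzφ, ?_⟩
    rw [mem_preimage, φ.left_inv hzφ]
    exact ψ.map_target hz
  · simp [φ.left_inv hzφ, ψ.right_inv hz]

theorem ae_vol_of_ae_charts {ι : Type*} [Countable ι]
    {φ : ι → OpenPartialHomeomorph M (E n)} (hφ : ∀ i, φ i ∈ atlas (E n) M) {K : ι → Set (E n)}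
    (hK : ∀ i, MeasurableSet (K i))
    (hcov : ∀ x, ∃ i, x ∈ (φ i).source ∧ φ i x ∈ K i) {P : M → Prop}
    (hP : ∀ i, ∀ᵐ y ∂(volume.restrict (K i)), P ((φ i).symm y)) : ∀ᵐ x ∂vol g, P x := by
  have hnull : ∀ i, volume {y | ¬ (y ∈ K i → P ((φ i).symm y))} = 0 := fun i =>
    (ae_restrict_iff' (hK i)).1 (hP i)
  refine measure_mono_null (fun x hx => ?_)
    (measure_iUnion_null fun i => vol_source_inter_preimage_eq_zero g (hφ i) (hnull i))
  obtain ⟨i, hi, hiK⟩ := hcov x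
  refine mem_iUnion.2 ⟨i, hi, fun h => hx ?_⟩
  have hP' := h hiK
  rwa [(φ i).left_inv hi] at hP'

end Geometry

/-! ### Sobolev embedding -/

theorem exists_eLpNorm_comp_symm_le {n : ℕ} {M : Type*} [TopologicalSpace M] [ChartedSpace (E n) M]
    [IsManifold (𝓡 n) ∞ M] [MeasurableSpace M] [BorelSpace M] (X : Type*) [NormedAddCommGroup X]
    (g : RMetric n M) {p : ℝ≥0∞} (hpt : p ≠ ⊤) {φ : OpenPartialHomeomorph M (E n)}
    (hφ : φ ∈ atlas (E n) M) {K : Set (E n)} (hK : IsCompact K) (hKφ : K ⊆ φ.target) :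
    ∃ C : ℝ, 0 ≤ C ∧ ∀ f : M → X, AEStronglyMeasurable f (vol g) →
      eLpNorm (fun y => f (φ.symm y)) p (volume.restrict K) ≤
        ENNReal.ofReal C * eLpNorm f p (vol g) := by
  obtain ⟨C, hC, hle⟩ := exists_map_restrict_le_vol g hφ hK hKφ
  have hm : AEMeasurable φ.symm (volume.restrict K) :=
    (φ.symm.continuousOn.mono hKφ).aemeasurable hK.measurableSet
  have hCp : C ^ (1 / p).toReal ≠ ⊤ := ENNReal.rpow_ne_top_of_nonneg ENNReal.toReal_nonneg hC
  refine ⟨(C ^ (1 / p).toReal).toReal, ENNReal.toReal_nonneg, fun f hf => ?_⟩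
  rw [ENNReal.ofReal_toReal hCp]
  calc eLpNorm (fun y => f (φ.symm y)) p (volume.restrict K)
      = eLpNorm f p (Measure.map φ.symm (volume.restrict K)) :=
        (eLpNorm_map_measure ((hf.smul_measure C).mono_measure hle) hm).symm
    _ ≤ eLpNorm f p (C • vol g) := eLpNorm_mono_measure f hle
    _ = C ^ (1 / p).toReal * eLpNorm f p (vol g) := by
        rw [eLpNorm_smul_measure_of_ne_top hpt, smul_eq_mul]

theorem eLpNorm_norm_fst_add_norm_snd_le {α X Y : Type*} [MeasurableSpace α] {μ : Measure α}
    [NormedAddCommGroup X] [NormedAddCommGroup Y] {p : ℝ≥0∞} [Fact (1 ≤ p)]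
    (u : WithLp 1 (Lp X p μ × Lp Y p μ)) :
    eLpNorm (fun x => ‖u.fst x‖ + ‖u.snd x‖) p μ ≤ ENNReal.ofReal ‖u‖ := by
  refine (eLpNorm_add_le (Lp.aestronglyMeasurable _).norm (Lp.aestronglyMeasurable _).norm
    Fact.out).trans_eq ?_
  rw [eLpNorm_norm, eLpNorm_norm, WithLp.prod_norm_eq_of_L1,
    ENNReal.ofReal_add (norm_nonneg _) (norm_nonneg _), Lp.norm_def, Lp.norm_def,
    ENNReal.ofReal_toReal (Lp.eLpNorm_ne_top _), ENNReal.ofReal_toReal (Lp.eLpNorm_ne_top _)]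

namespace SpinStructure

section Sobolev

variable {n : ℕ} {M : Type*} [TopologicalSpace M] [ChartedSpace (E n) M]
  [IsManifold (𝓡 n) ∞ M] {g : RMetric n M} (σ : SpinStructure g) {V : Type*}
  [NormedAddCommGroup V] [InnerProductSpace ℝ V] (κ : SpinorRep n V)

theorem hasWeakCovDeriv_iff {F : M → EndSpinor V} {G : M → (E n →L[ℝ] EndSpinor V)} :
    σ.HasWeakCovDeriv κ F G ↔ ∀ i, ∀ φ ∈ atlas (E n) M, ∀ v,
      HasWeakDeriv volume (σ.localDom i φ) v (σ.localSec κ i φ F) (σ.localDeriv κ i φ v F G) :=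
  ⟨fun h i φ hφ v => ⟨(h i φ hφ v).1, (h i φ hφ v).2.1, (h i φ hφ v).2.2⟩,
    fun h i φ hφ v => ⟨(h i φ hφ v).1, (h i φ hφ v).2, (h i φ hφ v).3⟩⟩

theorem exists_nhds_isCompact_subset_localDom (x : M) :
    ∃ K : Set (E n), IsCompact K ∧ K ⊆ σ.localDom (σ.indexAt x) (chartAt (E n) x) ∧
      {z | z ∈ (chartAt (E n) x).source ∧ chartAt (E n) x z ∈ K} ∈ 𝓝 x := by
  set φ := chartAt (E n) x
  have hxs : x ∈ φ.source := mem_chart_source _ x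
  have hy : φ x ∈ σ.localDom (σ.indexAt x) φ := by
    refine ⟨φ.map_source hxs, ?_⟩
    rw [mem_preimage, φ.left_inv hxs]
    exact σ.mem_U_indexAt x
  obtain ⟨r, hr, hrs⟩ :=
    Metric.nhds_basis_closedBall.mem_iff.1 ((σ.isOpen_localDom _ φ).mem_nhds hy)
  exact ⟨Metric.closedBall (φ x) r, isCompact_closedBall _ _, hrs,
    inter_mem (φ.open_source.mem_nhds hxs)
      ((φ.continuousAt hxs).preimage_mem_nhds (Metric.closedBall_mem_nhds _ hr))⟩

variable [CompleteSpace V]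

theorem exists_norm_localDeriv_le {i : ℕ} {φ : OpenPartialHomeomorph M (E n)}
    (hφ : φ ∈ atlas (E n) M) {K : Set (E n)} (hK : IsCompact K) (hKφ : K ⊆ σ.localDom i φ)
    (v : E n) : ∃ C : ℝ, 0 ≤ C ∧ ∀ (F : M → EndSpinor V) (G : M → (E n →L[ℝ] EndSpinor V)),
      ∀ y ∈ K, ‖σ.localDeriv κ i φ v F G y‖ ≤ C * (‖F (φ.symm y)‖ + ‖G (φ.symm y)‖) := by
  obtain ⟨C₁, hC₁0, hC₁⟩ := σ.exists_norm_coord_le hφ hK (hKφ.trans inter_subset_left) v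
  obtain ⟨C₂, hC₂0, hC₂⟩ := σ.exists_norm_connForm_le κ hφ hK hKφ v
  refine ⟨C₁ + 2 * C₂, by positivity, fun F G y hy => ?_⟩
  set x := φ.symm y
  have hG : ‖σ.endRep κ i x (G x (σ.coord (σ.indexAt x) x (coordVec φ y v)))‖ ≤ ‖G x‖ * C₁ :=
    (σ.norm_endRep_le κ i x _).trans
      ((G x).le_opNorm_of_le (hC₁ y hy _ (σ.mem_U_indexAt _)))
  have hF : ‖σ.localSec κ i φ F y‖ ≤ ‖F x‖ := σ.norm_endRep_le κ i x _
  have hωF := norm_mul_le_of_le (hC₂ y hy) hF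
  have hFω := norm_mul_le_of_le hF (hC₂ y hy)
  calc ‖σ.localDeriv κ i φ v F G y‖ ≤ ‖G x‖ * C₁ + (C₂ * ‖F x‖ + ‖F x‖ * C₂) :=
        norm_sub_le_of_le hG (norm_sub_le_of_le hωF hFω)
    _ ≤ _ := by
        linarith [mul_nonneg hC₁0 (norm_nonneg (F x)), mul_nonneg hC₂0 (norm_nonneg (G x))]

variable [MeasurableSpace M] [BorelSpace M] {p : ℝ≥0∞} (hpt : p ≠ ⊤)
  {i : ℕ} {φ : OpenPartialHomeomorph M (E n)} (hφ : φ ∈ atlas (E n) M) {K : Set (E n)}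
  (hK : IsCompact K) (hKφ : K ⊆ σ.localDom i φ)

include hpt hφ hK hKφ

theorem exists_eLpNorm_localSec_le : ∃ C : ℝ, 0 ≤ C ∧
    ∀ u : Lp (EndSpinor V) p (vol g),
      eLpNorm (σ.localSec κ i φ u) p (volume.restrict K) ≤ ENNReal.ofReal (C * ‖u‖) := by
  obtain ⟨C, hC0, hC⟩ :=
    exists_eLpNorm_comp_symm_le (EndSpinor V) g hpt hφ hK (hKφ.trans inter_subset_left)
  refine ⟨C, hC0, fun u => ?_⟩
  calc eLpNorm (σ.localSec κ i φ u) p (volume.restrict K)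
      ≤ eLpNorm (fun y => u (φ.symm y)) p (volume.restrict K) :=
        eLpNorm_mono fun y => σ.norm_endRep_le κ i _ _
    _ ≤ ENNReal.ofReal C * eLpNorm u p (vol g) := hC _ (Lp.aestronglyMeasurable _)
    _ = ENNReal.ofReal (C * ‖u‖) := by
        rw [ENNReal.ofReal_mul hC0, Lp.norm_def,
          ENNReal.ofReal_toReal (Lp.eLpNorm_ne_top _)]

variable [Fact (1 ≤ p)]

theorem exists_eLpNorm_localDeriv_le (v : E n) : ∃ C : ℝ, 0 ≤ C ∧
    ∀ u : WithLp 1 (Lp (EndSpinor V) p (vol g) × Lp (E n →L[ℝ] EndSpinor V) p (vol g)),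
      eLpNorm (σ.localDeriv κ i φ v u.fst u.snd) p (volume.restrict K) ≤
        ENNReal.ofReal (C * ‖u‖) := by
  obtain ⟨C, hC0, hC⟩ := exists_eLpNorm_comp_symm_le ℝ g hpt hφ hK (hKφ.trans inter_subset_left)
  obtain ⟨D, hD0, hD⟩ := σ.exists_norm_localDeriv_le κ hφ hK hKφ v
  refine ⟨D * C, by positivity, fun u => ?_⟩
  have hbound : ∀ᵐ y ∂volume.restrict K, ‖σ.localDeriv κ i φ v u.fst u.snd y‖ ≤
      D * ‖‖u.fst (φ.symm y)‖ + ‖u.snd (φ.symm y)‖‖ := by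
    filter_upwards [ae_restrict_mem hK.measurableSet] with y hy
    rw [Real.norm_of_nonneg (by positivity)]
    exact hD _ _ y hy
  calc eLpNorm (σ.localDeriv κ i φ v u.fst u.snd) p (volume.restrict K)
      ≤ ENNReal.ofReal D * eLpNorm (fun y => ‖u.fst (φ.symm y)‖ + ‖u.snd (φ.symm y)‖) p
          (volume.restrict K) := eLpNorm_le_mul_eLpNorm_of_ae_le_mul hbound p
    _ ≤ ENNReal.ofReal D * (ENNReal.ofReal C *
          eLpNorm (fun x => ‖u.fst x‖ + ‖u.snd x‖) p (vol g)) := by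
        gcongr
        exact hC (fun x => ‖u.fst x‖ + ‖u.snd x‖)
          ((Lp.aestronglyMeasurable _).norm.add (Lp.aestronglyMeasurable _).norm)
    _ ≤ ENNReal.ofReal D * (ENNReal.ofReal C * ENNReal.ofReal ‖u‖) := by
        gcongr
        exact eLpNorm_norm_fst_add_norm_snd_le u
    _ = ENNReal.ofReal (D * C * ‖u‖) := by
        rw [ENNReal.ofReal_mul (by positivity), ENNReal.ofReal_mul hD0, mul_assoc]

theorem exists_norm_sec_comp_symm_le (hp : (n : ℝ≥0∞) < p) :
    ∃ C : ℝ, 0 ≤ C ∧ ∀ u : σ.W1p κ p, ∀ᵐ y ∂volume.restrict K,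
      ‖sec u (φ.symm y)‖ ≤ C * ‖u‖ := by
  obtain ⟨R, hR, hRs⟩ := hK.exists_cthickening_subset_open (σ.isOpen_localDom i φ) hKφ
  have hp' : (Module.finrank ℝ (E n) : ℝ) < p.toReal := by
    rw [finrank_euclideanSpace_fin]
    simpa using (ENNReal.toReal_lt_toReal (ENNReal.natCast_ne_top n) hpt).2 hp
  obtain ⟨C, hC0, hC⟩ := exists_morrey_bound (μ := (volume : Measure (E n)))
    (EuclideanSpace.basisFun (Fin n) ℝ).toBasis Fact.out hp' hR
  obtain ⟨D₀, hD₀0, hD₀⟩ := σ.exists_eLpNorm_localSec_le κ hpt hφ hK.cthickening hRs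
  choose D' _ hD' using σ.exists_eLpNorm_localDeriv_le κ hpt hφ hK.cthickening hRs
  obtain ⟨D, hD⟩ := Finite.exists_le fun a => D' ((EuclideanSpace.basisFun (Fin n) ℝ).toBasis a)
  refine ⟨C * max D₀ D, by positivity, fun u => ?_⟩
  have hu := (σ.hasWeakCovDeriv_iff κ).1 u.2 i φ hφ
  have hfst : ‖u.1.fst‖ ≤ ‖u‖ := by
    change ‖u.1.fst‖ ≤ ‖u.1‖
    rw [WithLp.prod_norm_eq_of_L1]
    exact le_add_of_nonneg_right (norm_nonneg _)
  have hmorrey := hC hK hRs (hu 0).locallyIntegrableOn (fun a => hu _) (max D₀ D * ‖u‖)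
    (by positivity)
    ((hD₀ u.1.fst).trans (ENNReal.ofReal_le_ofReal (by gcongr; exact le_max_left _ _)))
    fun a => (hD' _ u.1).trans (ENNReal.ofReal_le_ofReal
      (mul_le_mul_of_nonneg_right ((hD a).trans (le_max_right _ _)) (norm_nonneg _)))
  filter_upwards [hmorrey, ae_restrict_mem hK.measurableSet] with y hy hyK
  rw [mul_assoc]
  exact (σ.norm_endRep κ (hKφ hyK).2 _).symm.trans_le hy

omit hpt hφ hK hKφ

theorem exists_norm_sec_le [CompactSpace M] (hp : (n : ℝ≥0∞) < p) (hpt : p ≠ ⊤) :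
    ∃ C : ℝ, 0 ≤ C ∧ ∀ u : σ.W1p κ p, ∀ᵐ x ∂vol g, ‖sec u x‖ ≤ C * ‖u‖ := by
  choose K hK hKφ hnhds using σ.exists_nhds_isCompact_subset_localDom
  choose C hC0 hC using fun x =>
    σ.exists_norm_sec_comp_symm_le κ hpt (chart_mem_atlas (E n) x) (hK x) (hKφ x) hp
  obtain ⟨t, ht⟩ := CompactSpace.elim_nhds_subcover _ hnhds
  refine ⟨∑ x ∈ t, C x, Finset.sum_nonneg fun x _ => hC0 x, fun u => ?_⟩
  refine ae_vol_of_ae_charts g (ι := t) (fun x => chart_mem_atlas (E n) x.1)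
    (fun x => (hK x).measurableSet) (fun z => ?_) fun x => ?_
  · obtain ⟨x, hx, hzx⟩ := mem_iUnion₂.1 (ht.ge (mem_univ z))
    exact ⟨⟨x, hx⟩, hzx⟩
  · filter_upwards [hC x u] with y hy
    refine hy.trans ?_
    gcongr
    exact Finset.single_le_sum (fun x _ => hC0 x) x.2

end Sobolev

end SpinStructure

/-! ### Completeness -/

section Limits

variable {α X : Type*} [MeasurableSpace α] [NormedAddCommGroup X] {μ : Measure α} {p : ℝ≥0∞}

theorem tendsto_eLpNorm_one_of_tendsto_eLpNorm [IsFiniteMeasure μ] (hp : 1 ≤ p) {F : ℕ → α → X}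
    (hF : ∀ k, AEStronglyMeasurable (F k) μ)
    (hlim : Tendsto (fun k => eLpNorm (F k) p μ) atTop (𝓝 0)) :
    Tendsto (fun k => eLpNorm (F k) 1 μ) atTop (𝓝 0) := by
  set c : ℝ≥0∞ := μ univ ^ (1 / (1 : ℝ≥0∞).toReal - 1 / p.toReal)
  have hc : c ≠ ⊤ := by
    refine ENNReal.rpow_ne_top_of_nonneg ?_ (measure_ne_top μ univ)
    rcases eq_or_ne p ⊤ with rfl | hpt
    · simp
    · have hp' : 1 ≤ p.toReal := by simpa using ENNReal.toReal_mono hpt hp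
      rw [ENNReal.toReal_one, div_one, sub_nonneg]
      exact (div_le_one (by linarith)).2 hp'
  refine tendsto_of_tendsto_of_tendsto_of_le_of_le tendsto_const_nhds ?_ (fun _ => zero_le)
    fun k => eLpNorm_le_eLpNorm_mul_rpow_measure_univ hp (hF k)
  simpa only [zero_mul] using ENNReal.Tendsto.mul_const hlim (Or.inr hc)

variable [TopologicalSpace α]

theorem locallyIntegrableOn_of_eLpNorm_lt_top [LocallyCompactSpace α] [T2Space α]
    [OpensMeasurableSpace α] [IsFiniteMeasureOnCompacts μ] (hp : 1 ≤ p) {Ω : Set α}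
    (hΩ : IsOpen Ω) {f : α → X} (hf : AEStronglyMeasurable f (μ.restrict Ω))
    (hfin : ∀ K ⊆ Ω, IsCompact K → eLpNorm f p (μ.restrict K) < ⊤) :
    LocallyIntegrableOn f Ω μ := by
  refine (locallyIntegrableOn_iff hΩ.isLocallyClosed).2 fun K hK hKc => ?_
  have : IsFiniteMeasure (μ.restrict K) := ⟨by simpa using hKc.measure_lt_top⟩
  exact MemLp.integrable hp ⟨hf.mono_set hK, hfin K hK hKc⟩

theorem tendsto_setIntegral_smul_of_tendsto_eLpNorm [NormedSpace ℝ X] [OpensMeasurableSpace α]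
    [T2Space α] [IsFiniteMeasureOnCompacts μ] (hp : 1 ≤ p) {Ω : Set α} {ζ : α → ℝ}
    (hζ : Continuous ζ) (hc : HasCompactSupport ζ) (hs : tsupport ζ ⊆ Ω) {f : α → X}
    {F : ℕ → α → X} (hf : LocallyIntegrableOn f Ω μ) (hF : ∀ k, LocallyIntegrableOn (F k) Ω μ)
    (hlim : Tendsto (fun k => eLpNorm (F k - f) p (μ.restrict (tsupport ζ))) atTop (𝓝 0)) :
    Tendsto (fun k => ∫ y in Ω, ζ y • F k y ∂μ) atTop (𝓝 (∫ y in Ω, ζ y • f y ∂μ)) := by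
  set K := tsupport ζ
  have hK : IsCompact K := hc
  have : IsFiniteMeasure (μ.restrict K) := ⟨by simpa using hK.measure_lt_top⟩
  obtain ⟨D, hD⟩ := hc.exists_bound_of_continuous hζ
  have h_integrable (h : α → X) (hh : LocallyIntegrableOn h Ω μ) :
      IntegrableOn (fun y => ζ y • h y) K μ :=
    (hh.integrableOn_compact_subset hs hK).continuousOn_smul hζ.continuousOn hK
  have hlim₁ := tendsto_eLpNorm_one_of_tendsto_eLpNorm hp
    (fun k => ((hF k).integrableOn_compact_subset hs hK).aestronglyMeasurable.sub
      (hf.integrableOn_compact_subset hs hK).aestronglyMeasurable) hlim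
  have hΩK : ∀ h : α → X, ∫ y in Ω, ζ y • h y ∂μ = ∫ y in K, ζ y • h y ∂μ := fun h =>
    (setIntegral_smul_eq_integral hs h).trans (setIntegral_smul_eq_integral subset_rfl h).symm
  simp_rw [hΩK]
  refine tendsto_integral_of_L1' _ (h_integrable f hf).aestronglyMeasurable
    (Eventually.of_forall fun k => h_integrable _ (hF k)) ?_
  refine tendsto_of_tendsto_of_tendsto_of_le_of_le tendsto_const_nhds
    (by simpa using ENNReal.Tendsto.const_mul hlim₁ (Or.inr (ENNReal.ofReal_ne_top (r := D))))
    (fun _ => zero_le) fun k => ?_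
  refine eLpNorm_le_mul_eLpNorm_of_ae_le_mul (Eventually.of_forall fun y => ?_) 1
  rw [Pi.sub_apply, ← smul_sub, norm_smul]
  exact mul_le_mul_of_nonneg_right (hD y) (norm_nonneg _)

end Limits

theorem exists_seq_tendsto_ae_of_tendsto_prod {α X Y : Type*} [MeasurableSpace α]
    [NormedAddCommGroup X] [NormedAddCommGroup Y] {μ : Measure α} {p : ℝ≥0∞} [Fact (1 ≤ p)]
    {u : ℕ → WithLp 1 (Lp X p μ × Lp Y p μ)} {w : WithLp 1 (Lp X p μ × Lp Y p μ)}
    (h : Tendsto u atTop (𝓝 w)) : ∃ ns : ℕ → ℕ, ∀ᵐ x ∂μ,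
      Tendsto (fun k => (u (ns k)).fst x) atTop (𝓝 (w.fst x)) ∧
      Tendsto (fun k => (u (ns k)).snd x) atTop (𝓝 (w.snd x)) := by
  have hfst := ((WithLp.continuous_fst 1 _ _).tendsto w).comp h
  have hsnd := ((WithLp.continuous_snd 1 _ _).tendsto w).comp h
  obtain ⟨ns, hns, hae⟩ := (tendstoInMeasure_of_tendsto_Lp hfst).exists_seq_tendsto_ae
  obtain ⟨ms, hms, hae'⟩ :=
    (tendstoInMeasure_of_tendsto_Lp (hsnd.comp hns.tendsto_atTop)).exists_seq_tendsto_ae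
  refine ⟨ns ∘ ms, ?_⟩
  filter_upwards [hae, hae'] with x hx hx'
  exact ⟨hx.comp hms.tendsto_atTop, hx'⟩

theorem HasWeakDeriv.of_tendsto_eLpNorm {G X : Type*} [NormedAddCommGroup G] [NormedSpace ℝ G]
    [MeasurableSpace G] [OpensMeasurableSpace G] [NormedAddCommGroup X] [NormedSpace ℝ X]
    {μ : Measure G} [IsFiniteMeasureOnCompacts μ] {p : ℝ≥0∞} (hp : 1 ≤ p) {Ω : Set G} {v : G}
    {u u' : G → X} {U U' : ℕ → G → X} (hU : ∀ k, HasWeakDeriv μ Ω v (U k) (U' k))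
    (hu : LocallyIntegrableOn u Ω μ) (hu' : LocallyIntegrableOn u' Ω μ)
    (hlim : ∀ K ⊆ Ω, IsCompact K →
      Tendsto (fun k => eLpNorm (U k - u) p (μ.restrict K)) atTop (𝓝 0))
    (hlim' : ∀ K ⊆ Ω, IsCompact K →
      Tendsto (fun k => eLpNorm (U' k - u') p (μ.restrict K)) atTop (𝓝 0)) :
    HasWeakDeriv μ Ω v u u' := by
  refine ⟨hu, hu', fun η hη hc hs => ?_⟩
  have hds := (tsupport_fderiv_apply_subset ℝ v).trans hs
  have hdc := hc.fderiv_apply (𝕜 := ℝ) v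
  have hleft := tendsto_setIntegral_smul_of_tendsto_eLpNorm hp (continuous_fderiv_apply_const hη v)
    hdc hds hu (fun k => (hU k).locallyIntegrableOn) (hlim _ hds hdc)
  have hright := tendsto_setIntegral_smul_of_tendsto_eLpNorm hp hη.continuous hc hs hu'
    (fun k => (hU k).locallyIntegrableOn_deriv) (hlim' _ hs hc)
  exact tendsto_nhds_unique hleft
    (hright.neg.congr fun k => ((hU k).integral_eq η hη hc hs).symm)

namespace SpinStructure

section Complete

variable {n : ℕ} {M : Type*} [TopologicalSpace M] [ChartedSpace (E n) M]
  [IsManifold (𝓡 n) ∞ M] {g : RMetric n M} (σ : SpinStructure g) {V : Type*}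
  [NormedAddCommGroup V] [InnerProductSpace ℝ V] (κ : SpinorRep n V)

theorem endRep_sub (i : ℕ) (x : M) (B C : EndSpinor V) :
    σ.endRep κ i x (B - C) = σ.endRep κ i x B - σ.endRep κ i x C := by
  simp only [endRep, mul_sub, sub_mul]

theorem continuous_endRep (i : ℕ) (x : M) : Continuous (σ.endRep κ i x) := by
  unfold endRep
  fun_prop

theorem localSec_sub (i : ℕ) (φ : OpenPartialHomeomorph M (E n)) (F F' : M → EndSpinor V) :
    σ.localSec κ i φ (F - F') = σ.localSec κ i φ F - σ.localSec κ i φ F' :=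
  funext fun y => σ.endRep_sub κ i (φ.symm y) _ _

theorem localDeriv_sub (i : ℕ) (φ : OpenPartialHomeomorph M (E n)) (v : E n)
    (F F' : M → EndSpinor V) (G G' : M → (E n →L[ℝ] EndSpinor V)) :
    σ.localDeriv κ i φ v (F - F') (G - G') =
      σ.localDeriv κ i φ v F G - σ.localDeriv κ i φ v F' G' := by
  funext y
  simp only [localDeriv, localSec_sub, Pi.sub_apply, sub_apply, endRep_sub, mul_sub, sub_mul]
  abel

theorem tendsto_localSec (i : ℕ) (φ : OpenPartialHomeomorph M (E n)) {F : ℕ → M → EndSpinor V}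
    {F₀ : M → EndSpinor V} {y : E n}
    (hF : Tendsto (fun k => F k (φ.symm y)) atTop (𝓝 (F₀ (φ.symm y)))) :
    Tendsto (fun k => σ.localSec κ i φ (F k) y) atTop (𝓝 (σ.localSec κ i φ F₀ y)) :=
  ((σ.continuous_endRep κ i _).tendsto _).comp hF

theorem tendsto_localDeriv (i : ℕ) (φ : OpenPartialHomeomorph M (E n)) (v : E n)
    {F : ℕ → M → EndSpinor V} {F₀ : M → EndSpinor V} {G : ℕ → M → (E n →L[ℝ] EndSpinor V)}
    {G₀ : M → (E n →L[ℝ] EndSpinor V)} {y : E n}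
    (hF : Tendsto (fun k => F k (φ.symm y)) atTop (𝓝 (F₀ (φ.symm y))))
    (hG : Tendsto (fun k => G k (φ.symm y)) atTop (𝓝 (G₀ (φ.symm y)))) :
    Tendsto (fun k => σ.localDeriv κ i φ v (F k) (G k) y) atTop
      (𝓝 (σ.localDeriv κ i φ v F₀ G₀ y)) := by
  have hS := σ.tendsto_localSec κ i φ hF
  have hG' := ((ContinuousLinearMap.apply ℝ (EndSpinor V) (σ.coord (σ.indexAt (φ.symm y))
    (φ.symm y) (coordVec φ y v))).continuous.tendsto _).comp hG
  exact (((σ.continuous_endRep κ i _).tendsto _).comp hG').sub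
    ((hS.const_mul _).sub (hS.mul_const _))

variable [MeasurableSpace M] [BorelSpace M] {p : ℝ≥0∞} [Fact (1 ≤ p)] [CompleteSpace V]
  (hpt : p ≠ ⊤) {i : ℕ} {φ : OpenPartialHomeomorph M (E n)} (hφ : φ ∈ atlas (E n) M)

include hpt hφ

theorem tendsto_eLpNorm_localSec_sub {K : Set (E n)} (hK : IsCompact K)
    (hKφ : K ⊆ σ.localDom i φ) {u : ℕ → Lp (EndSpinor V) p (vol g)}
    {w : Lp (EndSpinor V) p (vol g)} (h : Tendsto u atTop (𝓝 w)) :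
    Tendsto (fun k => eLpNorm (σ.localSec κ i φ (u k) - σ.localSec κ i φ w) p
      (volume.restrict K)) atTop (𝓝 0) := by
  obtain ⟨C, -, hC⟩ := σ.exists_eLpNorm_localSec_le κ hpt hφ hK hKφ
  have hbound : Tendsto (fun k => ENNReal.ofReal (C * ‖u k - w‖)) atTop (𝓝 0) := by
    simpa using ENNReal.tendsto_ofReal ((tendsto_iff_norm_sub_tendsto_zero.1 h).const_mul C)
  refine tendsto_of_tendsto_of_tendsto_of_le_of_le tendsto_const_nhds hbound
    (fun _ => zero_le) fun k => le_trans (le_of_eq (eLpNorm_congr_ae ?_)) (hC (u k - w))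
  filter_upwards [ae_restrict_of_ae_restrict_of_subset (hKφ.trans inter_subset_left)
    (ae_chart_of_ae_vol g hφ (Lp.coeFn_sub (u k) w))] with y hy
  rw [← localSec_sub, localSec, localSec, hy]

theorem tendsto_eLpNorm_localDeriv_sub {K : Set (E n)} (hK : IsCompact K)
    (hKφ : K ⊆ σ.localDom i φ) (v : E n)
    {u : ℕ → WithLp 1 (Lp (EndSpinor V) p (vol g) × Lp (E n →L[ℝ] EndSpinor V) p (vol g))}
    {w : WithLp 1 (Lp (EndSpinor V) p (vol g) × Lp (E n →L[ℝ] EndSpinor V) p (vol g))}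
    (h : Tendsto u atTop (𝓝 w)) :
    Tendsto (fun k => eLpNorm (σ.localDeriv κ i φ v (u k).fst (u k).snd -
      σ.localDeriv κ i φ v w.fst w.snd) p (volume.restrict K)) atTop (𝓝 0) := by
  obtain ⟨C, -, hC⟩ := σ.exists_eLpNorm_localDeriv_le κ hpt hφ hK hKφ v
  have hbound : Tendsto (fun k => ENNReal.ofReal (C * ‖u k - w‖)) atTop (𝓝 0) := by
    simpa using ENNReal.tendsto_ofReal ((tendsto_iff_norm_sub_tendsto_zero.1 h).const_mul C)
  refine tendsto_of_tendsto_of_tendsto_of_le_of_le tendsto_const_nhds hbound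
    (fun _ => zero_le) fun k => le_trans (le_of_eq (eLpNorm_congr_ae ?_)) (hC (u k - w))
  have hsub := ae_chart_of_ae_vol g hφ
    ((Lp.coeFn_sub (u k).fst w.fst).and (Lp.coeFn_sub (u k).snd w.snd))
  filter_upwards [ae_restrict_of_ae_restrict_of_subset (hKφ.trans inter_subset_left) hsub]
    with y ⟨hfst, hsnd⟩
  rw [← localDeriv_sub]
  simp only [localDeriv, localSec, WithLp.sub_fst, WithLp.sub_snd, hfst, hsnd]

theorem hasWeakDeriv_of_tendsto (v : E n)
    {u : ℕ → WithLp 1 (Lp (EndSpinor V) p (vol g) × Lp (E n →L[ℝ] EndSpinor V) p (vol g))}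
    {w : WithLp 1 (Lp (EndSpinor V) p (vol g) × Lp (E n →L[ℝ] EndSpinor V) p (vol g))}
    (h : Tendsto u atTop (𝓝 w)) (hu : ∀ k, HasWeakDeriv volume (σ.localDom i φ) v
      (σ.localSec κ i φ (u k).fst) (σ.localDeriv κ i φ v (u k).fst (u k).snd)) :
    HasWeakDeriv volume (σ.localDom i φ) v (σ.localSec κ i φ w.fst)
      (σ.localDeriv κ i φ v w.fst w.snd) := by
  have hp : 1 ≤ p := Fact.out
  have hΩ := σ.isOpen_localDom i φ
  obtain ⟨ns, hns⟩ := exists_seq_tendsto_ae_of_tendsto_prod h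
  have hae := ae_restrict_of_ae_restrict_of_subset
    (inter_subset_left : σ.localDom i φ ⊆ φ.target) (ae_chart_of_ae_vol g hφ hns)
  have hS : LocallyIntegrableOn (σ.localSec κ i φ w.fst) (σ.localDom i φ) := by
    refine locallyIntegrableOn_of_eLpNorm_lt_top hp hΩ (aestronglyMeasurable_of_tendsto_ae atTop
      (fun k => (hu (ns k)).locallyIntegrableOn.aestronglyMeasurable)
      (hae.mono fun y hy => σ.tendsto_localSec κ i φ hy.1)) fun K hK hKc => ?_
    obtain ⟨C, -, hC⟩ := σ.exists_eLpNorm_localSec_le κ hpt hφ hKc hK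
    exact (hC w.fst).trans_lt ENNReal.ofReal_lt_top
  have hD : LocallyIntegrableOn (σ.localDeriv κ i φ v w.fst w.snd) (σ.localDom i φ) := by
    refine locallyIntegrableOn_of_eLpNorm_lt_top hp hΩ (aestronglyMeasurable_of_tendsto_ae atTop
      (fun k => (hu (ns k)).locallyIntegrableOn_deriv.aestronglyMeasurable)
      (hae.mono fun y hy => σ.tendsto_localDeriv κ i φ v hy.1 hy.2)) fun K hK hKc => ?_
    obtain ⟨C, -, hC⟩ := σ.exists_eLpNorm_localDeriv_le κ hpt hφ hKc hK v
    exact (hC w).trans_lt ENNReal.ofReal_lt_top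
  exact .of_tendsto_eLpNorm hp hu hS hD
    (fun K hK hKc => σ.tendsto_eLpNorm_localSec_sub κ hpt hφ hKc hK
      (((WithLp.continuous_fst 1 _ _).tendsto w).comp h))
    fun K hK hKc => σ.tendsto_eLpNorm_localDeriv_sub κ hpt hφ hKc hK v h

omit hφ

theorem isClosed_W1p : IsClosed (σ.W1p κ p : Set (WithLp 1
    (Lp (EndSpinor V) p (vol g) × Lp (E n →L[ℝ] EndSpinor V) p (vol g)))) :=
  IsSeqClosed.isClosed fun _ _ hu hlim => (σ.hasWeakCovDeriv_iff κ).2 fun i φ hφ v =>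
    σ.hasWeakDeriv_of_tendsto κ hpt hφ v hlim fun k => (σ.hasWeakCovDeriv_iff κ).1 (hu k) i φ hφ v

theorem completeSpace_W1p : CompleteSpace (σ.W1p κ p) :=
  (σ.isClosed_W1p κ hpt).completeSpace_coe

end Complete

end SpinStructure

/-! ### Products of Sobolev sections -/

section FormMul

variable (X 𝔸 : Type*) [NormedAddCommGroup X] [NormedSpace ℝ X] [NormedRing 𝔸] [NormedAlgebra ℝ 𝔸]

/-- Multiplication of an algebra-valued linear form by an element of the algebra on the left,
`a • G = (v ↦ a * G v)`. -/
noncomputable def formMulLeft : 𝔸 →L[ℝ] (X →L[ℝ] 𝔸) →L[ℝ] (X →L[ℝ] 𝔸) :=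
  ContinuousLinearMap.compL ℝ X 𝔸 𝔸 ∘L ContinuousLinearMap.mul ℝ 𝔸

/-- Multiplication of an algebra-valued linear form by an element of the algebra on the right,
`G • a = (v ↦ G v * a)`. -/
noncomputable def formMulRight : 𝔸 →L[ℝ] (X →L[ℝ] 𝔸) →L[ℝ] (X →L[ℝ] 𝔸) :=
  ContinuousLinearMap.compL ℝ X 𝔸 𝔸 ∘L (ContinuousLinearMap.mul ℝ 𝔸).flip

variable {X 𝔸}

@[simp]
theorem formMulLeft_apply (a : 𝔸) (G : X →L[ℝ] 𝔸) (v : X) : formMulLeft X 𝔸 a G v = a * G v := rfl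

@[simp]
theorem formMulRight_apply (a : 𝔸) (G : X →L[ℝ] 𝔸) (v : X) :
    formMulRight X 𝔸 a G v = G v * a := rfl

theorem formMulLeft_one (G : X →L[ℝ] 𝔸) : formMulLeft X 𝔸 1 G = G :=
  ContinuousLinearMap.ext fun v => one_mul (G v)

theorem norm_formMulLeft_le (a : 𝔸) (G : X →L[ℝ] 𝔸) : ‖formMulLeft X 𝔸 a G‖ ≤ ‖a‖ * ‖G‖ := by
  refine ContinuousLinearMap.opNorm_le_bound _ (by positivity) fun v => ?_
  rw [formMulLeft_apply, mul_assoc]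
  exact norm_mul_le_of_le le_rfl (G.le_opNorm v)

end FormMul

namespace SpinStructure

section Multiplication

variable {n : ℕ} {M : Type*} [TopologicalSpace M] [ChartedSpace (E n) M]
  [IsManifold (𝓡 n) ∞ M] {g : RMetric n M} {σ : SpinStructure g} {V : Type*}
  [NormedAddCommGroup V] [InnerProductSpace ℝ V] {κ : SpinorRep n V}

theorem localDeriv_mul (σ : SpinStructure g) (κ : SpinorRep n V) {i : ℕ}
    {φ : OpenPartialHomeomorph M (E n)} {y : E n} (hy : y ∈ σ.localDom i φ) (v : E n)
    (F F' : M → EndSpinor V) (G G' : M → (E n →L[ℝ] EndSpinor V)) :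
    σ.localDeriv κ i φ v (fun x => F x * F' x) (fun x => formMulLeft (E n) (EndSpinor V) (F x)
      (G' x) + formMulRight (E n) (EndSpinor V) (F' x) (G x)) y =
      σ.localDeriv κ i φ v F G y * σ.localSec κ i φ F' y +
        σ.localSec κ i φ F y * σ.localDeriv κ i φ v F' G' y := by
  simp only [localDeriv, localSec, add_apply, formMulLeft_apply, formMulRight_apply, endRep_add,
    σ.endRep_mul κ hy.2]
  noncomm_ring

variable [FiniteDimensional ℝ V] [MeasurableSpace M] [BorelSpace M]

theorem ae_norm_localSec_le {F : M → EndSpinor V} {C : ℝ} (hC : ∀ᵐ x ∂vol g, ‖F x‖ ≤ C) (i : ℕ)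
    {φ : OpenPartialHomeomorph M (E n)} (hφ : φ ∈ atlas (E n) M) :
    ∀ᵐ y ∂volume.restrict (σ.localDom i φ), ‖σ.localSec κ i φ F y‖ ≤ C :=
  (ae_restrict_of_ae_restrict_of_subset inter_subset_left (ae_chart_of_ae_vol g hφ hC)).mono
    fun _ => (σ.norm_endRep_le κ i _ _).trans

theorem HasWeakCovDeriv.mul {F F' : M → EndSpinor V} {G G' : M → (E n →L[ℝ] EndSpinor V)}
    (h : σ.HasWeakCovDeriv κ F G) (h' : σ.HasWeakCovDeriv κ F' G') {C C' : ℝ}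
    (hC : ∀ᵐ x ∂vol g, ‖F x‖ ≤ C) (hC' : ∀ᵐ x ∂vol g, ‖F' x‖ ≤ C') :
    σ.HasWeakCovDeriv κ (fun x => F x * F' x)
      (fun x => formMulLeft (E n) (EndSpinor V) (F x) (G' x) +
        formMulRight (E n) (EndSpinor V) (F' x) (G x)) := by
  rw [hasWeakCovDeriv_iff] at h h' ⊢
  intro i φ hφ v
  have hopen := σ.isOpen_localDom i φ
  refine ((h i φ hφ v).mul hopen (h' i φ hφ v) (ae_norm_localSec_le hC i hφ)
    (ae_norm_localSec_le hC' i hφ)).congr ?_ ?_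
  · filter_upwards [ae_restrict_mem hopen.measurableSet] with y hy
    exact (σ.endRep_mul κ hy.2 _ _).symm
  · filter_upwards [ae_restrict_mem hopen.measurableSet] with y hy
    exact (σ.localDeriv_mul κ hy v F F' G G').symm

end Multiplication

end SpinStructure

/-! ### Powers in a Banach algebra by the binomial series -/

section Binomial

variable {𝔹 : Type*} [NormedRing 𝔹] [NormedAlgebra ℝ 𝔹]

theorem summable_norm_choose_mul_pow (a : ℝ) {r : ℝ} (hr0 : 0 ≤ r) (hr : r < 1) :
    Summable fun k : ℕ => ‖Ring.choose a k‖ * r ^ k := by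
  lift r to NNReal using hr0
  have hrad : (r : ℝ≥0∞) < (binomialSeries ℝ a).radius :=
    lt_of_lt_of_le (by exact_mod_cast hr) binomialSeries_radius_ge_one
  simpa [binomialSeries, FormalMultilinearSeries.ofScalars_norm] using
    (binomialSeries ℝ a).summable_norm_mul_pow hrad

variable (𝔹) in
theorem one_le_radius_binomialSeries (a : ℝ) : 1 ≤ (binomialSeries 𝔹 a).radius := by
  refine ENNReal.le_of_forall_nnreal_lt fun r hr => ?_
  refine FormalMultilinearSeries.le_radius_of_summable_norm _ ((summable_nat_add_iff 1).1 ?_)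
  refine Summable.of_nonneg_of_le (fun _ => by positivity) (fun k => ?_) ((summable_nat_add_iff 1).2
    (summable_norm_choose_mul_pow a r.coe_nonneg (by exact_mod_cast hr)))
  exact mul_le_mul_of_nonneg_right
    (FormalMultilinearSeries.ofScalars_norm_le _ _ _ (Nat.succ_pos k)) (by positivity)

/-- The binomial series for `(1 + T) ^ a`. -/
noncomputable def binom (a : ℝ) (T : 𝔹) : 𝔹 := ∑' k : ℕ, Ring.choose a k • T ^ k

theorem summable_norm_binom (a : ℝ) {T : 𝔹} (hT : ‖T‖ < 1) :
    Summable fun k : ℕ => ‖Ring.choose a k • T ^ k‖ := by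
  refine (summable_nat_add_iff 1).1 ?_
  refine Summable.of_nonneg_of_le (fun _ => norm_nonneg _) (fun k => ?_)
    ((summable_nat_add_iff 1).2 (summable_norm_choose_mul_pow a (norm_nonneg T) hT))
  rw [norm_smul]
  exact mul_le_mul_of_nonneg_left (norm_pow_le' T (Nat.succ_pos k)) (norm_nonneg _)

theorem hasSum_binom [CompleteSpace 𝔹] (a : ℝ) {T : 𝔹} (hT : ‖T‖ < 1) :
    HasSum (fun k : ℕ => Ring.choose a k • T ^ k) (binom a T) :=
  (summable_norm_binom a hT).of_norm.hasSum

theorem binom_mul_binom [CompleteSpace 𝔹] (a b : ℝ) {T : 𝔹} (hT : ‖T‖ < 1) :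
    binom a T * binom b T = binom (a + b) T := by
  unfold binom
  rw [tsum_mul_tsum_eq_tsum_sum_antidiagonal_of_summable_norm (summable_norm_binom a hT)
    (summable_norm_binom b hT)]
  refine tsum_congr fun k => ?_
  rw [Ring.add_choose_eq k (Commute.all a b), Finset.sum_smul]
  refine Finset.sum_congr rfl fun ij hij => ?_
  rw [smul_mul_smul_comm, ← pow_add, Finset.HasAntidiagonal.mem_antidiagonal.1 hij]

@[simp]
theorem binom_zero (T : 𝔹) : binom 0 T = 1 := by
  refine (tsum_eq_single 0 fun k hk => ?_).trans (by simp)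
  rw [Ring.choose_zero_pos _ (Nat.pos_of_ne_zero hk), zero_smul]

@[simp]
theorem binom_one (T : 𝔹) : binom 1 T = 1 + T := by
  have hchoose (k : ℕ) : Ring.choose (1 : ℝ) k = (Nat.choose 1 k : ℝ) := by
    simpa using Ring.choose_natCast (R := ℝ) 1 k
  unfold binom
  rw [tsum_eq_sum (s := Finset.range 2)]
  · simp [Finset.sum_range_succ]
  · intro k hk
    have hk1 : 1 < k := by simpa [Nat.lt_iff_add_one_le] using hk
    rw [hchoose, Nat.choose_eq_zero_of_lt hk1, Nat.cast_zero, zero_smul]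

theorem analyticAt_binom [CompleteSpace 𝔹] (a : ℝ) {T : 𝔹} (hT : ‖T‖ < 1) :
    AnalyticAt ℝ (binom a) T := by
  have hrad := one_le_radius_binomialSeries 𝔹 a
  have hsum : (binomialSeries 𝔹 a).sum = binom a := by
    funext x
    simp [FormalMultilinearSeries.sum, binom]
  have hball := (binomialSeries 𝔹 a).hasFPowerSeriesOnBall (lt_of_lt_of_le one_pos hrad)
  rw [hsum] at hball
  refine hball.analyticAt_of_mem (Metric.eball_subset_eball hrad ?_)
  rwa [Metric.mem_eball, edist_zero_right, ← ofReal_norm, ENNReal.ofReal_lt_one]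

theorem map_binom {𝔹' : Type*} [NormedRing 𝔹'] [NormedAlgebra ℝ 𝔹'] (Φ : 𝔹 ≃A[ℝ] 𝔹') (a : ℝ)
    (T : 𝔹) : Φ (binom a T) = binom a (Φ T) := by
  have h := Φ.toContinuousLinearEquiv.map_tsum
    (L := .unconditional ℕ) (f := fun k : ℕ => Ring.choose a k • T ^ k)
  simpa only [binom, ContinuousAlgEquiv.toContinuousLinearEquiv_apply, map_smul, map_pow] using h

end Binomial

section BinomPow

variable {𝔹 : Type*} [NormedRing 𝔹] [NormedAlgebra ℝ 𝔹] {Λ : ℝ} {B : 𝔹}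

/-- The power `B ^ a`, given by the binomial series expanded about the scalar `Λ`. -/
noncomputable def binomPow (Λ a : ℝ) (B : 𝔹) : 𝔹 := Λ ^ a • binom a (Λ⁻¹ • B - 1)

theorem pos_of_norm_sub_smul_one_lt (hB : ‖B - Λ • (1 : 𝔹)‖ < Λ) : 0 < Λ :=
  (norm_nonneg _).trans_lt hB

theorem norm_inv_smul_sub_one_lt_one (hB : ‖B - Λ • (1 : 𝔹)‖ < Λ) : ‖Λ⁻¹ • B - 1‖ < 1 := by
  have hΛ := pos_of_norm_sub_smul_one_lt hB
  have hfactor : Λ⁻¹ • B - 1 = Λ⁻¹ • (B - Λ • (1 : 𝔹)) := by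
    rw [smul_sub, inv_smul_smul₀ hΛ.ne']
  rwa [hfactor, norm_smul, norm_inv, Real.norm_of_nonneg hΛ.le, inv_mul_lt_one₀ hΛ]

@[simp]
theorem binomPow_zero (Λ : ℝ) (B : 𝔹) : binomPow Λ 0 B = 1 := by simp [binomPow]

theorem binomPow_one (hΛ : Λ ≠ 0) (B : 𝔹) : binomPow Λ 1 B = B := by
  rw [binomPow, binom_one, Real.rpow_one, add_sub_cancel, smul_inv_smul₀ hΛ]

theorem map_binomPow {𝔹' : Type*} [NormedRing 𝔹'] [NormedAlgebra ℝ 𝔹'] (Φ : 𝔹 ≃A[ℝ] 𝔹') (Λ a : ℝ)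
    (B : 𝔹) : Φ (binomPow Λ a B) = binomPow Λ a (Φ B) := by
  simp only [binomPow, map_smul, map_binom, map_sub, map_one]

theorem commute_binomPow_left (Λ a : ℝ) {Y : 𝔹} (h : Commute B Y) : Commute (binomPow Λ a B) Y :=
  (Commute.tsum_left Y fun k =>
    ((((h.smul_left _).sub_left (.one_left Y)).pow_left k).smul_left _)).smul_left _

theorem isSelfAdjoint_binomPow [StarRing 𝔹] [ContinuousStar 𝔹] [StarModule ℝ 𝔹] (Λ a : ℝ)
    (hB : IsSelfAdjoint B) : IsSelfAdjoint (binomPow Λ a B) := by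
  have hT : IsSelfAdjoint (Λ⁻¹ • B - 1) := (IsSelfAdjoint.smul (.all _) hB).sub (.one _)
  refine IsSelfAdjoint.smul (.all _) ?_
  rw [isSelfAdjoint_iff, binom, tsum_star]
  simp only [star_smul, star_pow, hT.star_eq, star_trivial]

variable [CompleteSpace 𝔹]

theorem hasSum_binomPow (a : ℝ) (hB : ‖B - Λ • (1 : 𝔹)‖ < Λ) :
    HasSum (fun k : ℕ => (Λ ^ a * Ring.choose a k) • (Λ⁻¹ • B - 1) ^ k) (binomPow Λ a B) := by
  simpa only [binomPow, smul_smul] using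
    (hasSum_binom a (norm_inv_smul_sub_one_lt_one hB)).const_smul (Λ ^ a)

theorem analyticAt_binomPow (a : ℝ) (hB : ‖B - Λ • (1 : 𝔹)‖ < Λ) :
    AnalyticAt ℝ (binomPow Λ a) B := by
  have hinner : AnalyticAt ℝ (fun B : 𝔹 => Λ⁻¹ • B - 1) B :=
    (Λ⁻¹ • ContinuousLinearMap.id ℝ 𝔹).analyticAt B |>.sub analyticAt_const
  have hcomp : AnalyticAt ℝ (fun B : 𝔹 => binom a (Λ⁻¹ • B - 1)) B :=
    (analyticAt_binom a (norm_inv_smul_sub_one_lt_one hB)).fun_comp_of_eq hinner rfl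
  exact hcomp.const_smul (c := Λ ^ a)

theorem binomPow_mul_binomPow (a b : ℝ) (hB : ‖B - Λ • (1 : 𝔹)‖ < Λ) :
    binomPow Λ a B * binomPow Λ b B = binomPow Λ (a + b) B := by
  rw [binomPow, binomPow, binomPow, smul_mul_smul_comm,
    binom_mul_binom a b (norm_inv_smul_sub_one_lt_one hB),
    Real.rpow_add (pos_of_norm_sub_smul_one_lt hB)]

theorem binomPow_half_mul_self (hB : ‖B - Λ • (1 : 𝔹)‖ < Λ) :
    binomPow Λ (1 / 2) B * binomPow Λ (1 / 2) B = B := by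
  rw [binomPow_mul_binomPow _ _ hB, add_halves,
    binomPow_one (pos_of_norm_sub_smul_one_lt hB).ne']

theorem binomPow_neg_mul_self (a : ℝ) (hB : ‖B - Λ • (1 : 𝔹)‖ < Λ) :
    binomPow Λ (-a) B * binomPow Λ a B = 1 := by
  rw [binomPow_mul_binomPow _ _ hB, neg_add_cancel, binomPow_zero]

theorem binomPow_mul_binomPow_neg (a : ℝ) (hB : ‖B - Λ • (1 : 𝔹)‖ < Λ) :
    binomPow Λ a B * binomPow Λ (-a) B = 1 := by
  rw [binomPow_mul_binomPow _ _ hB, add_neg_cancel, binomPow_zero]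

-- A solution `Y` commutes with `S ^ 2 = B`, hence with `S`, so that `2 • (S * Y) = 0`.
theorem eq_zero_of_binomPow_half_mul_add_eq_zero (hB : ‖B - Λ • (1 : 𝔹)‖ < Λ) {Y : 𝔹}
    (hY : binomPow Λ (1 / 2) B * Y + Y * binomPow Λ (1 / 2) B = 0) : Y = 0 := by
  set S := binomPow Λ (1 / 2) B
  have hSS : S * S = B := binomPow_half_mul_self hB
  have hanti : S * Y = -(Y * S) := eq_neg_of_add_eq_zero_left hY
  have hcommB : Commute B Y := by
    change B * Y = Y * B
    rw [← hSS, mul_assoc, hanti, mul_neg, ← mul_assoc, hanti, neg_mul, neg_neg, mul_assoc]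
  have hcommS : S * Y = Y * S := commute_binomPow_left _ _ hcommB
  have hSY : S * Y = 0 := by
    rw [← hcommS, ← two_smul ℝ (S * Y)] at hY
    exact (smul_eq_zero.1 hY).resolve_left two_ne_zero
  calc Y = binomPow Λ (-(1 / 2)) B * (S * Y) := by
        rw [← mul_assoc, binomPow_neg_mul_self _ hB, one_mul]
    _ = 0 := by rw [hSY, mul_zero]

theorem binomPow_half_mul_add_eq_iff (hB : ‖B - Λ • (1 : 𝔹)‖ < Λ) {X Y D : 𝔹}
    (hY : D = binomPow Λ (1 / 2) B * Y + Y * binomPow Λ (1 / 2) B) :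
    binomPow Λ (1 / 2) B * X + X * binomPow Λ (1 / 2) B = D ↔ X = Y := by
  refine ⟨fun hX => sub_eq_zero.1 (eq_zero_of_binomPow_half_mul_add_eq_zero hB ?_), ?_⟩
  · rw [mul_sub, sub_mul, sub_add_sub_comm, hX, hY, sub_self]
  · rintro rfl
    exact hY.symm

end BinomPow

section Equiv

variable {𝔹 𝔹' : Type*} [NormedRing 𝔹] [NormedAlgebra ℝ 𝔹] [NormedRing 𝔹'] [NormedAlgebra ℝ 𝔹']
  [CompleteSpace 𝔹'] {Λ : ℝ} {B : 𝔹}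

theorem analyticAt_binomPow_of_equiv (Φ : 𝔹 ≃A[ℝ] 𝔹') (a : ℝ) (hB : ‖Φ B - Λ • (1 : 𝔹')‖ < Λ) :
    AnalyticAt ℝ (binomPow Λ a) B := by
  have hconj : (binomPow Λ a : 𝔹 → 𝔹) =
      fun B => Φ.symm.toContinuousLinearEquiv (binomPow Λ a (Φ.toContinuousLinearEquiv B)) := by
    funext B
    simp only [ContinuousAlgEquiv.toContinuousLinearEquiv_apply, map_binomPow,
      ContinuousAlgEquiv.symm_apply_apply]
  rw [hconj]
  exact (Φ.symm.toContinuousLinearEquiv.analyticAt _).fun_comp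
    ((analyticAt_binomPow a hB).fun_comp (Φ.toContinuousLinearEquiv.analyticAt _))

theorem hasSum_binomPow_of_equiv (Φ : 𝔹 ≃A[ℝ] 𝔹') (a : ℝ) (hB : ‖Φ B - Λ • (1 : 𝔹')‖ < Λ) :
    HasSum (fun k : ℕ => (Λ ^ a * Ring.choose a k) • (Λ⁻¹ • B - 1) ^ k) (binomPow Λ a B) := by
  simpa only [Function.comp_def, map_smul, map_pow, map_sub, map_one, map_binomPow,
    ContinuousAlgEquiv.symm_apply_apply] using
    (hasSum_binomPow a hB).map Φ.symm Φ.symm.continuous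

end Equiv

/-! ### Contractions for an equivalent norm -/

section Renorm

variable {X Z : Type*} [NormedAddCommGroup X] [NormedSpace ℝ X]
  [NormedAddCommGroup Z] [NormedSpace ℝ Z]

/-- The graph of `f` parametrized by its domain `X`. Through it `X` carries the equivalent norm
`max ‖x‖ ‖f x‖`. -/
def equivGraph (f : X →L[ℝ] Z) : X ≃L[ℝ] (f : X →ₗ[ℝ] Z).graph :=
  .equivOfInverse ((ContinuousLinearMap.id ℝ X).prod f |>.codRestrict _ fun _ => rfl)
    (ContinuousLinearMap.fst ℝ X Z ∘L (f : X →ₗ[ℝ] Z).graph.subtypeL) (fun _ => rfl)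
    fun y => Subtype.ext (Prod.ext rfl y.2.symm)

theorem norm_equivGraph (f : X →L[ℝ] Z) (x : X) : ‖equivGraph f x‖ = max ‖x‖ ‖f x‖ := rfl

theorem completeSpace_of_equiv {Y : Type*} [NormedAddCommGroup Y] [NormedSpace ℝ Y]
    [CompleteSpace X] (e : X ≃L[ℝ] Y) : CompleteSpace Y :=
  (completeSpace_congr (e := e.toEquiv) e.isUniformEmbedding).1 inferInstance

theorem norm_conj_equivGraph_le (f : X →L[ℝ] Z) (T : X →L[ℝ] X) {s : ℝ} (hs : 0 ≤ s)
    (hT : ∀ x, ‖T x‖ ≤ s * max ‖x‖ ‖f x‖) (hfT : ∀ x, ‖f (T x)‖ ≤ s * max ‖x‖ ‖f x‖) :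
    ‖(equivGraph f).conjContinuousAlgEquiv T‖ ≤ s := by
  refine ContinuousLinearMap.opNorm_le_bound _ hs fun y => ?_
  obtain ⟨x, rfl⟩ := (equivGraph f).surjective y
  rw [ContinuousLinearEquiv.conjContinuousAlgEquiv_apply_apply,
    ContinuousLinearEquiv.symm_apply_apply, norm_equivGraph, norm_equivGraph]
  exact max_le (hT x) (hfT x)

-- The equivalent norm is `max ‖x‖ (M * ‖ι x‖)` with `M` so large that `K ≤ (s - q) * M`, where
-- `q < s < r`.
theorem exists_norm_conj_equivGraph_lt (ι : X →L[ℝ] Z) (T : X →L[ℝ] X) {q r K : ℝ} (hq : 0 ≤ q)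
    (hqr : q < r) (hK : 0 ≤ K) (hιT : ∀ x, ‖ι (T x)‖ ≤ q * ‖ι x‖)
    (hT : ∀ x, ‖T x‖ ≤ q * ‖x‖ + K * ‖ι x‖) :
    ∃ M : ℝ, ‖(equivGraph (M • ι)).conjContinuousAlgEquiv T‖ < r := by
  obtain ⟨s, hqs, hsr⟩ := exists_between hqr
  have hM : 0 < K / (s - q) + 1 := add_pos_of_nonneg_of_pos (div_nonneg hK (by linarith)) one_pos
  set M := K / (s - q) + 1
  have hKM : K ≤ (s - q) * M := by
    rw [← div_le_iff₀' (by linarith)]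
    simp [M]
  have hnorm (x : X) : ‖(M • ι) x‖ = M * ‖ι x‖ := by
    rw [_root_.smul_apply, norm_smul, Real.norm_of_nonneg hM.le]
  refine ⟨M, (norm_conj_equivGraph_le _ T (hq.trans hqs.le) (fun x => ?_) fun x => ?_).trans_lt hsr⟩
  all_goals
    simp only [hnorm]
    set N := max ‖x‖ (M * ‖ι x‖)
    have hxN : ‖x‖ ≤ N := le_max_left _ _
    have hιN : M * ‖ι x‖ ≤ N := le_max_right _ _
  · calc ‖T x‖ ≤ q * ‖x‖ + K * ‖ι x‖ := hT x
      _ ≤ q * ‖x‖ + (s - q) * M * ‖ι x‖ := by gcongr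
      _ = q * ‖x‖ + (s - q) * (M * ‖ι x‖) := by ring
      _ ≤ q * N + (s - q) * N := by gcongr
      _ = s * N := by ring
  · calc M * ‖ι (T x)‖ ≤ M * (q * ‖ι x‖) := by gcongr; exact hιT x
      _ = q * (M * ‖ι x‖) := by ring
      _ ≤ s * N := mul_le_mul hqs.le hιN (by positivity) (hq.trans hqs.le)

theorem exists_norm_conj_equivGraph_sub_lt (ι : X →L[ℝ] Z) (T : X →L[ℝ] X) {Λ q K : ℝ}
    (hq : 0 ≤ q) (hqΛ : q < Λ) (hK : 0 ≤ K) (hιT : ∀ x, ‖ι (T x - Λ • x)‖ ≤ q * ‖ι x‖)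
    (hT : ∀ x, ‖T x - Λ • x‖ ≤ q * ‖x‖ + K * ‖ι x‖) :
    ∃ M : ℝ, ‖(equivGraph (M • ι)).conjContinuousAlgEquiv T - Λ • 1‖ < Λ := by
  obtain ⟨M, hM⟩ := exists_norm_conj_equivGraph_lt ι (T - Λ • 1) hq hqΛ hK hιT hT
  exact ⟨M, by rwa [map_sub, map_smul, map_one] at hM⟩

variable [CompleteSpace X]

theorem analyticAt_binomPow_of_norm_sub_smul_le (a : ℝ) (ι : X →L[ℝ] Z) (T : X →L[ℝ] X)
    {Λ q K : ℝ} (hq : 0 ≤ q) (hqΛ : q < Λ) (hK : 0 ≤ K)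
    (hιT : ∀ x, ‖ι (T x - Λ • x)‖ ≤ q * ‖ι x‖)
    (hT : ∀ x, ‖T x - Λ • x‖ ≤ q * ‖x‖ + K * ‖ι x‖) :
    AnalyticAt ℝ (binomPow Λ a) T := by
  obtain ⟨M, hM⟩ := exists_norm_conj_equivGraph_sub_lt ι T hq hqΛ hK hιT hT
  have := completeSpace_of_equiv (equivGraph (M • ι))
  exact analyticAt_binomPow_of_equiv (equivGraph (M • ι)).conjContinuousAlgEquiv a hM

theorem hasSum_binomPow_of_norm_sub_smul_le (a : ℝ) (ι : X →L[ℝ] Z) (T : X →L[ℝ] X)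
    {Λ q K : ℝ} (hq : 0 ≤ q) (hqΛ : q < Λ) (hK : 0 ≤ K)
    (hιT : ∀ x, ‖ι (T x - Λ • x)‖ ≤ q * ‖ι x‖)
    (hT : ∀ x, ‖T x - Λ • x‖ ≤ q * ‖x‖ + K * ‖ι x‖) :
    HasSum (fun k : ℕ => (Λ ^ a * Ring.choose a k) • (Λ⁻¹ • T - 1) ^ k) (binomPow Λ a T) := by
  obtain ⟨M, hM⟩ := exists_norm_conj_equivGraph_sub_lt ι T hq hqΛ hK hιT hT
  have := completeSpace_of_equiv (equivGraph (M • ι))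
  exact hasSum_binomPow_of_equiv (equivGraph (M • ι)).conjContinuousAlgEquiv a hM

end Renorm

/-! ### Powers in a space of bounded multipliers -/

/-- A normed space `W` of essentially bounded `𝔸`-valued functions that is closed under pointwise
multiplication: `eval u` is a representative of `u`, and multiplication by an `A` that is uniformly
`q`-close to the scalar `c` is `q`-close to `c` modulo the weaker `L^∞` norm. -/
structure MultiplierSpace {α : Type*} [MeasurableSpace α] (μ : Measure α) (𝔸 W : Type*)
    [NormedRing 𝔸] [NormedAlgebra ℝ 𝔸] [NormedAddCommGroup W] [NormedSpace ℝ W] where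
  eval : W → α → 𝔸
  toLinfty : W →L[ℝ] Lp 𝔸 ∞ μ
  coeFn_toLinfty : ∀ u, toLinfty u =ᵐ[μ] eval u
  mul : W →L[ℝ] W →L[ℝ] W
  eval_mul : ∀ u w, eval (mul u w) =ᵐ[μ] fun x => eval u x * eval w x
  exists_norm_mul_sub_smul_le : ∀ A (c q : ℝ), (∀ᵐ x ∂μ, ‖eval A x - c • (1 : 𝔸)‖ ≤ q) →
    ∃ K : ℝ, 0 ≤ K ∧ ∀ u, ‖mul A u - c • u‖ ≤ q * ‖u‖ + K * ‖toLinfty u‖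

namespace MultiplierSpace

variable {α : Type*} [MeasurableSpace α] {μ : Measure α} {𝔸 W : Type*} [NormedRing 𝔸]
  [NormedAlgebra ℝ 𝔸] [NormedAddCommGroup W] [NormedSpace ℝ W] (𝓜 : MultiplierSpace μ 𝔸 W)

theorem toLinfty_eq_iff {u w : W} : 𝓜.toLinfty u = 𝓜.toLinfty w ↔ 𝓜.eval u =ᵐ[μ] 𝓜.eval w :=
  ⟨fun h => (𝓜.coeFn_toLinfty u).symm.trans (h ▸ 𝓜.coeFn_toLinfty w),
    fun h => Lp.ext ((𝓜.coeFn_toLinfty u).trans (h.trans (𝓜.coeFn_toLinfty w).symm))⟩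

theorem eval_zero : 𝓜.eval 0 =ᵐ[μ] 0 := by
  refine (𝓜.coeFn_toLinfty 0).symm.trans ?_
  rw [map_zero]
  exact Lp.coeFn_zero _ _ _

theorem eval_add (u w : W) : 𝓜.eval (u + w) =ᵐ[μ] 𝓜.eval u + 𝓜.eval w := by
  refine (𝓜.coeFn_toLinfty _).symm.trans ?_
  rw [map_add]
  exact (Lp.coeFn_add _ _).trans ((𝓜.coeFn_toLinfty u).add (𝓜.coeFn_toLinfty w))

theorem eval_smul (c : ℝ) (u : W) : 𝓜.eval (c • u) =ᵐ[μ] c • 𝓜.eval u := by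
  refine (𝓜.coeFn_toLinfty _).symm.trans ?_
  rw [map_smul]
  exact (Lp.coeFn_smul _ _).trans ((𝓜.coeFn_toLinfty u).const_smul c)

/-- `T` acts almost everywhere as left multiplication by `b`. -/
def IsMultiplication (T : W →L[ℝ] W) (b : α → 𝔸) : Prop :=
  ∀ u, 𝓜.eval (T u) =ᵐ[μ] fun x => b x * 𝓜.eval u x

variable {𝓜}

theorem isMultiplication_mul (A : W) : 𝓜.IsMultiplication (𝓜.mul A) (𝓜.eval A) := 𝓜.eval_mul A

namespace IsMultiplication

theorem zero : 𝓜.IsMultiplication 0 0 := fun u => by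
  simp only [zero_apply, Pi.zero_apply, zero_mul]
  exact 𝓜.eval_zero

theorem one : 𝓜.IsMultiplication 1 1 := fun u => by
  simp

variable {T T' : W →L[ℝ] W} {b b' : α → 𝔸}

theorem add (h : 𝓜.IsMultiplication T b) (h' : 𝓜.IsMultiplication T' b') :
    𝓜.IsMultiplication (T + T') (b + b') := fun u => by
  filter_upwards [𝓜.eval_add (T u) (T' u), h u, h' u] with x hadd hx hx'
  simp only [add_apply, hadd, Pi.add_apply, hx, hx', add_mul]

theorem smul (h : 𝓜.IsMultiplication T b) (c : ℝ) : 𝓜.IsMultiplication (c • T) (c • b) :=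
  fun u => by
    filter_upwards [𝓜.eval_smul c (T u), h u] with x hsmul hx
    simp only [_root_.smul_apply, hsmul, Pi.smul_apply, hx, smul_mul_assoc]

theorem sub (h : 𝓜.IsMultiplication T b) (h' : 𝓜.IsMultiplication T' b') :
    𝓜.IsMultiplication (T - T') (b - b') := by
  simpa only [sub_eq_add_neg, neg_one_smul] using h.add (h'.smul (-1))

theorem mul (h : 𝓜.IsMultiplication T b) (h' : 𝓜.IsMultiplication T' b') :
    𝓜.IsMultiplication (T * T') (b * b') := fun u => by
  filter_upwards [h (T' u), h' u] with x hx hx'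
  simp only [mul_apply_eq_comp, hx, hx', Pi.mul_apply, mul_assoc]

theorem pow (h : 𝓜.IsMultiplication T b) (k : ℕ) : 𝓜.IsMultiplication (T ^ k) (b ^ k) := by
  induction k with
  | zero => simpa only [pow_zero] using one
  | succ k ih => simpa only [pow_succ] using ih.mul h

theorem sum {ι : Type*} (s : Finset ι) {F : ι → W →L[ℝ] W} {f : ι → α → 𝔸}
    (h : ∀ i, 𝓜.IsMultiplication (F i) (f i)) :
    𝓜.IsMultiplication (∑ i ∈ s, F i) (∑ i ∈ s, f i) := by
  classical
  induction s using Finset.induction_on with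
  | empty => simpa only [Finset.sum_empty] using zero
  | insert i s hi ih => simpa only [Finset.sum_insert hi] using (h i).add ih

-- Convergence in `L^∞` gives almost everywhere convergence of a subsequence.
theorem of_hasSum {F : ℕ → W →L[ℝ] W} {f : ℕ → α → 𝔸} (h : ∀ k, 𝓜.IsMultiplication (F k) (f k))
    (hF : HasSum F T) (hf : ∀ᵐ x ∂μ, HasSum (fun k => f k x) (b x)) :
    𝓜.IsMultiplication T b := fun u => by
  have hlim : Tendsto (fun N => 𝓜.toLinfty ((∑ k ∈ Finset.range N, F k) u)) atTop
      (𝓝 (𝓜.toLinfty (T u))) :=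
    ((𝓜.toLinfty ∘L ContinuousLinearMap.apply ℝ W u).continuous.tendsto T).comp
      hF.tendsto_sum_nat
  obtain ⟨ns, hns, hae⟩ := (tendstoInMeasure_of_tendsto_Lp hlim).exists_seq_tendsto_ae
  filter_upwards [hae, hf, 𝓜.coeFn_toLinfty (T u),
    ae_all_iff.2 fun N => 𝓜.coeFn_toLinfty ((∑ k ∈ Finset.range N, F k) u),
    ae_all_iff.2 fun N => sum (Finset.range N) h u] with x hx hfx hT hpartial hsum
  simp only [hT, hpartial, hsum, Finset.sum_apply] at hx
  exact tendsto_nhds_unique hx ((hfx.tendsto_sum_nat.comp hns.tendsto_atTop).mul_const _)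

end IsMultiplication

section Pow

variable {Λ q : ℝ} {A : W}

theorem norm_toLinfty_mul_sub_smul_le (hA : ∀ᵐ x ∂μ, ‖𝓜.eval A x - Λ • (1 : 𝔸)‖ ≤ q) (u : W) :
    ‖𝓜.toLinfty (𝓜.mul A u - Λ • u)‖ ≤ q * ‖𝓜.toLinfty u‖ := by
  have hmultiplication : 𝓜.IsMultiplication (𝓜.mul A - Λ • 1) (𝓜.eval A - Λ • 1) :=
    (isMultiplication_mul A).sub (IsMultiplication.one.smul Λ)
  refine Lp.norm_le_mul_norm_of_ae_le_mul ?_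
  filter_upwards [hA, hmultiplication u,
    𝓜.coeFn_toLinfty (𝓜.mul A u - Λ • u), 𝓜.coeFn_toLinfty u] with x hx hmul hleft hright
  rw [hleft, hright]
  exact (congrArg norm hmul).trans_le ((norm_mul_le _ _).trans (by gcongr; exact hx))

variable [CompleteSpace W]

theorem analyticAt_binomPow_mul (a : ℝ) (hq : 0 ≤ q) (hqΛ : q < Λ)
    (hA : ∀ᵐ x ∂μ, ‖𝓜.eval A x - Λ • (1 : 𝔸)‖ ≤ q) :
    AnalyticAt ℝ (binomPow Λ a) (𝓜.mul A) := by
  obtain ⟨K, hK, hbound⟩ := 𝓜.exists_norm_mul_sub_smul_le A Λ q hA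
  exact analyticAt_binomPow_of_norm_sub_smul_le a 𝓜.toLinfty (𝓜.mul A) hq hqΛ hK
    (norm_toLinfty_mul_sub_smul_le hA) hbound

theorem hasSum_binomPow_mul (a : ℝ) (hq : 0 ≤ q) (hqΛ : q < Λ)
    (hA : ∀ᵐ x ∂μ, ‖𝓜.eval A x - Λ • (1 : 𝔸)‖ ≤ q) :
    HasSum (fun k : ℕ => (Λ ^ a * Ring.choose a k) • (Λ⁻¹ • 𝓜.mul A - 1) ^ k)
      (binomPow Λ a (𝓜.mul A)) := by
  obtain ⟨K, hK, hbound⟩ := 𝓜.exists_norm_mul_sub_smul_le A Λ q hA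
  exact hasSum_binomPow_of_norm_sub_smul_le a 𝓜.toLinfty (𝓜.mul A) hq hqΛ hK
    (norm_toLinfty_mul_sub_smul_le hA) hbound

theorem isMultiplication_binomPow_mul [CompleteSpace 𝔸] (a : ℝ) (hq : 0 ≤ q) (hqΛ : q < Λ)
    (hA : ∀ᵐ x ∂μ, ‖𝓜.eval A x - Λ • (1 : 𝔸)‖ ≤ q) :
    𝓜.IsMultiplication (binomPow Λ a (𝓜.mul A)) fun x => binomPow Λ a (𝓜.eval A x) := by
  refine .of_hasSum (fun k => ((((isMultiplication_mul A).smul Λ⁻¹).sub .one).pow k).smul _)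
    (hasSum_binomPow_mul a hq hqΛ hA) ?_
  filter_upwards [hA] with x hx using hasSum_binomPow a (hx.trans_lt hqΛ)

variable (𝓜)

/-- The pointwise power `A ^ a`. As `W` need not contain the constants, it is written as the
operator `mul A ^ (a - 1)` applied to `A`. -/
noncomputable def pow (Λ a : ℝ) (A : W) : W := binomPow Λ (a - 1) (𝓜.mul A) A

variable {𝓜}

theorem eval_pow [CompleteSpace 𝔸] (a : ℝ) (hq : 0 ≤ q) (hqΛ : q < Λ)
    (hA : ∀ᵐ x ∂μ, ‖𝓜.eval A x - Λ • (1 : 𝔸)‖ ≤ q) :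
    𝓜.eval (𝓜.pow Λ a A) =ᵐ[μ] fun x => binomPow Λ a (𝓜.eval A x) := by
  filter_upwards [isMultiplication_binomPow_mul (a - 1) hq hqΛ hA A, hA] with x hx hAx
  have hmul := binomPow_mul_binomPow (a - 1) 1 (hAx.trans_lt hqΛ)
  rw [binomPow_one (hq.trans_lt hqΛ).ne', sub_add_cancel] at hmul
  rw [pow, hx, hmul]

theorem contDiffOn_pow {k : WithTop ℕ∞} {I : Set ℝ} {A : ℝ → W} (a : ℝ) (hq : 0 ≤ q) (hqΛ : q < Λ)
    (hA : ContDiffOn ℝ k A I) (hAΛ : ∀ t ∈ I, ∀ᵐ x ∂μ, ‖𝓜.eval (A t) x - Λ • (1 : 𝔸)‖ ≤ q) :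
    ContDiffOn ℝ k (fun t => 𝓜.pow Λ a (A t)) I := fun t ht => by
  have hpow : ContDiffWithinAt ℝ k (fun s => binomPow Λ (a - 1) (𝓜.mul (A s))) I t :=
    ContDiffAt.comp_contDiffWithinAt (g := binomPow Λ (a - 1)) t
      (analyticAt_binomPow_mul (a - 1) hq hqΛ (hAΛ t ht)).contDiffAt
      (𝓜.mul.contDiff.comp_contDiffWithinAt (hA t ht))
  exact hpow.clm_apply (hA t ht)

end Pow

section Deriv

variable {I : Set ℝ} {F G H : ℝ → W} {t : ℝ}

theorem derivWithin_ae_eq_of_eqOn_mul {h : ℝ → Lp 𝔸 ∞ μ} (ht : t ∈ I)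
    (hF : DifferentiableWithinAt ℝ F I t) (hG : DifferentiableWithinAt ℝ G I t)
    (hFG : EqOn h (fun s => 𝓜.toLinfty (𝓜.mul (F s) (G s))) I) :
    ⇑(derivWithin h I t) =ᵐ[μ] fun x => 𝓜.eval (F t) x * 𝓜.eval (derivWithin G I t) x +
      𝓜.eval (derivWithin F I t) x * 𝓜.eval (G t) x := by
  have hderiv : derivWithin h I t =
      𝓜.toLinfty (𝓜.mul (F t) (derivWithin G I t) + 𝓜.mul (derivWithin F I t) (G t)) := by
    by_cases hI : UniqueDiffWithinAt ℝ I t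
    · rw [derivWithin_congr hFG (hFG ht)]
      exact (𝓜.toLinfty.hasFDerivAt.comp_hasDerivWithinAt t (𝓜.mul.hasDerivWithinAt_of_bilinear
        hF.hasDerivWithinAt hG.hasDerivWithinAt)).derivWithin hI
    · simp [derivWithin_zero_of_not_uniqueDiffWithinAt hI]
  rw [hderiv]
  filter_upwards [𝓜.coeFn_toLinfty
    (𝓜.mul (F t) (derivWithin G I t) + 𝓜.mul (derivWithin F I t) (G t)),
    𝓜.eval_add (𝓜.mul (F t) (derivWithin G I t)) (𝓜.mul (derivWithin F I t) (G t)),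
    𝓜.eval_mul (F t) (derivWithin G I t), 𝓜.eval_mul (derivWithin F I t) (G t)]
    with x hx hadd hFdG hdFG
  rw [hx, hadd, Pi.add_apply, hFdG, hdFG]

theorem eval_derivWithin_of_eval_mul (ht : t ∈ I) (hF : DifferentiableWithinAt ℝ F I t)
    (hG : DifferentiableWithinAt ℝ G I t) (hH : DifferentiableWithinAt ℝ H I t)
    (hFG : ∀ s ∈ I, 𝓜.eval (H s) =ᵐ[μ] fun x => 𝓜.eval (F s) x * 𝓜.eval (G s) x) :
    𝓜.eval (derivWithin H I t) =ᵐ[μ] fun x => 𝓜.eval (F t) x * 𝓜.eval (derivWithin G I t) x +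
      𝓜.eval (derivWithin F I t) x * 𝓜.eval (G t) x := by
  have hderiv : derivWithin (fun s => 𝓜.toLinfty (H s)) I t = 𝓜.toLinfty (derivWithin H I t) := by
    by_cases hI : UniqueDiffWithinAt ℝ I t
    · exact (𝓜.toLinfty.hasFDerivAt.comp_hasDerivWithinAt t hH.hasDerivWithinAt).derivWithin hI
    · simp [derivWithin_zero_of_not_uniqueDiffWithinAt hI]
  refine ((𝓜.coeFn_toLinfty _).symm.trans (hderiv ▸ ?_))
  exact derivWithin_ae_eq_of_eqOn_mul ht hF hG fun s hs =>
    𝓜.toLinfty_eq_iff.2 ((hFG s hs).trans (𝓜.eval_mul _ _).symm)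

theorem eval_derivWithin_of_eval_mul_eq_one (ht : t ∈ I) (hF : DifferentiableWithinAt ℝ F I t)
    (hG : DifferentiableWithinAt ℝ G I t)
    (hFG : ∀ s ∈ I, ∀ᵐ x ∂μ, 𝓜.eval (F s) x * 𝓜.eval (G s) x = 1 ∧
      𝓜.eval (G s) x * 𝓜.eval (F s) x = 1) :
    𝓜.eval (derivWithin F I t) =ᵐ[μ]
      fun x => -(𝓜.eval (F t) x * 𝓜.eval (derivWithin G I t) x * 𝓜.eval (F t) x) := by
  have hconst : EqOn (fun _ => 𝓜.toLinfty (𝓜.mul (F t) (G t)))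
      (fun s => 𝓜.toLinfty (𝓜.mul (F s) (G s))) I := fun s hs => by
    refine 𝓜.toLinfty_eq_iff.2 ?_
    filter_upwards [𝓜.eval_mul (F t) (G t), 𝓜.eval_mul (F s) (G s), hFG t ht, hFG s hs]
      with x hmul_t hmul_s hone_t hone_s
    rw [hmul_t, hmul_s, hone_t.1, hone_s.1]
  filter_upwards [derivWithin_ae_eq_of_eqOn_mul ht hF hG hconst, Lp.coeFn_zero 𝔸 ∞ μ, hFG t ht]
    with x hx hzero hone
  rw [derivWithin_fun_const, Pi.zero_apply, hzero, Pi.zero_apply] at hx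
  set f := 𝓜.eval (F t) x
  set g := 𝓜.eval (G t) x
  set f' := 𝓜.eval (derivWithin F I t) x
  calc f' = f' * g * f := by rw [mul_assoc, hone.2, mul_one]
    _ = -(f * 𝓜.eval (derivWithin G I t) x) * f := by rw [eq_neg_of_add_eq_zero_right hx.symm]
    _ = -(f * 𝓜.eval (derivWithin G I t) x * f) := neg_mul _ _

end Deriv

section Path

variable [CompleteSpace 𝔸] [CompleteSpace W] {Λ q : ℝ} {I : Set ℝ} {A : ℝ → W} {t : ℝ}

theorem sylvester_derivWithin_pow_half (hq : 0 ≤ q) (hqΛ : q < Λ) (hA : ContDiffOn ℝ 1 A I)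
    (hAΛ : ∀ t ∈ I, ∀ᵐ x ∂μ, ‖𝓜.eval (A t) x - Λ • (1 : 𝔸)‖ ≤ q) (ht : t ∈ I) :
    ∀ᵐ x ∂μ, ∀ X : 𝔸,
      𝓜.eval (𝓜.pow Λ (1 / 2) (A t)) x * X + X * 𝓜.eval (𝓜.pow Λ (1 / 2) (A t)) x =
          𝓜.eval (derivWithin A I t) x ↔
        X = 𝓜.eval (derivWithin (fun s => 𝓜.pow Λ (1 / 2) (A s)) I t) x := by
  have hS := (contDiffOn_pow (𝓜 := 𝓜) (1 / 2) hq hqΛ hA hAΛ).differentiableOn one_ne_zero t ht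
  have hSS (s : ℝ) (hs : s ∈ I) : 𝓜.eval (A s) =ᵐ[μ] fun x =>
      𝓜.eval (𝓜.pow Λ (1 / 2) (A s)) x * 𝓜.eval (𝓜.pow Λ (1 / 2) (A s)) x := by
    filter_upwards [eval_pow (1 / 2) hq hqΛ (hAΛ s hs), hAΛ s hs] with x hx hAx
    rw [hx, binomPow_half_mul_self (hAx.trans_lt hqΛ)]
  filter_upwards [eval_pow (1 / 2) hq hqΛ (hAΛ t ht), hAΛ t ht,
    eval_derivWithin_of_eval_mul ht hS hS (hA.differentiableOn one_ne_zero t ht) hSS]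
    with x hx hAx hdA X
  rw [hx] at hdA ⊢
  exact binomPow_half_mul_add_eq_iff (hAx.trans_lt hqΛ) hdA

theorem eval_pow_neg_mul_eval_pow (a : ℝ) (hq : 0 ≤ q) (hqΛ : q < Λ) {A : W}
    (hA : ∀ᵐ x ∂μ, ‖𝓜.eval A x - Λ • (1 : 𝔸)‖ ≤ q) :
    ∀ᵐ x ∂μ, 𝓜.eval (𝓜.pow Λ (-a) A) x * 𝓜.eval (𝓜.pow Λ a A) x = 1 ∧
      𝓜.eval (𝓜.pow Λ a A) x * 𝓜.eval (𝓜.pow Λ (-a) A) x = 1 := by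
  filter_upwards [eval_pow a hq hqΛ hA, eval_pow (-a) hq hqΛ hA, hA] with x hx hxneg hAx
  rw [hx, hxneg]
  exact ⟨binomPow_neg_mul_self a (hAx.trans_lt hqΛ),
    binomPow_mul_binomPow_neg a (hAx.trans_lt hqΛ)⟩

theorem eval_derivWithin_pow_neg (a : ℝ) (hq : 0 ≤ q) (hqΛ : q < Λ) (hA : ContDiffOn ℝ 1 A I)
    (hAΛ : ∀ t ∈ I, ∀ᵐ x ∂μ, ‖𝓜.eval (A t) x - Λ • (1 : 𝔸)‖ ≤ q) (ht : t ∈ I) :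
    𝓜.eval (derivWithin (fun s => 𝓜.pow Λ (-a) (A s)) I t) =ᵐ[μ] fun x =>
      -(𝓜.eval (𝓜.pow Λ (-a) (A t)) x *
        𝓜.eval (derivWithin (fun s => 𝓜.pow Λ a (A s)) I t) x *
        𝓜.eval (𝓜.pow Λ (-a) (A t)) x) :=
  eval_derivWithin_of_eval_mul_eq_one ht
    ((contDiffOn_pow (-a) hq hqΛ hA hAΛ).differentiableOn one_ne_zero t ht)
    ((contDiffOn_pow a hq hqΛ hA hAΛ).differentiableOn one_ne_zero t ht)
    fun s hs => eval_pow_neg_mul_eval_pow a hq hqΛ (hAΛ s hs)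

end Path

end MultiplierSpace

/-! ### Bounded pairs of `L^p` functions under the Leibniz rule -/

section LInfty

variable {α : Type*} [MeasurableSpace α] {μ : Measure α} {p : ℝ≥0∞} {𝔸 X Y : Type*} [NormedRing 𝔸]
  [NormedAlgebra ℝ 𝔸] [NormedAddCommGroup X] [NormedSpace ℝ X] [NormedAddCommGroup Y]
  [NormedSpace ℝ Y]

theorem norm_holder_sub_smul_le {L : 𝔸 →L[ℝ] Y →L[ℝ] Y} (hL : ∀ a y, ‖L a y‖ ≤ ‖a‖ * ‖y‖)
    (hL_one : ∀ y, L 1 y = y) {a : Lp 𝔸 ∞ μ} {c q : ℝ}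
    (ha : ∀ᵐ x ∂μ, ‖a x - c • (1 : 𝔸)‖ ≤ q) (f : Lp Y p μ) :
    ‖L.holder p a f - c • f‖ ≤ q * ‖f‖ := by
  refine Lp.norm_le_mul_norm_of_ae_le_mul ?_
  filter_upwards [ha, L.coeFn_holder (r := p) a f, Lp.coeFn_sub (L.holder p a f) (c • f),
    Lp.coeFn_smul c f] with x hax hholder hsub hsmul
  have hx : (L.holder p a f - c • f) x = L (a x - c • (1 : 𝔸)) (f x) := by
    rw [hsub, Pi.sub_apply, hholder, hsmul, Pi.smul_apply, map_sub, map_smul, sub_apply,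
      _root_.smul_apply, hL_one]
  rw [hx]
  exact (hL _ _).trans (by gcongr)

variable [Fact (1 ≤ p)]

/-- The factorization through `L^∞` of a linear map into `L^p` with essentially bounded values. -/
noncomputable def toLinftyOfBound (f : X →L[ℝ] Lp Y p μ) {C : ℝ} (hC : 0 ≤ C)
    (hf : ∀ u, ∀ᵐ x ∂μ, ‖f u x‖ ≤ C * ‖u‖) : X →L[ℝ] Lp Y ∞ μ :=
  have hmem (u : X) : MemLp (f u) ∞ μ := memLp_top_of_bound (Lp.aestronglyMeasurable _) _ (hf u)
  LinearMap.mkContinuous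
    { toFun u := (hmem u).toLp (f u)
      map_add' u w := by
        rw [← MemLp.toLp_add]
        exact MemLp.toLp_congr _ _ (map_add f u w ▸ Lp.coeFn_add (f u) (f w))
      map_smul' c u := by
        rw [RingHom.id_apply, ← MemLp.toLp_const_smul]
        exact MemLp.toLp_congr _ _ (map_smul f c u ▸ Lp.coeFn_smul c (f u)) }
    C fun u => by
      refine (Lp.norm_toLp _ (hmem u)).trans_le (ENNReal.toReal_le_of_le_ofReal (by positivity) ?_)
      rw [eLpNorm_exponent_top]
      exact eLpNormEssSup_le_of_ae_bound (hf u)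

theorem coeFn_toLinftyOfBound (f : X →L[ℝ] Lp Y p μ) {C : ℝ} (hC : 0 ≤ C)
    (hf : ∀ u, ∀ᵐ x ∂μ, ‖f u x‖ ≤ C * ‖u‖) (u : X) :
    toLinftyOfBound f hC hf u =ᵐ[μ] f u :=
  MemLp.coeFn_toLp (memLp_top_of_bound (Lp.aestronglyMeasurable _) _ (hf u))

end LInfty

section Pairs

variable {α : Type*} [MeasurableSpace α] {μ : Measure α} {p : ℝ≥0∞} [Fact (1 ≤ p)]
  {𝔸 Y : Type*} [NormedRing 𝔸] [NormedAlgebra ℝ 𝔸] [NormedAddCommGroup Y] [NormedSpace ℝ Y]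
  {W : Submodule ℝ (WithLp 1 (Lp 𝔸 p μ × Lp Y p μ))}

variable (W) in
/-- The first component of a pair. -/
noncomputable def pairFst : W →L[ℝ] Lp 𝔸 p μ := WithLp.fstL 1 ℝ _ _ ∘L W.subtypeL

variable (W) in
/-- The second component of a pair. -/
noncomputable def pairSnd : W →L[ℝ] Lp Y p μ := WithLp.sndL 1 ℝ _ _ ∘L W.subtypeL

theorem norm_pair (u : W) : ‖u‖ = ‖pairFst W u‖ + ‖pairSnd W u‖ := WithLp.prod_norm_eq_of_L1 _

variable (L R : 𝔸 →L[ℝ] Y →L[ℝ] Y) (ι : W →L[ℝ] Lp 𝔸 ∞ μ)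

/-- The product `(F, G) * (F', G') = (F F', L F G' + R F' G)` of pairs; the factors that stand
on the left are taken in `L^∞` through `ι`. -/
noncomputable def pairMul : W →L[ℝ] W →L[ℝ] WithLp 1 (Lp 𝔸 p μ × Lp Y p μ) :=
  let ofProd : Lp 𝔸 p μ × Lp Y p μ →L[ℝ] WithLp 1 (Lp 𝔸 p μ × Lp Y p μ) :=
    (WithLp.prodContinuousLinearEquiv 1 ℝ (Lp 𝔸 p μ) (Lp Y p μ)).symm.toContinuousLinearMap
  ContinuousLinearMap.compL ℝ W _ _ (ofProd ∘L .inl ℝ _ _) ∘L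
      ((ContinuousLinearMap.mul ℝ 𝔸).holderL μ ∞ p p).bilinearComp ι (pairFst W) +
    ContinuousLinearMap.compL ℝ W _ _ (ofProd ∘L .inr ℝ _ _) ∘L
      ((L.holderL μ ∞ p p).bilinearComp ι (pairSnd W) +
        ((R.holderL μ ∞ p p).bilinearComp ι (pairSnd W)).flip)

theorem fst_pairMul (u w : W) :
    (pairMul L R ι u w).fst = (ContinuousLinearMap.mul ℝ 𝔸).holder p (ι u) (pairFst W w) := by
  simp [pairMul]

theorem snd_pairMul (u w : W) :
    (pairMul L R ι u w).snd = L.holder p (ι u) (pairSnd W w) + R.holder p (ι w) (pairSnd W u) := by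
  simp [pairMul]

variable {ι}

theorem coeFn_fst_pairMul (hι : ∀ u : W, ι u =ᵐ[μ] pairFst W u) (u w : W) :
    (pairMul L R ι u w).fst =ᵐ[μ] fun x => pairFst W u x * pairFst W w x := by
  rw [fst_pairMul]
  filter_upwards [(ContinuousLinearMap.mul ℝ 𝔸).coeFn_holder (r := p) (ι u) (pairFst W w), hι u]
    with x hx hu
  rw [hx, hu, ContinuousLinearMap.mul_apply']

theorem coeFn_snd_pairMul (hι : ∀ u : W, ι u =ᵐ[μ] pairFst W u) (u w : W) :
    (pairMul L R ι u w).snd =ᵐ[μ]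
      fun x => L (pairFst W u x) (pairSnd W w x) + R (pairFst W w x) (pairSnd W u x) := by
  rw [snd_pairMul]
  filter_upwards [Lp.coeFn_add (L.holder p (ι u) (pairSnd W w)) (R.holder p (ι w) (pairSnd W u)),
    L.coeFn_holder (r := p) (ι u) (pairSnd W w), R.coeFn_holder (r := p) (ι w) (pairSnd W u),
    hι u, hι w] with x hadd hL hR hu hw
  rw [hadd, Pi.add_apply, hL, hR, hu, hw]

variable {L}

theorem norm_pairMul_sub_smul_le (hL : ∀ a y, ‖L a y‖ ≤ ‖a‖ * ‖y‖) (hL_one : ∀ y, L 1 y = y) {A : W}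
    {c q : ℝ} (hA : ∀ᵐ x ∂μ, ‖ι A x - c • (1 : 𝔸)‖ ≤ q) (u : W) :
    ‖pairMul L R ι A u - c • (u : WithLp 1 (Lp 𝔸 p μ × Lp Y p μ))‖ ≤
      q * ‖u‖ + ‖R‖ * ‖pairSnd W A‖ * ‖ι u‖ := by
  have hfst : (pairMul L R ι A u - c • u.1).fst =
      (ContinuousLinearMap.mul ℝ 𝔸).holder p (ι A) (pairFst W u) - c • pairFst W u := by
    rw [WithLp.sub_fst, fst_pairMul, WithLp.smul_fst]
    rfl
  have hsnd : (pairMul L R ι A u - c • u.1).snd =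
      (L.holder p (ι A) (pairSnd W u) - c • pairSnd W u) + R.holder p (ι u) (pairSnd W A) := by
    rw [WithLp.sub_snd, snd_pairMul, WithLp.smul_snd, add_sub_right_comm]
    rfl
  calc ‖pairMul L R ι A u - c • u.1‖
      ≤ q * ‖pairFst W u‖ + (q * ‖pairSnd W u‖ + ‖R‖ * ‖ι u‖ * ‖pairSnd W A‖) := by
        rw [WithLp.prod_norm_eq_of_L1, hfst, hsnd]
        exact add_le_add
          (norm_holder_sub_smul_le (L := .mul ℝ 𝔸) norm_mul_le one_mul hA (pairFst W u))
          (norm_add_le_of_le (norm_holder_sub_smul_le hL hL_one hA (pairSnd W u))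
            (ContinuousLinearMap.norm_holder_apply_apply_le _ _ _))
    _ = q * ‖u‖ + ‖R‖ * ‖pairSnd W A‖ * ‖ι u‖ := by
        rw [norm_pair]
        ring

/-- A space of pairs with bounded first component that is closed under the Leibniz product is a
space of multipliers. -/
noncomputable def MultiplierSpace.ofPairs (R : 𝔸 →L[ℝ] Y →L[ℝ] Y)
    (hL : ∀ a y, ‖L a y‖ ≤ ‖a‖ * ‖y‖) (hL_one : ∀ y, L 1 y = y) {C : ℝ} (hC : 0 ≤ C)
    (hWC : ∀ u : W, ∀ᵐ x ∂μ, ‖pairFst W u x‖ ≤ C * ‖u‖)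
    (hW : ∀ (u w : W) (z : WithLp 1 (Lp 𝔸 p μ × Lp Y p μ)),
      (z.fst =ᵐ[μ] fun x => pairFst W u x * pairFst W w x) →
      (z.snd =ᵐ[μ] fun x =>
        L (pairFst W u x) (pairSnd W w x) + R (pairFst W w x) (pairSnd W u x)) → z ∈ W) :
    MultiplierSpace μ 𝔸 W :=
  let ι := toLinftyOfBound (pairFst W) hC hWC
  have hι : ∀ u, ι u =ᵐ[μ] pairFst W u := coeFn_toLinftyOfBound (pairFst W) hC hWC
  have hmem (u w : W) : pairMul L R ι u w ∈ W :=
    hW u w _ (coeFn_fst_pairMul L R hι u w) (coeFn_snd_pairMul L R hι u w)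
  { eval u := pairFst W u
    toLinfty := ι
    coeFn_toLinfty := hι
    mul := LinearMap.mkContinuous₂
      (LinearMap.mk₂ ℝ (fun u w => ⟨pairMul L R ι u w, hmem u w⟩)
        (fun u u' w => Subtype.ext (by simp)) (fun c u w => Subtype.ext (by simp))
        (fun u w w' => Subtype.ext (by simp)) (fun c u w => Subtype.ext (by simp)))
      ‖pairMul L R ι‖ (pairMul L R ι).le_opNorm₂
    eval_mul := coeFn_fst_pairMul L R hι
    exists_norm_mul_sub_smul_le A c q hA := by
      refine ⟨‖R‖ * ‖pairSnd W A‖, by positivity, norm_pairMul_sub_smul_le R hL hL_one ?_⟩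
      filter_upwards [hA, hι A] with x hx hιx
      rwa [hιx] }

end Pairs

/-! ### Symmetric endomorphisms of the spinor space -/

section Symmetric

variable {V : Type*} [NormedAddCommGroup V] [InnerProductSpace ℝ V] {B : EndSpinor V}

theorem norm_le_of_isSymmetric {c : ℝ} (hc : 0 ≤ c) (hB : B.IsSymmetric)
    (h : ∀ v, |inner ℝ (B v) v| ≤ c * ‖v‖ ^ 2) : ‖B‖ ≤ c := by
  rw [ContinuousLinearMap.norm_eq_iSup_rayleighQuotient B hB]
  refine ciSup_le fun v => ?_
  rw [ContinuousLinearMap.rayleighQuotient, abs_div, abs_sq]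
  exact div_le_of_le_mul₀ (by positivity) hc (h v)

theorem norm_sub_smul_one_le {Λ₁ Λ₂ : ℝ} (hΛ : Λ₁ ≤ Λ₂) (hB : B.IsSymmetric)
    (hlower : Λ₁ • (1 : EndSpinor V) ≤ B) (hupper : B ≤ Λ₂ • (1 : EndSpinor V)) :
    ‖B - Λ₂ • (1 : EndSpinor V)‖ ≤ Λ₂ - Λ₁ := by
  refine norm_le_of_isSymmetric (sub_nonneg.2 hΛ) (hB.sub (LinearMap.IsSymmetric.one.smul rfl))
    fun v => ?_
  have hlow := ((ContinuousLinearMap.le_def _ _).1 hlower).inner_nonneg_left v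
  have hupp := ((ContinuousLinearMap.le_def _ _).1 hupper).inner_nonneg_left v
  simp only [sub_apply, _root_.smul_apply, one_apply_eq_self, inner_sub_left, real_inner_smul_left,
    real_inner_self_eq_norm_sq] at hlow hupp ⊢
  rw [abs_of_nonpos (by linarith)]
  linarith

theorem isPositive_binomPow_half [CompleteSpace V] {Λ : ℝ} (hB : B.IsSymmetric)
    (hBΛ : ‖B - Λ • (1 : EndSpinor V)‖ < Λ) : (binomPow Λ (1 / 2) B).IsPositive := by
  have hsa : IsSelfAdjoint (binomPow Λ (1 / 4) B) :=
    isSelfAdjoint_binomPow Λ _ (ContinuousLinearMap.isSelfAdjoint_iff_isSymmetric.2 hB)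
  have hsq : binomPow Λ (1 / 2) B = star (binomPow Λ (1 / 4) B) * binomPow Λ (1 / 4) B := by
    rw [hsa.star_eq, binomPow_mul_binomPow _ _ hBΛ]
    norm_num
  rw [hsq]
  exact ContinuousLinearMap.isPositive_adjoint_comp_self _

end Symmetric

/-! ### The algebra `W^{1,p}(M, End(Σ_g M))` -/

section SobolevAlgebra

variable {n : ℕ} {M : Type*} [TopologicalSpace M] [ChartedSpace (E n) M]
  [IsManifold (𝓡 n) ∞ M] [MeasurableSpace M] [BorelSpace M] {g : RMetric n M}
  {V : Type*} [NormedAddCommGroup V] [InnerProductSpace ℝ V] {p : ℝ≥0∞}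

theorem SpinorRep.finiteDimensional (κ : SpinorRep n V) : FiniteDimensional ℝ V :=
  Module.finite_of_finrank_pos (by rw [κ.finrank_eq]; positivity)

namespace SpinStructure

variable {σ : SpinStructure g} {κ : SpinorRep n V} {Λ₁ Λ₂ : ℝ} {A : σ.W1p κ p}

variable [Fact (1 ≤ p)] {𝓜 : MultiplierSpace (vol g) (EndSpinor V) (σ.W1p κ p)}

theorem ae_norm_eval_sub_smul_one_le (h𝓜 : 𝓜.eval = sec) (hΛ : Λ₁ ≤ Λ₂)
    (hA : A ∈ σ.admissible κ p Λ₁ Λ₂) :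
    ∀ᵐ x ∂vol g, ‖𝓜.eval A x - Λ₂ • (1 : EndSpinor V)‖ ≤ Λ₂ - Λ₁ := by
  rw [h𝓜]
  filter_upwards [hA] with x ⟨hsymm, hlower, hupper⟩
  exact norm_sub_smul_one_le hΛ hsymm hlower hupper

theorem isSqrt_pow_half [CompleteSpace V] [CompleteSpace (σ.W1p κ p)] (h𝓜 : 𝓜.eval = sec)
    (hΛ₁ : 0 < Λ₁)
    (hΛ : Λ₁ ≤ Λ₂) (hA : A ∈ σ.admissible κ p Λ₁ Λ₂) : IsSqrt (𝓜.pow Λ₂ (1 / 2) A) A := by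
  have hqΛ : Λ₂ - Λ₁ < Λ₂ := sub_lt_self Λ₂ hΛ₁
  have hclose := ae_norm_eval_sub_smul_one_le h𝓜 hΛ hA
  have hpow : sec (𝓜.pow Λ₂ (1 / 2) A) =ᵐ[vol g] fun x => binomPow Λ₂ (1 / 2) (sec A x) :=
    h𝓜 ▸ 𝓜.eval_pow (1 / 2) (sub_nonneg.2 hΛ) hqΛ hclose
  rw [h𝓜] at hclose
  filter_upwards [hpow, hclose, hA] with x hpow_x hclose_x hA_x
  rw [hpow_x]
  exact ⟨isPositive_binomPow_half hA_x.1 (hclose_x.trans_lt hqΛ),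
    binomPow_half_mul_self (hclose_x.trans_lt hqΛ)⟩

theorem isInv_pow_neg_half [CompleteSpace V] [CompleteSpace (σ.W1p κ p)] (h𝓜 : 𝓜.eval = sec)
    (hΛ₁ : 0 < Λ₁) (hΛ : Λ₁ ≤ Λ₂) (hA : A ∈ σ.admissible κ p Λ₁ Λ₂) :
    IsInv (𝓜.pow Λ₂ (-(1 / 2)) A) (𝓜.pow Λ₂ (1 / 2) A) := by
  simp only [IsInv, ← h𝓜]
  exact 𝓜.eval_pow_neg_mul_eval_pow _ (sub_nonneg.2 hΛ) (sub_lt_self Λ₂ hΛ₁)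
    (ae_norm_eval_sub_smul_one_le h𝓜 hΛ hA)

variable (σ κ) in
theorem exists_multiplierSpace [CompactSpace M] (hp : (n : ℝ≥0∞) < p) (hp_top : p ≠ ⊤) :
    ∃ 𝓜 : MultiplierSpace (vol g) (EndSpinor V) (σ.W1p κ p), 𝓜.eval = sec := by
  have : FiniteDimensional ℝ V := κ.finiteDimensional
  have : CompleteSpace V := FiniteDimensional.complete ℝ V
  obtain ⟨C, hC_nonneg, hC⟩ := σ.exists_norm_sec_le κ hp hp_top
  exact ⟨.ofPairs (L := formMulLeft (E n) (EndSpinor V)) (formMulRight (E n) (EndSpinor V))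
    norm_formMulLeft_le formMulLeft_one hC_nonneg hC fun u w z hfst hsnd =>
      (HasWeakCovDeriv.mul u.2 w.2 (hC u) (hC w)).congr hfst.symm hsnd.symm, rfl⟩

end SpinStructure

end SobolevAlgebra

end SpinGeom

open SpinGeom SpinGeom.SpinStructure in
theorem mainTheorem6_general {n : ℕ} {M : Type*} [TopologicalSpace M] [CompactSpace M]
    [ChartedSpace (E n) M] [IsManifold (𝓡 n) ∞ M] [MeasurableSpace M] [BorelSpace M]
    (g : RMetric n M) (σ : SpinStructure g)
    {V : Type*} [NormedAddCommGroup V] [InnerProductSpace ℝ V] (κ : SpinorRep n V)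
    (p : ℝ≥0∞) [Fact (1 ≤ p)] (hp : (n : ℝ≥0∞) < p) (hp_top : p ≠ ⊤)
    (Λ₁ Λ₂ : ℝ) (hΛ₁ : 0 < Λ₁) (hΛ : Λ₁ ≤ Λ₂)
    (I : Set ℝ) (A : ℝ → σ.W1p κ p) (hA : ContDiffOn ℝ 1 A I)
    (hP : ∀ t ∈ I, A t ∈ σ.admissible κ p Λ₁ Λ₂) :
    ∃ S Q : ℝ → σ.W1p κ p,
      (∀ t ∈ I, IsSqrt (S t) (A t) ∧ IsInv (Q t) (S t)) ∧
      ContDiffOn ℝ 1 S I ∧ ContDiffOn ℝ 1 Q I ∧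
      ∀ t ∈ I,
        (∀ᵐ x ∂vol g, ∀ X : EndSpinor V,
          sec (S t) x * X + X * sec (S t) x = sec (derivWithin A I t) x ↔
            X = sec (derivWithin S I t) x) ∧
        (∀ᵐ x ∂vol g, sec (derivWithin Q I t) x =
          -(sec (Q t) x * sec (derivWithin S I t) x * sec (Q t) x)) := by
  have : FiniteDimensional ℝ V := κ.finiteDimensional
  have : CompleteSpace V := FiniteDimensional.complete ℝ V
  have : CompleteSpace (σ.W1p κ p) := σ.completeSpace_W1p κ hp_top
  have hmultiplier := σ.exists_multiplierSpace κ hp hp_top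
  obtain ⟨𝓜, h𝓜⟩ := hmultiplier
  have hq : 0 ≤ Λ₂ - Λ₁ := sub_nonneg.2 hΛ
  have hqΛ : Λ₂ - Λ₁ < Λ₂ := sub_lt_self Λ₂ hΛ₁
  have hclose (t : ℝ) (ht : t ∈ I) :
      ∀ᵐ x ∂vol g, ‖𝓜.eval (A t) x - Λ₂ • (1 : EndSpinor V)‖ ≤ Λ₂ - Λ₁ :=
    ae_norm_eval_sub_smul_one_le h𝓜 hΛ (hP t ht)
  refine ⟨fun t => 𝓜.pow Λ₂ (1 / 2) (A t), fun t => 𝓜.pow Λ₂ (-(1 / 2)) (A t),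
    fun t ht => ⟨isSqrt_pow_half h𝓜 hΛ₁ hΛ (hP t ht),
      isInv_pow_neg_half h𝓜 hΛ₁ hΛ (hP t ht)⟩,
    𝓜.contDiffOn_pow _ hq hqΛ hA hclose, 𝓜.contDiffOn_pow _ hq hqΛ hA hclose, ?_⟩
  simp only [← h𝓜]
  intro t ht
  exact ⟨𝓜.sylvester_derivWithin_pow_half hq hqΛ hA hclose ht,
      𝓜.eval_derivWithin_pow_neg _ hq hqΛ hA hclose ht⟩

open SpinGeom SpinGeom.SpinStructure in
theorem mainTheorem6 {n : ℕ} {M : Type*} [TopologicalSpace M] [T2Space M] [CompactSpace M]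
    [ChartedSpace (E n) M] [IsManifold (𝓡 n) ∞ M] [MeasurableSpace M] [BorelSpace M]
    (g : RMetric n M) (σ : SpinStructure g)
    {V : Type*} [NormedAddCommGroup V] [InnerProductSpace ℝ V] (κ : SpinorRep n V)
    (p : ℝ≥0∞) [Fact (1 ≤ p)] (hp : (n : ℝ≥0∞) < p) (hp_top : p ≠ ⊤)
    (Λ₁ Λ₂ : ℝ) (hΛ₁ : 0 < Λ₁) (hΛ : Λ₁ ≤ Λ₂)
    (I : Set ℝ) (hI : I.OrdConnected)
    (A : ℝ → σ.W1p κ p) (hA : ContDiffOn ℝ 1 A I)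
    (hP : ∀ t ∈ I, A t ∈ σ.admissible κ p Λ₁ Λ₂) :
    ∃ S Q : ℝ → σ.W1p κ p,
      (∀ t ∈ I, IsSqrt (S t) (A t) ∧ IsInv (Q t) (S t)) ∧
      ContDiffOn ℝ 1 S I ∧ ContDiffOn ℝ 1 Q I ∧
      ∀ t ∈ I,
        (∀ᵐ x ∂vol g, ∀ X : EndSpinor V,
          sec (S t) x * X + X * sec (S t) x = sec (derivWithin A I t) x ↔
            X = sec (derivWithin S I t) x) ∧
        (∀ᵐ x ∂vol g, sec (derivWithin Q I t) x =
          -(sec (Q t) x * sec (derivWithin S I t) x * sec (Q t) x)) :=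
  mainTheorem6_general g σ κ p hp hp_top Λ₁ Λ₂ hΛ₁ hΛ I A hA hP
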